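/- Let $k$ be a field of characteristic $\neq 2$. \textbf{Hurwitz and para-Hurwitz superalgebras.} A quadratic superform on a $\mathbb Z_2$-graded $k$-vector space $U=U_{\bar 0}\oplus U_{\bar 1}$ is a pair $q=(q_{\bar 0},\mathrm b)$, where $q_{\bar 0}$ is a quadratic form on $U_{\bar 0}$ and $\mathrm b$ is a supersymmetric even bilinear form on $U$ that restricts on $U_{\bar 0}$ to the polar form of $q_{\bar 0}$. It is regular if $\mathrm b$ is nondegenerate on $U_{\bar 0}$ and on $U_{\bar 1}$. A Hurwitz superalgebra is a nonzero unital (not necessarily associative) superalgebra $C=C_{\bar 0}\oplus C_{\bar 1}$ over $k$ with a regular quadratic superform $q$ such that $$q_{\bar 0}(x_{\bar 0}y_{\bar 0})=q_{\bar 0}(x_{\bar 0})q_{\bar 0}(y_{\bar 0}),\qquad \mathrm b(x_{\bar 0}y,x_{\bar 0}z)=q_{\bar 0}(x_{\bar 0})\mathrm b(y,z)=\mathrm b(yx_{\bar 0},zx_{\bar 0}),$$ $$\mathrm b(xy,zt)+(-1)^{|x||y|+|x||z|+|y||z|}\mathrm b(zy,xt)=(-1)^{|y||z|}\mathrm b(x,z)\mathrm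 b(y,t)$$ for all $x_{\bar 0},y_{\bar 0}\in C_{\bar 0}$ and all homogeneous $x,y,z,t\in C$. If $C_{\bar 1}=0$, it is a Hurwitz algebra. Put $\bar x=\mathrm b(x,1)1-x$. The para-Hurwitz superalgebra $S$ attached to $C$ is the superspace $C$ with the same norm and with the product $x\bullet y=\bar x\,\bar y$. \textbf{The Jordan superalgebra and its derivations.} Let $J=H_3(C,*)$ be the superspace of $3\times 3$ matrices $(a_{ij})$ over $C$ with $a_{ij}=\overline{a_{ji}}$ for all $i,j$, with the Jordan product $x\circ y=\frac12\bigl(xy+(-1)^{|x||y|}yx\bigr)$. In $\mathrm{End}_k(J)$ let $[f,g]=fg-(-1)^{|f||g|}gf$ for homogeneous $f,g$. Let $\mathfrak{der}\,J=(\mathfrak{der}\,J)_{\bar 0}\oplus(\mathfrak{der}\,J)_{\bar 1}$, where $(\mathfrak{der}\,J)_{\bar\imath}$ consists of the linear maps $d$ of parity $\bar\imath$ with $d(x\circ y)=d(x)\circ y+(-1)^{i|x|}x\circ d(y)$ for all homogeneous $x,y\in J$. Let $\mathfrak{inder}\,J=[L_J,L_J]$ be the span of all supercommutators $[L_x,L_y]$,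 where $L_x(y)=x\circ y$. A Lie superalgebra is simple if it is not abelian and has no graded ideals other than $0$ and itself. \textbf{Statement.} Let $S$ be a para-Hurwitz superalgebra over $k$ and let $J=H_3(C,*)$ be the Jordan superalgebra of $3\times 3$ hermitian matrices over the associated Hurwitz superalgebra $C$. (1) Unless $\operatorname{char}k=3$ and $\dim_k S=2$, $\mathfrak{der}\,J$ is a simple Lie superalgebra, and $\mathfrak{der}\,J=\mathfrak{inder}\,J$. (2) If $\operatorname{char}k=3$ and $\dim_k S=2$, then $\mathfrak{inder}\,J=[\mathfrak{der}\,J,\mathfrak{der}\,J]$, and this is an ideal of codimension $1$ of the Lie superalgebra $\mathfrak{der}\,J$ which is simple as a Lie superalgebra. In particular this covers para-Hurwitz algebras ($C_{\bar 1}=0$), for which $J$ is a Jordan algebra and $\mathfrak{der}\,J$ a Lie algebra. -/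

import Mathlib

/-- The sign `(-1)^(i j)` attached to two parities, as an element of `k`. -/
def superSign (k : Type*) [Field k] (i j : ZMod 2) : k := if i = 1 ∧ j = 1 then -1 else 1

/-- A quadratic superform `q = (q₀, b)` on a `ℤ/2`-graded vector space. -/
structure QuadraticSuperform {k V : Type*} [Field k] [AddCommGroup V] [Module k V]
    (𝒱 : ZMod 2 → Submodule k V) where
  /-- the quadratic form on the even part -/
  q₀ : QuadraticForm k (𝒱 0)
  /-- the bilinear form on the whole space -/
  b : LinearMap.BilinForm k V
  /-- `b` is supersymmetric -/
  supersymmetric : ∀ i j : ZMod 2, ∀ x ∈ 𝒱 i, ∀ y ∈ 𝒱 j, b x y = superSign k i j * b y x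
  /-- `b` is even: the even and the odd part are orthogonal -/
  even : ∀ x ∈ 𝒱 0, ∀ y ∈ 𝒱 1, b x y = 0
  /-- on the even part `b` is the polar form of `q₀` -/
  polar : ∀ x y : 𝒱 0, b x y = q₀ (x + y) - q₀ x - q₀ y

/-- Regularity of a quadratic superform (characteristic different from `2`): the polar form
of `q₀` and the restriction of `b` to the odd part are both nondegenerate. -/
structure QuadraticSuperform.IsRegular {k V : Type*} [Field k] [AddCommGroup V] [Module k V]
    {𝒱 : ZMod 2 → Submodule k V} (N : QuadraticSuperform 𝒱) : Prop where
  nondegenerate_even : ∀ x ∈ 𝒱 0, (∀ y ∈ 𝒱 0, N.b x y = 0) → x = 0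
  nondegenerate_odd : ∀ x ∈ 𝒱 1, (∀ y ∈ 𝒱 1, N.b x y = 0) → x = 0

/-- A composition superalgebra: a (not necessarily associative) superalgebra with a regular
quadratic superform, the norm, that permits composition.  That `C` is the direct sum of `𝒞 0`
and `𝒞 1` is the instance `[DirectSum.Decomposition 𝒞]` wherever this is used. -/
structure IsCompositionSuperalgebra {k C : Type*} [Field k] [NonUnitalNonAssocRing C] [Module k C]
    (𝒞 : ZMod 2 → Submodule k C) (N : QuadraticSuperform 𝒞) : Prop where
  mul_mem : ∀ i j : ZMod 2, ∀ x ∈ 𝒞 i, ∀ y ∈ 𝒞 j, x * y ∈ 𝒞 (i + j)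
  regular : N.IsRegular
  norm_mul : ∀ x y z : 𝒞 0, (z : C) = x * y → N.q₀ z = N.q₀ x * N.q₀ y
  form_mul_left : ∀ (x : 𝒞 0) (y z : C), N.b (x * y) (x * z) = N.q₀ x * N.b y z
  form_mul_right : ∀ (x : 𝒞 0) (y z : C), N.b (y * x) (z * x) = N.q₀ x * N.b y z
  form_mul_mul : ∀ i j l m : ZMod 2, ∀ x ∈ 𝒞 i, ∀ y ∈ 𝒞 j, ∀ z ∈ 𝒞 l, ∀ t ∈ 𝒞 m,
    N.b (x * y) (z * t)
        + superSign k i j * superSign k i l * superSign k j l * N.b (z * y) (x * t)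
      = superSign k j l * (N.b x z * N.b y t)

/-- A Hurwitz superalgebra: a nonzero unital composition superalgebra.
A Hurwitz algebra is the case `𝒞 1 = ⊥`. -/
structure IsHurwitzSuperalgebra {k C : Type*} [Field k] [NonAssocRing C] [Module k C]
    (𝒞 : ZMod 2 → Submodule k C) (N : QuadraticSuperform 𝒞) : Prop
    extends IsCompositionSuperalgebra 𝒞 N where
  one_ne_zero : (1 : C) ≠ 0
  one_mem : (1 : C) ∈ 𝒞 0

/-- The standard involution `x ↦ b(x,1) 1 - x`. -/
def standardInvolution {k C : Type*} [Field k] [NonAssocRing C] [Module k C]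
    {𝒞 : ZMod 2 → Submodule k C} (N : QuadraticSuperform 𝒞) : C →ₗ[k] C :=
  (N.b.flip 1).smulRight (1 : C) - LinearMap.id

theorem standardInvolution_apply {k C : Type*} [Field k] [NonAssocRing C] [Module k C]
    {𝒞 : ZMod 2 → Submodule k C} (N : QuadraticSuperform 𝒞) (x : C) :
    standardInvolution N x = N.b x 1 • (1 : C) - x := rfl

/-- The superalgebra `S` is, through the identification `φ : S ≃ C` of vector spaces,
the para-Hurwitz superalgebra attached to the Hurwitz superalgebra `C`:
`S` has the grading and the norm of `C` and the product `x • y = x̄ ȳ`. -/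
structure IsParaHurwitzOf {k C S : Type*} [Field k] [NonAssocRing C] [Module k C]
    [NonUnitalNonAssocRing S] [Module k S]
    {𝒮 : ZMod 2 → Submodule k S} (NS : QuadraticSuperform 𝒮)
    {𝒞 : ZMod 2 → Submodule k C} (N : QuadraticSuperform 𝒞) (φ : S ≃ₗ[k] C) : Prop where
  hurwitz : IsHurwitzSuperalgebra 𝒞 N
  mem_iff : ∀ (i : ZMod 2) (x : S), x ∈ 𝒮 i ↔ φ x ∈ 𝒞 i
  map_mul : ∀ x y : S, φ (x * y) = standardInvolution N (φ x) * standardInvolution N (φ y)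
  form_eq : ∀ x y : S, NS.b x y = N.b (φ x) (φ y)
  norm_eq : ∀ (x : 𝒮 0) (y : 𝒞 0), φ x = y → NS.q₀ x = N.q₀ y

/-- The space of `3 × 3` matrices `X` over `C` with `X = X*`, where `(X*)ᵣₛ` is the
conjugate of `Xₛᵣ`. -/
def hermitianMatrices {k C : Type*} [Field k] [NonAssocRing C] [Module k C]
    {𝒞 : ZMod 2 → Submodule k C} (N : QuadraticSuperform 𝒞) :
    Submodule k (Matrix (Fin 3) (Fin 3) C) where
  carrier := {X | ∀ r s, standardInvolution N (X s r) = X r s}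
  add_mem' hX hY r s := by simp [hX r s, hY r s]
  zero_mem' r s := by simp
  smul_mem' c X hX r s := by simp [hX r s]

/-- The vector space `J` of hermitian `3 × 3` matrices over `C`, as a type. -/
def HermitianSpace {k C : Type*} [Field k] [NonAssocRing C] [Module k C]
    {𝒞 : ZMod 2 → Submodule k C} (N : QuadraticSuperform 𝒞) : Type _ :=
  hermitianMatrices N

instance {k C : Type*} [Field k] [NonAssocRing C] [Module k C]
    {𝒞 : ZMod 2 → Submodule k C} (N : QuadraticSuperform 𝒞) : AddCommGroup (HermitianSpace N) :=
  inferInstanceAs (AddCommGroup (hermitianMatrices N))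

instance {k C : Type*} [Field k] [NonAssocRing C] [Module k C]
    {𝒞 : ZMod 2 → Submodule k C} (N : QuadraticSuperform 𝒞) : Module k (HermitianSpace N) :=
  inferInstanceAs (Module k (hermitianMatrices N))

/-- The matrix underlying an element of `J`. -/
def HermitianSpace.toMatrix {k C : Type*} [Field k] [NonAssocRing C] [Module k C]
    {𝒞 : ZMod 2 → Submodule k C} (N : QuadraticSuperform 𝒞) :
    HermitianSpace N →ₗ[k] Matrix (Fin 3) (Fin 3) C :=
  (hermitianMatrices N).subtype

theorem HermitianSpace.toMatrix_injective {k C : Type*} [Field k] [NonAssocRing C] [Module k C]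
    {𝒞 : ZMod 2 → Submodule k C} (N : QuadraticSuperform 𝒞) :
    Function.Injective (HermitianSpace.toMatrix N) :=
  Subtype.val_injective

theorem HermitianSpace.toMatrix_mem {k C : Type*} [Field k] [NonAssocRing C] [Module k C]
    {𝒞 : ZMod 2 → Submodule k C} {N : QuadraticSuperform 𝒞} (X : HermitianSpace N) :
    HermitianSpace.toMatrix N X ∈ hermitianMatrices N :=
  Subtype.property X

/-- The even and the odd part of `J`: all entries even, or all odd. -/
def hermitianGrading {k C : Type*} [Field k] [NonAssocRing C] [Module k C]
    {𝒞 : ZMod 2 → Submodule k C} (N : QuadraticSuperform 𝒞) (i : ZMod 2) :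
    Submodule k (HermitianSpace N) where
  carrier := {X | ∀ r s, HermitianSpace.toMatrix N X r s ∈ 𝒞 i}
  add_mem' hX hY r s := by
    rw [map_add]
    exact (𝒞 i).add_mem (hX r s) (hY r s)
  zero_mem' r s := by
    rw [map_zero]
    exact (𝒞 i).zero_mem
  smul_mem' c X hX r s := by
    rw [map_smul]
    exact (𝒞 i).smul_mem c (hX r s)

/-- The homogeneous component of parity `i` of a matrix over a superspace. -/
def matrixPart {k C : Type*} [Field k] [AddCommGroup C] [Module k C]
    (𝒞 : ZMod 2 → Submodule k C) [DirectSum.Decomposition 𝒞] (i : ZMod 2)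
    (X : Matrix (Fin 3) (Fin 3) C) : Matrix (Fin 3) (Fin 3) C :=
  fun r s => (DirectSum.decompose 𝒞 (X r s) i : C)

theorem matrixPart_add {k C : Type*} [Field k] [AddCommGroup C] [Module k C]
    (𝒞 : ZMod 2 → Submodule k C) [DirectSum.Decomposition 𝒞] (i : ZMod 2)
    (X Y : Matrix (Fin 3) (Fin 3) C) :
    matrixPart 𝒞 i (X + Y) = matrixPart 𝒞 i X + matrixPart 𝒞 i Y := by
  ext r s
  simp [matrixPart, DirectSum.decompose_add]

theorem matrixPart_smul {k C : Type*} [Field k] [AddCommGroup C] [Module k C]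
    (𝒞 : ZMod 2 → Submodule k C) [DirectSum.Decomposition 𝒞] (i : ZMod 2)
    (c : k) (X : Matrix (Fin 3) (Fin 3) C) :
    matrixPart 𝒞 i (c • X) = c • matrixPart 𝒞 i X := by
  ext r s
  simp only [matrixPart, Matrix.smul_apply, DirectSum.decompose_smul]
  rfl

/-- The symmetrized product `x ∘ y = (x y + (-1)^(|x||y|) y x) / 2` of matrices,
extended bilinearly from homogeneous matrices. -/
def symmetrizedProduct {k C : Type*} [Field k] [NonAssocRing C] [Module k C]
    (𝒞 : ZMod 2 → Submodule k C) [DirectSum.Decomposition 𝒞]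
    (X Y : Matrix (Fin 3) (Fin 3) C) : Matrix (Fin 3) (Fin 3) C :=
  (2⁻¹ : k) • ∑ i : ZMod 2, ∑ j : ZMod 2,
    (matrixPart 𝒞 i X * matrixPart 𝒞 j Y
      + superSign k i j • (matrixPart 𝒞 j Y * matrixPart 𝒞 i X))

theorem standardInvolution_mem {k C : Type*} [Field k] [NonAssocRing C] [Module k C]
    {𝒞 : ZMod 2 → Submodule k C} {N : QuadraticSuperform 𝒞} (h : IsHurwitzSuperalgebra 𝒞 N)
    {i : ZMod 2} {x : C} (hx : x ∈ 𝒞 i) : standardInvolution N x ∈ 𝒞 i := by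
  rw [standardInvolution_apply]
  refine (𝒞 i).sub_mem ?_ hx
  fin_cases i
  · exact (𝒞 0).smul_mem _ h.one_mem
  · have h1 := N.supersymmetric 1 0 x hx 1 h.one_mem
    rw [N.even 1 h.one_mem x hx, mul_zero] at h1
    rw [h1, zero_smul]
    exact (𝒞 1).zero_mem

theorem QuadraticSuperform.eq_of_form_eq {k C : Type*} [Field k] [AddCommGroup C] [Module k C]
    {𝒞 : ZMod 2 → Submodule k C} {N : QuadraticSuperform 𝒞} (h : N.IsRegular)
    {i : ZMod 2} {x y : C} (hx : x ∈ 𝒞 i) (hy : y ∈ 𝒞 i)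
    (hxy : ∀ z ∈ 𝒞 i, N.b x z = N.b y z) : x = y := by
  rw [← sub_eq_zero]
  have hm := (𝒞 i).sub_mem hx hy
  have h0 : ∀ z ∈ 𝒞 i, N.b (x - y) z = 0 := fun z hz => by simp [hxy z hz]
  fin_cases i
  · exact h.nondegenerate_even _ hm h0
  · exact h.nondegenerate_odd _ hm h0

theorem superSign_zero_right (k : Type*) [Field k] (i : ZMod 2) : superSign k i 0 = 1 := by
  simp [superSign]

theorem superSign_zero_left (k : Type*) [Field k] (i : ZMod 2) : superSign k 0 i = 1 := by
  simp [superSign]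

theorem superSign_one_one (k : Type*) [Field k] : superSign k 1 1 = -1 := by
  simp [superSign]

theorem zmod_two_cases (i : ZMod 2) : i = 0 ∨ i = 1 := by
  revert i
  decide

theorem superSign_comm (k : Type*) [Field k] (i j : ZMod 2) :
    superSign k i j = superSign k j i := by
  simp [superSign, and_comm]

theorem superSign_mul_self (k : Type*) [Field k] (i j : ZMod 2) :
    superSign k i j * superSign k i j = 1 := by
  rw [superSign]
  split_ifs <;> simp

theorem superSign_add_left (k : Type*) [Field k] (i j l : ZMod 2) :
    superSign k (i + j) l = superSign k i l * superSign k j l := by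
  have e : (1 + 1 : ZMod 2) = 0 := by decide
  rcases zmod_two_cases i with rfl | rfl <;> rcases zmod_two_cases j with rfl | rfl <;>
    rcases zmod_two_cases l with rfl | rfl <;>
    simp [superSign_zero_right, superSign_zero_left, superSign_one_one, e]

theorem form_standardInvolution_mul {k C : Type*} [Field k] [NonAssocRing C] [Module k C]
    [IsScalarTower k C C] [SMulCommClass k C C]
    {𝒞 : ZMod 2 → Submodule k C} {N : QuadraticSuperform 𝒞} (h : IsHurwitzSuperalgebra 𝒞 N)
    {i j m : ZMod 2} {x y t : C} (hx : x ∈ 𝒞 i) (hy : y ∈ 𝒞 j) (ht : t ∈ 𝒞 m) :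
    N.b (standardInvolution N x * y) t = superSign k i j * N.b y (x * t) := by
  have h1 := h.form_mul_mul i j 0 m x hx y hy 1 h.one_mem t ht
  simp only [superSign_zero_right, one_mul, mul_one] at h1
  rw [standardInvolution_apply]
  simp only [sub_mul, smul_mul_assoc, one_mul, map_sub, map_smul, LinearMap.sub_apply,
    LinearMap.smul_apply, smul_eq_mul]
  linear_combination -h1

theorem form_mul_standardInvolution {k C : Type*} [Field k] [NonAssocRing C] [Module k C]
    [IsScalarTower k C C] [SMulCommClass k C C]
    {𝒞 : ZMod 2 → Submodule k C} {N : QuadraticSuperform 𝒞} (h : IsHurwitzSuperalgebra 𝒞 N)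
    {i j l : ZMod 2} {x y z : C} (hx : x ∈ 𝒞 i) (hy : y ∈ 𝒞 j) (hz : z ∈ 𝒞 l) :
    N.b (x * y) z = superSign k j l * N.b x (z * standardInvolution N y) := by
  have h1 := h.form_mul_mul i j l 0 x hx y hy z hz 1 h.one_mem
  have h2 := N.supersymmetric _ _ _ (h.mul_mem l j z hz y hy) x hx
  simp only [mul_one] at h1
  rw [standardInvolution_apply]
  simp only [mul_sub, mul_smul_comm, mul_one, map_sub, map_smul, smul_eq_mul]
  rw [h2] at h1
  have e : superSign k i j * superSign k i l * superSign k (l + j) i = 1 := by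
    rw [superSign_add_left, superSign_comm k l i, superSign_comm k j i]
    linear_combination superSign k i l * superSign k i l * superSign_mul_self k i j
      + superSign_mul_self k i l
  linear_combination h1 - superSign k j l * N.b x (z * y) * e

theorem standardInvolution_standardInvolution {k C : Type*} [Field k] [NonAssocRing C]
    [Module k C] [IsScalarTower k C C] [SMulCommClass k C C]
    {𝒞 : ZMod 2 → Submodule k C} {N : QuadraticSuperform 𝒞} (h : IsHurwitzSuperalgebra 𝒞 N)
    {i : ZMod 2} {x : C} (hx : x ∈ 𝒞 i) :
    standardInvolution N (standardInvolution N x) = x := by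
  refine QuadraticSuperform.eq_of_form_eq h.regular
    (standardInvolution_mem h (standardInvolution_mem h hx)) hx fun t ht => ?_
  have h1 := form_standardInvolution_mul h (standardInvolution_mem h hx) h.one_mem ht
  have hm := h.mul_mem _ _ _ (standardInvolution_mem h hx) _ ht
  have h2 := form_standardInvolution_mul h hx ht h.one_mem
  have h3 := N.supersymmetric _ _ _ h.one_mem _ hm
  simp only [superSign_zero_right, superSign_zero_left, mul_one, one_mul] at h1 h2 h3
  rw [h1, h3, h2, N.supersymmetric _ _ _ ht _ hx, ← mul_assoc, superSign_comm k i i,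
    superSign_comm k i i]
  rw [superSign_comm k i i, superSign_mul_self, one_mul]

theorem standardInvolution_mul {k C : Type*} [Field k] [NonAssocRing C] [Module k C]
    [IsScalarTower k C C] [SMulCommClass k C C]
    {𝒞 : ZMod 2 → Submodule k C} {N : QuadraticSuperform 𝒞} (h : IsHurwitzSuperalgebra 𝒞 N)
    {i j : ZMod 2} {x y : C} (hx : x ∈ 𝒞 i) (hy : y ∈ 𝒞 j) :
    standardInvolution N (x * y)
      = superSign k i j • (standardInvolution N y * standardInvolution N x) := by
  have hxy := h.mul_mem _ _ _ hx _ hy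
  have hx' := standardInvolution_mem h hx
  have hy' := standardInvolution_mem h hy
  refine QuadraticSuperform.eq_of_form_eq h.regular (standardInvolution_mem h hxy)
    ((𝒞 (i + j)).smul_mem _ (add_comm j i ▸ h.mul_mem _ _ _ hy' _ hx')) fun t ht => ?_
  have ht' := standardInvolution_mem h ht
  have h1 := form_standardInvolution_mul h hxy h.one_mem ht
  have h2 := N.supersymmetric _ _ _ h.one_mem _ (h.mul_mem _ _ _ hxy _ ht)
  have h3 := form_mul_standardInvolution h hxy ht h.one_mem
  have h4 := form_standardInvolution_mul h hx' hy ht'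
  rw [standardInvolution_standardInvolution h hx] at h4
  have h5 := form_standardInvolution_mul h hy hx' ht
  have h6 := N.supersymmetric _ _ _ hx' _ (h.mul_mem _ _ _ hy _ ht)
  have h7 := form_mul_standardInvolution h hy ht hx'
  simp only [superSign_zero_right, superSign_zero_left, mul_one, one_mul] at h1 h2 h3
  rw [h1, h2, h3, h4]
  simp only [map_smul, LinearMap.smul_apply, smul_eq_mul]
  rw [h5, h6, h7, superSign_comm k i (j + (i + j)), superSign_add_left, superSign_comm k j i]
  rcases zmod_two_cases i with rfl | rfl <;> rcases zmod_two_cases j with rfl | rfl <;>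
    simp [superSign_zero_right, superSign_zero_left, superSign_one_one,
      show (1 + 1 : ZMod 2) = 0 by decide]

theorem standardInvolution_decompose {k C : Type*} [Field k] [NonAssocRing C] [Module k C]
    {𝒞 : ZMod 2 → Submodule k C} [DirectSum.Decomposition 𝒞] {N : QuadraticSuperform 𝒞}
    (h : IsHurwitzSuperalgebra 𝒞 N) (i : ZMod 2) (x : C) :
    (DirectSum.decompose 𝒞 (standardInvolution N x) i : C)
      = standardInvolution N (DirectSum.decompose 𝒞 x i : C) := by
  induction x using DirectSum.Decomposition.inductionOn 𝒞 with
  | zero => simp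
  | @homogeneous j m =>
    by_cases hij : j = i
    · subst hij
      rw [DirectSum.decompose_of_mem_same _ (standardInvolution_mem h m.2),
        DirectSum.decompose_of_mem_same _ m.2]
    · rw [DirectSum.decompose_of_mem_ne _ (standardInvolution_mem h m.2) hij,
        DirectSum.decompose_of_mem_ne _ m.2 hij, map_zero]
  | add a b ha hb => simp [DirectSum.decompose_add, ha, hb]

theorem symmetrizedProduct_mem {k C : Type*} [Field k] [NonAssocRing C] [Module k C]
    [IsScalarTower k C C] [SMulCommClass k C C]
    {𝒞 : ZMod 2 → Submodule k C} [DirectSum.Decomposition 𝒞] {N : QuadraticSuperform 𝒞}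
    (h : IsHurwitzSuperalgebra 𝒞 N) {X Y : Matrix (Fin 3) (Fin 3) C}
    (hX : X ∈ hermitianMatrices N) (hY : Y ∈ hermitianMatrices N) :
    symmetrizedProduct 𝒞 X Y ∈ hermitianMatrices N := by
  refine Submodule.smul_mem _ _ (Submodule.sum_mem _ fun i _ => Submodule.sum_mem _ fun j _ => ?_)
  have key : ∀ (l : ZMod 2) {Z : Matrix (Fin 3) (Fin 3) C}, Z ∈ hermitianMatrices N →
      ∀ r s, standardInvolution N (matrixPart 𝒞 l Z s r) = matrixPart 𝒞 l Z r s := by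
    intro l Z hZ r s
    rw [matrixPart, ← standardInvolution_decompose h, hZ r s]
    rfl
  have hmem : ∀ (l : ZMod 2) (Z : Matrix (Fin 3) (Fin 3) C) (r s), matrixPart 𝒞 l Z r s ∈ 𝒞 l :=
    fun l Z r s => SetLike.coe_mem _
  intro r s
  simp only [Matrix.add_apply, Matrix.smul_apply, Matrix.mul_apply, map_add, map_smul, map_sum]
  simp only [standardInvolution_mul h (hmem _ _ _ _) (hmem _ _ _ _), key i hX, key j hY]
  rw [← Finset.smul_sum, ← Finset.smul_sum, smul_smul, superSign_comm k j i,
    superSign_mul_self, one_smul, add_comm]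

theorem symmetrizedProduct_add_left {k C : Type*} [Field k] [NonAssocRing C] [Module k C]
    (𝒞 : ZMod 2 → Submodule k C) [DirectSum.Decomposition 𝒞]
    (X X' Y : Matrix (Fin 3) (Fin 3) C) : symmetrizedProduct 𝒞 (X + X') Y
      = symmetrizedProduct 𝒞 X Y + symmetrizedProduct 𝒞 X' Y := by
  simp only [symmetrizedProduct, matrixPart_add, add_mul, mul_add, smul_add,
    Finset.sum_add_distrib]
  abel

theorem symmetrizedProduct_add_right {k C : Type*} [Field k] [NonAssocRing C] [Module k C]
    (𝒞 : ZMod 2 → Submodule k C) [DirectSum.Decomposition 𝒞]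
    (X Y Y' : Matrix (Fin 3) (Fin 3) C) : symmetrizedProduct 𝒞 X (Y + Y')
      = symmetrizedProduct 𝒞 X Y + symmetrizedProduct 𝒞 X Y' := by
  simp only [symmetrizedProduct, matrixPart_add, add_mul, mul_add, smul_add,
    Finset.sum_add_distrib]
  abel

theorem symmetrizedProduct_smul_left {k C : Type*} [Field k] [NonAssocRing C] [Module k C]
    [IsScalarTower k C C] [SMulCommClass k C C]
    (𝒞 : ZMod 2 → Submodule k C) [DirectSum.Decomposition 𝒞] (c : k)
    (X Y : Matrix (Fin 3) (Fin 3) C) :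
    symmetrizedProduct 𝒞 (c • X) Y = c • symmetrizedProduct 𝒞 X Y := by
  simp only [symmetrizedProduct, matrixPart_smul, smul_mul_assoc, mul_smul_comm, smul_comm _ c,
    ← smul_add, ← Finset.smul_sum]

theorem symmetrizedProduct_smul_right {k C : Type*} [Field k] [NonAssocRing C] [Module k C]
    [IsScalarTower k C C] [SMulCommClass k C C]
    (𝒞 : ZMod 2 → Submodule k C) [DirectSum.Decomposition 𝒞] (c : k)
    (X Y : Matrix (Fin 3) (Fin 3) C) :
    symmetrizedProduct 𝒞 X (c • Y) = c • symmetrizedProduct 𝒞 X Y := by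
  simp only [symmetrizedProduct, matrixPart_smul, smul_mul_assoc, mul_smul_comm, smul_comm _ c,
    ← smul_add, ← Finset.smul_sum]

/-- The product of the Jordan superalgebra `J`: the symmetrized product. -/
def jordanProduct {k C : Type*} [Field k] [NonAssocRing C] [Module k C]
    [IsScalarTower k C C] [SMulCommClass k C C]
    {𝒞 : ZMod 2 → Submodule k C} [DirectSum.Decomposition 𝒞] {N : QuadraticSuperform 𝒞}
    (h : IsHurwitzSuperalgebra 𝒞 N) :
    HermitianSpace N →ₗ[k] HermitianSpace N →ₗ[k] HermitianSpace N :=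
  LinearMap.mk₂ k
    (fun X Y => ⟨symmetrizedProduct 𝒞 (HermitianSpace.toMatrix N X) (HermitianSpace.toMatrix N Y),
      symmetrizedProduct_mem h X.toMatrix_mem Y.toMatrix_mem⟩)
    (fun _ _ _ => Subtype.ext <| symmetrizedProduct_add_left 𝒞 _ _ _)
    (fun _ _ _ => Subtype.ext <| symmetrizedProduct_smul_left 𝒞 _ _ _)
    (fun _ _ _ => Subtype.ext <| symmetrizedProduct_add_right 𝒞 _ _ _)
    (fun _ _ _ => Subtype.ext <| symmetrizedProduct_smul_right 𝒞 _ _ _)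

theorem toMatrix_jordanProduct {k C : Type*} [Field k] [NonAssocRing C] [Module k C]
    [IsScalarTower k C C] [SMulCommClass k C C]
    {𝒞 : ZMod 2 → Submodule k C} [DirectSum.Decomposition 𝒞] {N : QuadraticSuperform 𝒞}
    (h : IsHurwitzSuperalgebra 𝒞 N) (X Y : HermitianSpace N) :
    HermitianSpace.toMatrix N (jordanProduct h X Y)
      = symmetrizedProduct 𝒞 (HermitianSpace.toMatrix N X) (HermitianSpace.toMatrix N Y) := rfl

/-- The endomorphisms of parity `i` of a superspace. -/
def endGrading {k A : Type*} [Field k] [AddCommGroup A] [Module k A]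
    (𝒜 : ZMod 2 → Submodule k A) (i : ZMod 2) : Submodule k (Module.End k A) where
  carrier := {f | ∀ j, ∀ x ∈ 𝒜 j, f x ∈ 𝒜 (i + j)}
  add_mem' hf hg j x hx := (𝒜 (i + j)).add_mem (hf j x hx) (hg j x hx)
  zero_mem' j _ _ := (𝒜 (i + j)).zero_mem
  smul_mem' c _ hf j x hx := (𝒜 (i + j)).smul_mem c (hf j x hx)

/-- The span `[L, M]` of the supercommutators `[f, g] = f g - (-1)^(|f||g|) g f` of the
homogeneous elements `f` of `L` and `g` of `M`, where `L` and `M` are graded subspaces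
of the Lie superalgebra `gl(A)` of all endomorphisms of the superspace `A`. -/
def superCommutator {k A : Type*} [Field k] [AddCommGroup A] [Module k A]
    (𝒜 : ZMod 2 → Submodule k A) (L M : Submodule k (Module.End k A)) :
    Submodule k (Module.End k A) :=
  Submodule.span k {h | ∃ i j : ZMod 2, ∃ f ∈ L ⊓ endGrading 𝒜 i, ∃ g ∈ M ⊓ endGrading 𝒜 j,
    h = f * g - superSign k i j • (g * f)}

/-- Graded subspaces of `gl(A)`: those spanned by their homogeneous elements. -/
def IsGradedSubspace {k A : Type*} [Field k] [AddCommGroup A] [Module k A]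
    (𝒜 : ZMod 2 → Submodule k A) (L : Submodule k (Module.End k A)) : Prop :=
  L = (L ⊓ endGrading 𝒜 0) ⊔ (L ⊓ endGrading 𝒜 1)

/-- Lie subsuperalgebras of `gl(A)`. -/
structure IsLieSubsuperalgebra {k A : Type*} [Field k] [AddCommGroup A] [Module k A]
    (𝒜 : ZMod 2 → Submodule k A) (L : Submodule k (Module.End k A)) : Prop where
  graded : IsGradedSubspace 𝒜 L
  bracket_le : superCommutator 𝒜 L L ≤ L

/-- (Graded) ideals `I` of a Lie subsuperalgebra `L` of `gl(A)`. -/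
structure IsLieSuperideal {k A : Type*} [Field k] [AddCommGroup A] [Module k A]
    (𝒜 : ZMod 2 → Submodule k A) (I L : Submodule k (Module.End k A)) : Prop where
  le : I ≤ L
  graded : IsGradedSubspace 𝒜 I
  bracket_le : superCommutator 𝒜 L I ≤ I

/-- `L` is a Lie subsuperalgebra of `gl(A)` that is simple as a Lie superalgebra:
it is not abelian and its only ideals are `0` and `L`. -/
structure IsSimpleLieSuperalgebra {k A : Type*} [Field k] [AddCommGroup A] [Module k A]
    (𝒜 : ZMod 2 → Submodule k A) (L : Submodule k (Module.End k A)) : Prop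
    extends IsLieSubsuperalgebra 𝒜 L where
  not_abelian : superCommutator 𝒜 L L ≠ ⊥
  eq_bot_or_eq : ∀ I, IsLieSuperideal 𝒜 I L → I = ⊥ ∨ I = L

/-- The derivations of parity `i` of the superalgebra with underlying superspace `A` and
product `μ`. -/
def homogeneousDerivations {k A : Type*} [Field k] [AddCommGroup A] [Module k A]
    (𝒜 : ZMod 2 → Submodule k A) (μ : A →ₗ[k] A →ₗ[k] A) (i : ZMod 2) :
    Submodule k (Module.End k A) where
  carrier := {d | d ∈ endGrading 𝒜 i ∧ ∀ j, ∀ x ∈ 𝒜 j, ∀ y,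
    d (μ x y) = μ (d x) y + superSign k i j • μ x (d y)}
  add_mem' hf hg := ⟨add_mem hf.1 hg.1, fun j x hx y => by
    simp only [LinearMap.add_apply, map_add, hf.2 j x hx y, hg.2 j x hx y, smul_add]
    abel⟩
  zero_mem' := ⟨zero_mem _, fun j x _ y => by simp⟩
  smul_mem' c _ hf := ⟨Submodule.smul_mem _ c hf.1, fun j x hx y => by
    simp only [LinearMap.smul_apply, map_smul, hf.2 j x hx y, smul_add, smul_comm c]⟩

/-- The space `der` of all derivations of a superalgebra. -/
def superDerivations {k A : Type*} [Field k] [AddCommGroup A] [Module k A]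
    (𝒜 : ZMod 2 → Submodule k A) (μ : A →ₗ[k] A →ₗ[k] A) : Submodule k (Module.End k A) :=
  homogeneousDerivations 𝒜 μ 0 ⊔ homogeneousDerivations 𝒜 μ 1

/-- The space `inder = [L_A, L_A]` of inner derivations of a Jordan superalgebra with
product `μ`, where `L_A` is the space of the left multiplications `μ x`. -/
def innerSuperDerivations {k A : Type*} [Field k] [AddCommGroup A] [Module k A]
    (𝒜 : ZMod 2 → Submodule k A) (μ : A →ₗ[k] A →ₗ[k] A) : Submodule k (Module.End k A) :=
  superCommutator 𝒜 (LinearMap.range μ) (LinearMap.range μ)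

/-- The codimension of `I` in `L`, for subspaces `I ≤ L` of a vector space
(with the value `0` if the codimension is infinite). -/
noncomputable def codimensionIn {k V : Type*} [Field k] [AddCommGroup V] [Module k V]
    (I L : Submodule k V) : ℕ :=
  Module.finrank k (L ⧸ I.submoduleOf L)

/-- `der J`, for `J` the Jordan superalgebra of hermitian `3 × 3` matrices over `C`. -/
def derHermitian {k C : Type*} [Field k] [NonAssocRing C] [Module k C]
    [IsScalarTower k C C] [SMulCommClass k C C]
    {𝒞 : ZMod 2 → Submodule k C} [DirectSum.Decomposition 𝒞] {N : QuadraticSuperform 𝒞}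
    (h : IsHurwitzSuperalgebra 𝒞 N) : Submodule k (Module.End k (HermitianSpace N)) :=
  superDerivations (hermitianGrading N) (jordanProduct h)

/-- `inder J`, for `J` the Jordan superalgebra of hermitian `3 × 3` matrices over `C`. -/
def inderHermitian {k C : Type*} [Field k] [NonAssocRing C] [Module k C]
    [IsScalarTower k C C] [SMulCommClass k C C]
    {𝒞 : ZMod 2 → Submodule k C} [DirectSum.Decomposition 𝒞] {N : QuadraticSuperform 𝒞}
    (h : IsHurwitzSuperalgebra 𝒞 N) : Submodule k (Module.End k (HermitianSpace N)) :=
  innerSuperDerivations (hermitianGrading N) (jordanProduct h)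

/-! Indices run modulo 3. Write `e_i` for `diag i`, `x_i(a)` for `offDiag i a` and `a • b` for the
para-Hurwitz product. Then `J` is the sum of the lines `k e_i` and of three copies `x_i(C)` of `C`,
with `x_i(a) ∘ x_{i+1}(b) = x_{i+2}(a • b)` and `x_i(a) ∘ x_i(b) = 2 b(a,b) (e_{i+1} + e_{i+2})`.
The para-Hurwitz product makes this table invariant under cyclic shifts of the index, and all
computations reduce to two facts: the form is associative for `•`, and `(x • y) • z ± (z • y) • x =
± b(x,z) y`, with its mirror image.

A derivation of `J` is determined by its values on the `e_i` up to one that kills them. Hence it is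
a sum of the inner derivations `D_i(a) = 2 [L_{x_i(a)}, L_{e_{i+1}}]` and of a diagonal derivation
`d`. The latter is a triple `(d_0, d_1, d_2)` of skew maps of `C` with `d_{i+2}(x • y) = d_i(x) • y
± x • d_{i+1}(y)`: local triality. The brackets are `[d, D_i(a)] = D_i(d_i(a))` and `[D_i(a),
D_{i+1}(b)] = D_{i+2}(a • b)`, while `[D_i(a), D_i(b)]` is diagonal. The `D_i(a)` together with the
`[D_i(a), D_i(b)]` span `inder J`.

Simplicity of `inder J` holds without exception. If a subspace is stable under all `ad D_i(a)` and
contains a nonzero homogeneous derivation, then suitable brackets isolate some `D_i(c)` with `c ≠ 0`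
(`IsOffDiagStable.exists_offDiagDer_mem`); the composition identity spreads this to all `D_j(x)`,
and these generate `inder J`.

It remains to compare `der J` with `inder J`. The maps `[D_i(a), D_i(b)]` act on component `i` as
elementary skew maps. Since a Hurwitz superalgebra has finite dimension, they yield every skew map,
so modulo inner derivations `d` is diagonal with `d_i = 0` (`exists_mem_inder_comp_eq`). Triality
then forces `d_{i+1}` to be left multiplication by `c = d_{i+1}(1)` and `d_{i+2}` to be, up to sign,
right multiplication by `c`, with `c` orthogonal to `1` and in the nucleus. An odd such `c` is zero.
An even one is realized by an inner derivation as soon as some nonisotropic even `a` is orthogonal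
to `1` and `c`. If there is none, then `c = 0` or `C = k 1 + k c` has dimension two
(`mem_inder_or_isBinary`).

For `dim C = 2` the diagonal derivations in question multiply the three components by multiples of
`c`, with weights of sum zero. The inner ones among them have weights spanned by `(-4, 2, 2)` and
its cyclic shifts: everything if `3 ≠ 0` in `k`, but only the line of `(1, 1, 1)` in characteristic
3. The weights `(0, 1, -1)` then give an outer derivation that spans `der J` modulo `inder J`. -/

set_option linter.unusedSectionVars false

/-! ### Conjugation and the para-Hurwitz product of a Hurwitz superalgebra. -/

section HurwitzAlgebra

variable {k C : Type*} [Field k] [NonAssocRing C] [Module k C]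
  [IsScalarTower k C C] [SMulCommClass k C C]
  {𝒞 : ZMod 2 → Submodule k C} [DirectSum.Decomposition 𝒞] {N : QuadraticSuperform 𝒞}

/-- The product `x • y = x̄ ȳ`, as a bilinear map. -/
def paraProduct (N : QuadraticSuperform 𝒞) : C →ₗ[k] C →ₗ[k] C :=
  (LinearMap.mul k C).compl₁₂ (standardInvolution N) (standardInvolution N)

theorem paraProduct_apply (x y : C) :
    paraProduct N x y = standardInvolution N x * standardInvolution N y := rfl

theorem superSign_add_right (k : Type*) [Field k] (i j l : ZMod 2) :
    superSign k i (j + l) = superSign k i j * superSign k i l := by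
  rw [superSign_comm, superSign_add_left, superSign_comm k j, superSign_comm k l]

theorem ZMod.one_add_one_eq_zero : (1 + 1 : ZMod 2) = 0 := by decide

theorem QuadraticSuperform.form_eq_zero {i j : ZMod 2} (hij : i ≠ j) {x y : C} (hx : x ∈ 𝒞 i)
    (hy : y ∈ 𝒞 j) : N.b x y = 0 := by
  rcases zmod_two_cases i with rfl | rfl <;> rcases zmod_two_cases j with rfl | rfl
  · exact absurd rfl hij
  · exact N.even x hx y hy
  · rw [N.supersymmetric 1 0 x hx y hy, N.even y hy x hx, mul_zero]
  · exact absurd rfl hij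

/-- A property of the elements of a superspace that is additive and holds for homogeneous
elements holds for all. -/
theorem superspace_induction (𝒞 : ZMod 2 → Submodule k C) [DirectSum.Decomposition 𝒞]
    {p : C → Prop} (hom : ∀ i, ∀ x ∈ 𝒞 i, p x) (add : ∀ x y, p x → p y → p (x + y)) (x : C) :
    p x := by
  induction x using DirectSum.Decomposition.inductionOn 𝒞 with
  | zero => exact hom 0 0 (zero_mem _)
  | homogeneous m => exact hom _ _ m.2
  | add a b ha hb => exact add a b ha hb

theorem superspace_disjoint (𝒞 : ZMod 2 → Submodule k C) [DirectSum.Decomposition 𝒞]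
    {i j : ZMod 2} (hij : i ≠ j) {x : C} (hi : x ∈ 𝒞 i) (hj : x ∈ 𝒞 j) : x = 0 := by
  rw [← DirectSum.decompose_of_mem_same 𝒞 hi, DirectSum.decompose_of_mem_ne 𝒞 hj hij.symm]

namespace IsHurwitzSuperalgebra

variable (h : IsHurwitzSuperalgebra 𝒞 N)
include h

theorem exists_form_ne_zero {i : ZMod 2} {x : C} (hx : x ∈ 𝒞 i) (h0 : x ≠ 0) :
    ∃ y ∈ 𝒞 i, N.b x y ≠ 0 := by
  by_contra! H
  exact h0 (QuadraticSuperform.eq_of_form_eq h.regular hx (zero_mem _) fun z hz => by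
    simp [H z hz])

theorem conj_one : standardInvolution N 1 = 1 := by
  refine QuadraticSuperform.eq_of_form_eq h.regular (standardInvolution_mem h h.one_mem)
    h.one_mem fun t ht => ?_
  have := form_standardInvolution_mul h h.one_mem h.one_mem ht
  simpa [superSign_zero_left] using this

theorem form_one_one : N.b 1 1 = 2 := by
  have h1 := h.conj_one
  rw [standardInvolution_apply, sub_eq_iff_eq_add, one_add_one_eq_two,
    show (2 : C) = (2 : k) • (1 : C) by rw [two_smul, one_add_one_eq_two]] at h1
  exact smul_left_injective k h.one_ne_zero h1

theorem conj_conj (x : C) : standardInvolution N (standardInvolution N x) = x := by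
  induction x using superspace_induction 𝒞 with
  | hom i x hx => exact standardInvolution_standardInvolution h hx
  | add x y hx hy => rw [map_add, map_add, hx, hy]

theorem form_one_of_odd {x : C} (hx : x ∈ 𝒞 1) : N.b x 1 = 0 :=
  QuadraticSuperform.form_eq_zero (by decide) hx h.one_mem

theorem form_one_left (x : C) : N.b 1 x = N.b x 1 := by
  induction x using superspace_induction 𝒞 with
  | hom i x hx =>
    rw [N.supersymmetric _ _ _ h.one_mem _ hx, superSign_zero_left, one_mul]
  | add x y hx hy => rw [map_add, map_add, hx, hy]; rfl

theorem conj_of_form_one_eq_zero {x : C} (hx : N.b x 1 = 0) : standardInvolution N x = -x := by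
  rw [standardInvolution_apply, hx, zero_smul, zero_sub]

theorem form_conj_conj (x y : C) :
    N.b (standardInvolution N x) (standardInvolution N y) = N.b x y := by
  simp only [standardInvolution_apply, map_sub, map_smul, LinearMap.sub_apply,
    LinearMap.smul_apply, h.form_one_one, smul_eq_mul, h.form_one_left]
  ring

theorem conj_injective : Function.Injective (standardInvolution N) :=
  Function.LeftInverse.injective h.conj_conj

/-- Linearization of `x̄ (x z) = q(x) z`. Moving `x̄` and `ȳ` across the form turns it into the
composition identity `form_mul_mul`. -/
theorem conj_mul_mul {i j l : ZMod 2} {x y z : C} (hx : x ∈ 𝒞 i) (hy : y ∈ 𝒞 j) (hz : z ∈ 𝒞 l) :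
    standardInvolution N x * (y * z) + superSign k i j • (standardInvolution N y * (x * z))
      = N.b x y • z := by
  have hx' := standardInvolution_mem h hx
  have hy' := standardInvolution_mem h hy
  -- For equal parities both sides lie in `𝒞 l`. Otherwise `b(x, y) = 0` and the left side is
  -- homogeneous, so that it can again be tested against the form.
  by_cases hij : i = j
  · subst hij
    have e : i + (i + l) = l := by
      rw [← add_assoc, CharTwo.add_self_eq_zero, zero_add]
    have m1 := h.mul_mem _ _ _ hx' _ (h.mul_mem _ _ _ hy _ hz)
    have m2 := h.mul_mem _ _ _ hy' _ (h.mul_mem _ _ _ hx _ hz)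
    rw [e] at m1 m2
    refine QuadraticSuperform.eq_of_form_eq h.regular
      (add_mem m1 (Submodule.smul_mem _ _ m2)) (Submodule.smul_mem _ _ hz) fun t ht => ?_
    have h1 := form_standardInvolution_mul h hx (h.mul_mem _ _ _ hy _ hz) ht
    have h2 := form_standardInvolution_mul h hy (h.mul_mem _ _ _ hx _ hz) ht
    have h3 := h.form_mul_mul _ _ _ _ x hx z hz y hy t ht
    have h4 := h.form_mul_mul _ _ _ _ y hy z hz x hx t ht
    have h5 := N.supersymmetric _ _ _ hx _ hy
    simp only [map_add, map_smul, LinearMap.add_apply, LinearMap.smul_apply, smul_eq_mul, h1, h2]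
    simp only [superSign_add_right, superSign_comm k l i] at *
    rcases zmod_two_cases i with rfl | rfl <;> rcases zmod_two_cases l with rfl | rfl <;>
      simp only [superSign_zero_left, superSign_zero_right, superSign_one_one, one_mul, mul_one,
        neg_mul, neg_neg, mul_neg] at * <;> first
        | linear_combination h4 - N.b z t * h5
        | linear_combination -h4 - N.b z t * h5
  · have hd := DirectSum.Decomposition.inductionOn 𝒞 (motive := fun _ => True)
    rw [QuadraticSuperform.form_eq_zero hij hx hy, zero_smul]
    have e : i + (j + l) = j + (i + l) := by abel
    have m1 := h.mul_mem _ _ _ hx' _ (h.mul_mem _ _ _ hy _ hz)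
    have m2 := h.mul_mem _ _ _ hy' _ (h.mul_mem _ _ _ hx _ hz)
    rw [e] at m1
    refine QuadraticSuperform.eq_of_form_eq h.regular
      (add_mem m1 (Submodule.smul_mem _ _ m2)) (zero_mem _) fun t ht => ?_
    have h1 := form_standardInvolution_mul h hx (h.mul_mem _ _ _ hy _ hz) ht
    have h2 := form_standardInvolution_mul h hy (h.mul_mem _ _ _ hx _ hz) ht
    have h4 := h.form_mul_mul _ _ _ _ y hy z hz x hx t ht
    rw [QuadraticSuperform.form_eq_zero (Ne.symm hij) hy hx] at h4
    simp only [map_add, map_smul, LinearMap.add_apply, LinearMap.smul_apply, smul_eq_mul, h1, h2,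
      map_zero, LinearMap.zero_apply]
    simp only [superSign_add_right, superSign_comm k l i] at *
    rcases zmod_two_cases i with rfl | rfl <;> rcases zmod_two_cases l with rfl | rfl <;>
    rcases zmod_two_cases j with rfl | rfl <;>
      simp only [superSign_zero_left, superSign_zero_right, superSign_one_one, one_mul, mul_one,
        neg_mul, mul_neg, not_true_eq_false] at * <;>
      first
        | linear_combination h4
        | linear_combination -h4

/-- The mirror image of `conj_mul_mul`, transported by the superinvolution `x ↦ x̄`. -/
theorem mul_mul_conj {i j l : ZMod 2} {x y z : C} (hx : x ∈ 𝒞 i) (hy : y ∈ 𝒞 j) (hz : z ∈ 𝒞 l) :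
    z * x * standardInvolution N y + superSign k i j • (z * y * standardInvolution N x)
      = N.b x y • z := by
  have hx' := standardInvolution_mem h hx
  have hy' := standardInvolution_mem h hy
  have hz' := standardInvolution_mem h hz
  apply h.conj_injective
  have h1 := h.conj_mul_mul hx' hy' hz'
  simp only [h.conj_conj, h.form_conj_conj] at h1
  rw [map_add, map_smul, map_smul, standardInvolution_mul h (h.mul_mem _ _ _ hz _ hx) hy',
    standardInvolution_mul h (h.mul_mem _ _ _ hz _ hy) hx', standardInvolution_mul h hz hx,
    standardInvolution_mul h hz hy, h.conj_conj, h.conj_conj]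
  by_cases hij : i = j
  · subst hij
    have e : N.b y x = superSign k i i * N.b x y := N.supersymmetric _ _ _ hy _ hx
    have h2 := h.conj_mul_mul hy' hx' hz'
    simp only [h.conj_conj, h.form_conj_conj] at h2
    rcases zmod_two_cases i with rfl | rfl <;> rcases zmod_two_cases l with rfl | rfl <;>
      simp [superSign_zero_left, superSign_zero_right, superSign_one_one,
        ZMod.one_add_one_eq_zero] at * <;>
      first | linear_combination h1 | (rw [add_comm]; exact h1)
  · have e : N.b y x = 0 := QuadraticSuperform.form_eq_zero (Ne.symm hij) hy hx
    have e' : N.b x y = 0 := QuadraticSuperform.form_eq_zero hij hx hy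
    rcases zmod_two_cases i with rfl | rfl <;> rcases zmod_two_cases l with rfl | rfl <;>
    rcases zmod_two_cases j with rfl | rfl <;>
      simp [superSign_zero_left, superSign_zero_right, superSign_one_one, e', e,
        ZMod.one_add_one_eq_zero] at * <;>
      first | (rw [add_comm]; exact h1) | (rw [← neg_add, add_comm, h1, neg_zero])

theorem conj_paraProduct {i j : ZMod 2} {x y : C} (hx : x ∈ 𝒞 i) (hy : y ∈ 𝒞 j) :
    standardInvolution N (paraProduct N x y) = superSign k i j • (y * x) := by
  rw [paraProduct_apply, standardInvolution_mul h (standardInvolution_mem h hx)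
    (standardInvolution_mem h hy), h.conj_conj, h.conj_conj]

theorem paraProduct_mem {i j : ZMod 2} {x y : C} (hx : x ∈ 𝒞 i) (hy : y ∈ 𝒞 j) :
    paraProduct N x y ∈ 𝒞 (i + j) :=
  h.mul_mem _ _ _ (standardInvolution_mem h hx) _ (standardInvolution_mem h hy)

/-- Associativity of the form, without signs. It makes the three off-diagonal components of `J` play
the same role. -/
theorem form_paraProduct {i j l : ZMod 2} {x y z : C} (hx : x ∈ 𝒞 i) (hy : y ∈ 𝒞 j)
    (hz : z ∈ 𝒞 l) : N.b (paraProduct N x y) z = N.b x (paraProduct N y z) := by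
  have hx' := standardInvolution_mem h hx
  have hy' := standardInvolution_mem h hy
  have hz' := standardInvolution_mem h hz
  have h1 := form_mul_standardInvolution h hx' hy' hz
  rw [paraProduct_apply, h1, h.conj_conj, ← h.form_conj_conj, h.conj_conj,
    standardInvolution_mul h hz hy, map_smul, smul_eq_mul, ← mul_assoc, superSign_comm k l j,
    superSign_mul_self, one_mul, paraProduct_apply]

/-- With its mirror image below, the super version of `(x • y) • x = q(x) y = x • (y • x)`.
Conjugation reverses products, so both reduce to `mul_mul_conj` and `conj_mul_mul`. -/
theorem paraProduct_paraProduct_left {i j l : ZMod 2} {x y z : C} (hx : x ∈ 𝒞 i) (hy : y ∈ 𝒞 j)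
    (hz : z ∈ 𝒞 l) : paraProduct N (paraProduct N x y) z
      + (superSign k i j * superSign k i l * superSign k j l) •
        paraProduct N (paraProduct N z y) x = (superSign k i j * N.b x z) • y := by
  rw [paraProduct_apply, paraProduct_apply _ x, h.conj_paraProduct hx hy, h.conj_paraProduct hz hy,
    mul_smul _ (N.b x z), ← h.mul_mul_conj hx hz hy, smul_add, smul_mul_assoc, smul_mul_assoc, smul_smul,
    smul_smul, superSign_comm k l j]
  congr 2
  linear_combination superSign k i j * superSign k i l * superSign_mul_self k j l

theorem paraProduct_paraProduct_right {i j l : ZMod 2} {x y z : C} (hx : x ∈ 𝒞 i) (hy : y ∈ 𝒞 j)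
    (hz : z ∈ 𝒞 l) : paraProduct N x (paraProduct N y z)
      + (superSign k i j * superSign k i l * superSign k j l) •
        paraProduct N z (paraProduct N y x) = (superSign k j l * N.b x z) • y := by
  rw [paraProduct_apply, paraProduct_apply z, h.conj_paraProduct hy hz, h.conj_paraProduct hy hx,
    mul_smul _ (N.b x z), ← h.conj_mul_mul hx hz hy, smul_add, mul_smul_comm, mul_smul_comm, smul_smul,
    smul_smul, superSign_comm k j i]
  congr 2
  linear_combination superSign k i l * superSign k j l * superSign_mul_self k i j

theorem one_paraProduct (x : C) : paraProduct N 1 x = standardInvolution N x := by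
  rw [paraProduct_apply, h.conj_one, one_mul]

theorem paraProduct_one (x : C) : paraProduct N x 1 = standardInvolution N x := by
  rw [paraProduct_apply, h.conj_one, mul_one]

end IsHurwitzSuperalgebra
end HurwitzAlgebra

/-! ### The multiplication table of `J` and its coordinates. -/

section HermitianMatrices

theorem Fin.three_add_one_add_one (i : Fin 3) : i + 1 + 1 = i + 2 := by omega
theorem Fin.three_add_one_add_two (i : Fin 3) : i + 1 + 2 = i := by omega
theorem Fin.three_add_two_add_one (i : Fin 3) : i + 2 + 1 = i := by omega
theorem Fin.three_add_two_add_two (i : Fin 3) : i + 2 + 2 = i + 1 := by omega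
theorem Fin.three_ne_add_one (i : Fin 3) : i ≠ i + 1 := by omega
theorem Fin.three_ne_add_two (i : Fin 3) : i ≠ i + 2 := by omega
theorem Fin.three_add_one_ne_add_two (i : Fin 3) : i + 1 ≠ i + 2 := by omega

theorem Fin.three_cases (i j : Fin 3) : i = j ∨ j = i + 1 ∨ j = i + 2 := by omega

variable {k C : Type*} [Field k] [NonAssocRing C] [Module k C]
  [IsScalarTower k C C] [SMulCommClass k C C]
  {𝒞 : ZMod 2 → Submodule k C} [DirectSum.Decomposition 𝒞] {N : QuadraticSuperform 𝒞}

theorem matrixPart_of_mem {i j : ZMod 2} {X : Matrix (Fin 3) (Fin 3) C}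
    (hX : ∀ r s, X r s ∈ 𝒞 i) : matrixPart 𝒞 j X = if i = j then X else 0 := by
  ext r s
  split_ifs with hij
  · subst hij
    exact DirectSum.decompose_of_mem_same _ (hX r s)
  · exact DirectSum.decompose_of_mem_ne _ (hX r s) hij

theorem symmetrizedProduct_of_mem {i j : ZMod 2} {X Y : Matrix (Fin 3) (Fin 3) C}
    (hX : ∀ r s, X r s ∈ 𝒞 i) (hY : ∀ r s, Y r s ∈ 𝒞 j) :
    symmetrizedProduct 𝒞 X Y = (2⁻¹ : k) • (X * Y + superSign k i j • (Y * X)) := by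
  rw [symmetrizedProduct]
  congr 1
  simp only [matrixPart_of_mem hX, matrixPart_of_mem hY]
  rw [Finset.sum_eq_single i, Finset.sum_eq_single j]
  · simp
  · intro l _ hl
    simp [Ne.symm hl]
  · simp
  · intro l _ hl
    refine Finset.sum_eq_zero fun m _ => ?_
    simp [Ne.symm hl]
  · simp

namespace HermitianSpace

theorem ext_matrix {X Y : HermitianSpace N}
    (hXY : ∀ r s, toMatrix N X r s = toMatrix N Y r s) : X = Y :=
  toMatrix_injective N (by ext r s; exact hXY r s)

theorem conj_toMatrix (X : HermitianSpace N) (r s : Fin 3) :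
    standardInvolution N (toMatrix N X s r) = toMatrix N X r s :=
  X.toMatrix_mem r s

end HermitianSpace

open HermitianSpace

namespace IsHurwitzSuperalgebra

variable (h : IsHurwitzSuperalgebra 𝒞 N)

/-- The diagonal idempotent `Eᵢᵢ` of `J`. -/
def diag (i : Fin 3) : HermitianSpace N :=
  ⟨Matrix.single i i 1, fun r s => by
    rw [Matrix.single_apply, Matrix.single_apply, apply_ite (standardInvolution N), h.conj_one,
      map_zero]
    simp only [and_comm]⟩

/-- The hermitian matrix with the entries `2 a` and `2 ā` in the two off-diagonal positions
not meeting the `i`-th row and column. -/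
def offDiag (i : Fin 3) : C →ₗ[k] HermitianSpace N :=
  LinearMap.codRestrict (hermitianMatrices N)
    ((2 : k) • (Matrix.singleLinearMap k (i + 2) (i + 1)
      + Matrix.singleLinearMap k (i + 1) (i + 2) ∘ₗ standardInvolution N)) fun a r s => by
    have h1 := Fin.three_add_one_ne_add_two i
    rcases Fin.three_cases i r with rfl | rfl | rfl <;>
    rcases Fin.three_cases i s with rfl | rfl | rfl <;>
      simp [h.conj_conj, h1, h1.symm]

theorem toMatrix_diag (i : Fin 3) :
    toMatrix N (h.diag i) = Matrix.single i i 1 := rfl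

theorem toMatrix_offDiag (i : Fin 3) (a : C) :
    toMatrix N (h.offDiag i a) = Matrix.single (i + 2) (i + 1) ((2 : k) • a)
      + Matrix.single (i + 1) (i + 2) ((2 : k) • standardInvolution N a) := by
  simp only [← Matrix.smul_single, ← smul_add]
  rfl

theorem diag_mem (i : Fin 3) : h.diag i ∈ hermitianGrading N 0 := fun r s => by
  rw [toMatrix_diag, Matrix.single_apply]
  split_ifs
  exacts [h.one_mem, zero_mem _]

theorem offDiag_mem (i : Fin 3) {p : ZMod 2} {a : C} (ha : a ∈ 𝒞 p) :
    h.offDiag i a ∈ hermitianGrading N p := fun r s => by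
  have ha' := standardInvolution_mem h ha
  rw [toMatrix_offDiag, Matrix.add_apply, Matrix.single_apply, Matrix.single_apply]
  refine add_mem ?_ ?_ <;> split_ifs
  exacts [Submodule.smul_mem _ _ ha, zero_mem _, Submodule.smul_mem _ _ ha', zero_mem _]

theorem toMatrix_jordanProduct_of_mem {i j : ZMod 2} {X Y : HermitianSpace N}
    (hX : X ∈ hermitianGrading N i) (hY : Y ∈ hermitianGrading N j) :
    toMatrix N (jordanProduct h X Y) = (2⁻¹ : k) •
      (toMatrix N X * toMatrix N Y + superSign k i j • (toMatrix N Y * toMatrix N X)) := by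
  rw [toMatrix_jordanProduct, symmetrizedProduct_of_mem hX hY]

theorem jordanProduct_mem {i j : ZMod 2} {X Y : HermitianSpace N}
    (hX : X ∈ hermitianGrading N i) (hY : Y ∈ hermitianGrading N j) :
    jordanProduct h X Y ∈ hermitianGrading N (i + j) := fun r s => by
  rw [h.toMatrix_jordanProduct_of_mem hX hY, Matrix.smul_apply, Matrix.add_apply,
    Matrix.smul_apply, Matrix.mul_apply, Matrix.mul_apply]
  refine Submodule.smul_mem _ _ (add_mem (Submodule.sum_mem _ fun m _ => ?_)
    (Submodule.smul_mem _ _ (Submodule.sum_mem _ fun m _ => ?_)))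
  · exact h.mul_mem _ _ _ (hX r m) _ (hY m s)
  · rw [add_comm]
    exact h.mul_mem _ _ _ (hY r m) _ (hX m s)

theorem jordanProduct_comm {i j : ZMod 2} {X Y : HermitianSpace N}
    (hX : X ∈ hermitianGrading N i) (hY : Y ∈ hermitianGrading N j) :
    jordanProduct h X Y = superSign k i j • jordanProduct h Y X := by
  refine toMatrix_injective N ?_
  rw [map_smul, h.toMatrix_jordanProduct_of_mem hX hY, h.toMatrix_jordanProduct_of_mem hY hX,
    smul_comm, superSign_comm k j i, smul_add (superSign k i j), smul_smul, superSign_mul_self,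
    one_smul, add_comm]

variable (hk : (2 : k) ≠ 0)

theorem two_inv_smul_two (x : C) (hk : (2 : k) ≠ 0) : (2⁻¹ : k) • (x + x) = x := by
  rw [← two_smul k x, smul_smul, inv_mul_cancel₀ hk, one_smul]

include h hk

theorem jordanProduct_diag_diag_self (i : Fin 3) :
    jordanProduct h (h.diag i) (h.diag i) = h.diag i := by
  refine toMatrix_injective N ?_
  rw [h.toMatrix_jordanProduct_of_mem (h.diag_mem i) (h.diag_mem i), superSign_zero_left, one_smul,
    toMatrix_diag, Matrix.single_mul_single_same, one_mul]
  ext r s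
  rw [Matrix.smul_apply, Matrix.add_apply, two_inv_smul_two _ hk]

omit hk in
theorem jordanProduct_diag_diag {i j : Fin 3} (hij : i ≠ j) :
    jordanProduct h (h.diag i) (h.diag j) = 0 := by
  refine toMatrix_injective N ?_
  rw [h.toMatrix_jordanProduct_of_mem (h.diag_mem i) (h.diag_mem j),
    toMatrix_diag, toMatrix_diag, Matrix.single_mul_single_of_ne _ _ _ _ hij,
    Matrix.single_mul_single_of_ne _ _ _ _ hij.symm]
  simp

omit hk in
theorem jordanProduct_diag_offDiag_self (i : Fin 3) (a : C) :
    jordanProduct h (h.diag i) (h.offDiag i a) = 0 := by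
  have h1 := Fin.three_ne_add_one i
  have h2 := Fin.three_ne_add_two i
  induction a using superspace_induction 𝒞 with
  | add x y hx hy => rw [map_add, map_add, hx, hy, add_zero]
  | hom p a ha =>
    refine toMatrix_injective N ?_
    rw [h.toMatrix_jordanProduct_of_mem (h.diag_mem i) (h.offDiag_mem i ha), toMatrix_diag,
      toMatrix_offDiag]
    simp [add_mul, mul_add, h1, h2, h1.symm, h2.symm]

omit hk in
theorem jordanProduct_diag_offDiag {i j : Fin 3} (hij : i ≠ j) (a : C) :
    jordanProduct h (h.diag i) (h.offDiag j a) = (2⁻¹ : k) • h.offDiag j a := by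
  have h1 := Fin.three_add_one_ne_add_two j
  have h3 : i = j + 1 ∨ i = j + 2 := (Fin.three_cases j i).resolve_left hij.symm
  induction a using superspace_induction 𝒞 with
  | add x y hx hy => rw [map_add, map_add, hx, hy, smul_add]
  | hom p a ha =>
    refine toMatrix_injective N ?_
    rw [h.toMatrix_jordanProduct_of_mem (h.diag_mem i) (h.offDiag_mem j ha), toMatrix_diag,
      map_smul, toMatrix_offDiag]
    rcases h3 with rfl | rfl <;>
      simp [add_mul, mul_add, h1, h1.symm, superSign_zero_left, add_comm]

/-- The factor `2` in `offDiag` is there for this formula: it makes the scalars cancel, since `2⁻¹ *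
(2 * 2) = 2`. The placement of the conjugates makes the formula the same for all `i`. -/
theorem jordanProduct_offDiag_succ (i : Fin 3) (a b : C) :
    jordanProduct h (h.offDiag i a) (h.offDiag (i + 1) b) = h.offDiag (i + 2) (paraProduct N a b) := by
  have h1 := Fin.three_add_one_ne_add_two i
  have h2 := Fin.three_ne_add_one i
  have h3 := Fin.three_ne_add_two i
  induction a using superspace_induction 𝒞 with
  | add x y hx hy => simp only [map_add, LinearMap.add_apply, hx, hy]
  | hom p a ha =>
  induction b using superspace_induction 𝒞 with
  | add x y hx hy => simp only [map_add, hx, hy]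
  | hom q b hb =>
    refine toMatrix_injective N ?_
    rw [h.toMatrix_jordanProduct_of_mem (h.offDiag_mem i ha) (h.offDiag_mem _ hb),
      toMatrix_offDiag, toMatrix_offDiag, toMatrix_offDiag, h.conj_paraProduct ha hb,
      paraProduct_apply]
    simp only [Fin.three_add_one_add_one, Fin.three_add_one_add_two, Fin.three_add_two_add_one,
      Fin.three_add_two_add_two, add_mul, mul_add, Matrix.single_mul_single_same, h1, h1.symm, h2,
      h2.symm, h3, h3.symm, ne_eq, not_false_eq_true, Matrix.single_mul_single_of_ne, add_zero,
      zero_add, Matrix.smul_single, smul_add, smul_mul_assoc, mul_smul_comm, smul_smul]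
    congr 3
    · linear_combination 2 * inv_mul_cancel₀ hk
    · linear_combination (2 * superSign k p q) * inv_mul_cancel₀ hk

theorem jordanProduct_offDiag_self (i : Fin 3) (a b : C) :
    jordanProduct h (h.offDiag i a) (h.offDiag i b)
      = (2 * N.b a b) • (h.diag (i + 1) + h.diag (i + 2)) := by
  have h1 := Fin.three_add_one_ne_add_two i
  induction a using superspace_induction 𝒞 with
  | add x y hx hy => simp only [map_add, LinearMap.add_apply, hx, hy, mul_add, add_smul]
  | hom p a ha =>
  induction b using superspace_induction 𝒞 with
  | add x y hx hy => simp only [map_add, hx, hy, mul_add, add_smul]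
  | hom q b hb =>
    have e1 := h.conj_mul_mul ha hb h.one_mem
    have e2 := h.mul_mul_conj (standardInvolution_mem h ha) (standardInvolution_mem h hb) h.one_mem
    simp only [mul_one, one_mul, h.conj_conj, h.form_conj_conj] at e1 e2
    have e3 := h.mul_mul_conj ha hb h.one_mem
    simp only [one_mul] at e3
    refine toMatrix_injective N ?_
    rw [h.toMatrix_jordanProduct_of_mem (h.offDiag_mem i ha) (h.offDiag_mem _ hb),
      toMatrix_offDiag, toMatrix_offDiag, map_smul, map_add, toMatrix_diag, toMatrix_diag]
    simp only [add_mul, mul_add, Matrix.single_mul_single_same, h1, h1.symm, 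
      ne_eq, not_false_eq_true, Matrix.single_mul_single_of_ne, add_zero,
      zero_add, Matrix.smul_single, smul_add, smul_mul_assoc, mul_smul_comm, smul_smul]
    have e4 : (2⁻¹ * (2 * 2) : k) = 2 := by field_simp
    have e5 : 2⁻¹ * (superSign k p q * (2 * 2)) = 2 * superSign k p q := by field_simp
    -- The two diagonal entries arise as `ā b ± b̄ a` and as `a b̄ ± b ā`. Both equal `b(a,b) 1`, so
    -- each copy of this scalar is unfolded in its own way.
    rw [e4, e5, mul_smul, mul_smul, mul_smul, ← e1]
    nth_rw 2 [e1]
    rw [← e3, smul_add, smul_add, Matrix.single_add, Matrix.single_add]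
    abel

/-- The coordinate of a hermitian matrix at `h.diag i`. -/
def diagCoord (N : QuadraticSuperform 𝒞) (i : Fin 3) : HermitianSpace N →ₗ[k] k :=
  (2⁻¹ : k) • (N.b 1 ∘ₗ Matrix.entryLinearMap k C i i ∘ₗ toMatrix N)

/-- The coordinate of a hermitian matrix at `h.offDiag i`. -/
def offDiagCoord (N : QuadraticSuperform 𝒞) (i : Fin 3) : HermitianSpace N →ₗ[k] C :=
  (2⁻¹ : k) • (Matrix.entryLinearMap k C (i + 2) (i + 1) ∘ₗ toMatrix N)

omit h hk in
theorem diagCoord_apply (i : Fin 3) (X : HermitianSpace N) :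
    diagCoord N i X = 2⁻¹ * N.b 1 (toMatrix N X i i) := rfl

omit h hk in
theorem offDiagCoord_apply (i : Fin 3) (X : HermitianSpace N) :
    offDiagCoord N i X = (2⁻¹ : k) • toMatrix N X (i + 2) (i + 1) := rfl

theorem diagCoord_diag_self (i : Fin 3) : diagCoord N i (h.diag i) = 1 := by
  rw [diagCoord_apply, toMatrix_diag, Matrix.single_apply_same, h.form_one_one, inv_mul_cancel₀ hk]

omit hk in
theorem diagCoord_diag {i j : Fin 3} (hij : i ≠ j) : diagCoord N i (h.diag j) = 0 := by
  simp [diagCoord_apply, toMatrix_diag, hij.symm]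

omit hk in
theorem diagCoord_offDiag (i j : Fin 3) (a : C) : diagCoord N i (h.offDiag j a) = 0 := by
  rw [diagCoord_apply, toMatrix_offDiag, Matrix.add_apply,
    Matrix.single_apply_of_ne _ _ _ _ _ (by omega), Matrix.single_apply_of_ne _ _ _ _ _ (by omega)]
  simp

omit hk in
theorem offDiagCoord_diag (i j : Fin 3) : offDiagCoord N i (h.diag j) = 0 := by
  rw [offDiagCoord_apply, toMatrix_diag, Matrix.single_apply_of_ne _ _ _ _ _ (by omega), smul_zero]

theorem offDiagCoord_offDiag_self (i : Fin 3) (a : C) : offDiagCoord N i (h.offDiag i a) = a := by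
  rw [offDiagCoord_apply, toMatrix_offDiag, Matrix.add_apply, Matrix.single_apply_same,
    Matrix.single_apply_of_ne _ _ _ _ _ (by omega), add_zero, smul_smul, inv_mul_cancel₀ hk,
    one_smul]

omit hk in
theorem offDiagCoord_offDiag {i j : Fin 3} (hij : i ≠ j) (a : C) :
    offDiagCoord N i (h.offDiag j a) = 0 := by
  rw [offDiagCoord_apply, toMatrix_offDiag, Matrix.add_apply,
    Matrix.single_apply_of_ne _ _ _ _ _ (by omega), Matrix.single_apply_of_ne _ _ _ _ _ (by omega),
    add_zero, smul_zero]

theorem sum_coord (X : HermitianSpace N) :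
    ∑ i, diagCoord N i X • h.diag i + ∑ i, h.offDiag i (offDiagCoord N i X) = X := by
  refine ext_matrix fun r s => ?_
  rw [map_add, map_sum, map_sum]
  simp only [map_smul, toMatrix_diag, toMatrix_offDiag, diagCoord_apply, offDiagCoord_apply,
    conj_toMatrix]
  -- A diagonal entry `x` satisfies `x̄ = x`, that is `2 x = b(x,1) 1`; it is therefore a scalar.
  have e : ∀ i, (2⁻¹ * N.b 1 (toMatrix N X i i)) • (1 : C) = toMatrix N X i i := fun i => by
    have h1 := conj_toMatrix X i i
    rw [standardInvolution_apply, sub_eq_iff_eq_add, ← two_smul k] at h1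
    rw [h.form_one_left, mul_smul, h1, smul_smul, inv_mul_cancel₀ hk, one_smul]
  simp only [Matrix.smul_single, e]
  fin_cases r <;> fin_cases s <;> simp [Fin.sum_univ_three, inv_smul_smul₀ hk]

theorem diagCoord_of_odd (i : Fin 3) {X : HermitianSpace N} (hX : X ∈ hermitianGrading N 1) :
    diagCoord N i X = 0 := by
  rw [diagCoord_apply, h.form_one_left, h.form_one_of_odd (hX i i), mul_zero]

omit h hk in
theorem offDiagCoord_mem (i : Fin 3) {p : ZMod 2} {X : HermitianSpace N}
    (hX : X ∈ hermitianGrading N p) : offDiagCoord N i X ∈ 𝒞 p :=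
  Submodule.smul_mem _ _ (hX _ _)

/-- An additive property of the homogeneous elements of parity `p` of `J` holds once it holds for
the elements `h.offDiag i a` and, if `p = 0`, for the multiples of `h.diag i`. -/
theorem grading_induction {p : ZMod 2} {P : HermitianSpace N → Prop}
    (diag : p = 0 → ∀ (c : k) i, P (c • h.diag i))
    (offDiag : ∀ i, ∀ a ∈ 𝒞 p, P (h.offDiag i a)) (add : ∀ X Y, P X → P Y → P (X + Y))
    {X : HermitianSpace N} (hX : X ∈ hermitianGrading N p) : P X := by
  have h0 : P 0 := by simpa using offDiag 0 0 (zero_mem _)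
  have h1 : ∀ i, P (diagCoord N i X • h.diag i) := fun i => by
    rcases zmod_two_cases p with rfl | rfl
    · exact diag rfl _ i
    · rw [h.diagCoord_of_odd hk i hX, zero_smul]
      exact h0
  rw [← h.sum_coord hk X]
  exact add _ _ (Finset.sum_induction _ _ add h0 fun i _ => h1 i)
    (Finset.sum_induction _ _ add h0 fun i _ => offDiag i _ (offDiagCoord_mem i hX))

theorem exists_homogeneous (X : HermitianSpace N) :
    ∃ Y ∈ hermitianGrading N 0, ∃ Z ∈ hermitianGrading N 1, X = Y + Z := by
  have key : ∀ a : C, ∃ b ∈ 𝒞 0, ∃ c ∈ 𝒞 1, a = b + c := fun a => by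
    induction a using superspace_induction 𝒞 with
    | hom i x hx =>
      rcases zmod_two_cases i with rfl | rfl
      · exact ⟨x, hx, 0, zero_mem _, (add_zero x).symm⟩
      · exact ⟨0, zero_mem _, x, hx, (zero_add x).symm⟩
    | add x y hx hy =>
      obtain ⟨b, hb, c, hc, rfl⟩ := hx
      obtain ⟨b', hb', c', hc', rfl⟩ := hy
      exact ⟨b + b', add_mem hb hb', c + c', add_mem hc hc', by abel⟩
  choose b hb c hc e using fun i => key (offDiagCoord N i X)
  refine ⟨∑ i, diagCoord N i X • h.diag i + ∑ i, h.offDiag i (b i), ?_,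
    ∑ i, h.offDiag i (c i), ?_, ?_⟩
  · exact add_mem (Submodule.sum_mem _ fun i _ => Submodule.smul_mem _ _ (h.diag_mem i))
      (Submodule.sum_mem _ fun i _ => h.offDiag_mem i (hb i))
  · exact Submodule.sum_mem _ fun i _ => h.offDiag_mem i (hc i)
  · conv_lhs => rw [← h.sum_coord hk X]
    rw [add_assoc, ← Finset.sum_add_distrib (f := fun i => h.offDiag i (b i))]
    congr 1
    exact Finset.sum_congr rfl fun i _ => by rw [e, map_add]

/-- Linear maps on `J` agree if they agree on the elements `h.diag i` and `h.offDiag i a` with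
`a` homogeneous. -/
theorem hom_ext {M : Type*} [AddCommGroup M] [Module k M] {f g : HermitianSpace N →ₗ[k] M}
    (diag : ∀ i, f (h.diag i) = g (h.diag i))
    (offDiag : ∀ i p, ∀ a ∈ 𝒞 p, f (h.offDiag i a) = g (h.offDiag i a)) : f = g := by
  have key : ∀ i a, f (h.offDiag i a) = g (h.offDiag i a) := fun i a => by
    induction a using superspace_induction 𝒞 with
    | hom p x hx => exact offDiag i p x hx
    | add x y hx hy => simp only [map_add, hx, hy]
  ext X
  rw [← h.sum_coord hk X]
  simp only [map_add, map_sum, map_smul, diag, key]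

omit hk in
theorem grading_disjoint {i j : ZMod 2} (hij : i ≠ j) {X : HermitianSpace N}
    (hi : X ∈ hermitianGrading N i) (hj : X ∈ hermitianGrading N j) : X = 0 :=
  ext_matrix fun r s => by
    rw [superspace_disjoint 𝒞 hij (hi r s) (hj r s), map_zero, Matrix.zero_apply]

theorem jordanProduct_offDiag_succ_comm (i : Fin 3) {p q : ZMod 2} {a b : C}
    (ha : a ∈ 𝒞 p) (hb : b ∈ 𝒞 q) : jordanProduct h (h.offDiag (i + 1) b) (h.offDiag i a)
      = superSign k p q • h.offDiag (i + 2) (paraProduct N a b) := by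
  rw [h.jordanProduct_comm (h.offDiag_mem _ hb) (h.offDiag_mem _ ha),
    h.jordanProduct_offDiag_succ hk, superSign_comm]

theorem jordanProduct_diag_comm (i : Fin 3) (X : HermitianSpace N) :
    jordanProduct h X (h.diag i) = jordanProduct h (h.diag i) X := by
  obtain ⟨Y, hY, Z, hZ, rfl⟩ := h.exists_homogeneous hk X
  simp only [map_add, LinearMap.add_apply, h.jordanProduct_comm hY (h.diag_mem i),
    h.jordanProduct_comm hZ (h.diag_mem i), superSign_zero_right, one_smul]

end IsHurwitzSuperalgebra
end HermitianMatrices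

/-! ### Supercommutators and derivations of an arbitrary superalgebra. -/

section SuperBracket

variable {k A : Type*} [Field k] [AddCommGroup A] [Module k A] {𝒜 : ZMod 2 → Submodule k A}
  {μ : A →ₗ[k] A →ₗ[k] A}

/-- The supercommutator of endomorphisms `f` of parity `i` and `g` of parity `j`. -/
def superBracket (i j : ZMod 2) (f g : Module.End k A) : Module.End k A :=
  f * g - superSign k i j • (g * f)

theorem superBracket_apply (i j : ZMod 2) (f g : Module.End k A) (x : A) :
    superBracket i j f g x = f (g x) - superSign k i j • g (f x) := rfl

theorem superBracket_add_right (i j : ZMod 2) (f g g' : Module.End k A) :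
    superBracket i j f (g + g') = superBracket i j f g + superBracket i j f g' := by
  simp only [superBracket, mul_add, add_mul, smul_add]
  abel

theorem superBracket_add_left (i j : ZMod 2) (f f' g : Module.End k A) :
    superBracket i j (f + f') g = superBracket i j f g + superBracket i j f' g := by
  simp only [superBracket, mul_add, add_mul, smul_add]
  abel

theorem superBracket_smul_right (i j : ZMod 2) (c : k) (f g : Module.End k A) :
    superBracket i j f (c • g) = c • superBracket i j f g := by
  simp only [superBracket, mul_smul_comm, smul_mul_assoc, smul_sub, smul_comm c]

theorem superBracket_smul_left (i j : ZMod 2) (c : k) (f g : Module.End k A) :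
    superBracket i j (c • f) g = c • superBracket i j f g := by
  simp only [superBracket, mul_smul_comm, smul_mul_assoc, smul_sub, smul_comm c]

theorem superBracket_swap (i j : ZMod 2) (f g : Module.End k A) :
    superBracket i j f g = -superSign k i j • superBracket j i g f := by
  rw [superBracket, superBracket, smul_sub, smul_smul, superSign_comm k j i, neg_mul,
    superSign_mul_self, neg_smul, neg_smul, one_smul]
  abel

/-- The super Jacobi identity, in the form that `ad d` is a superderivation of the bracket. -/
theorem superBracket_superBracket (i j l : ZMod 2) (d f g : Module.End k A) :
    superBracket i (j + l) d (superBracket j l f g)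
      = superBracket (i + j) l (superBracket i j d f) g
        + superSign k i j • superBracket j (i + l) f (superBracket i l d g) := by
  simp only [superBracket, superSign_add_left, superSign_add_right, superSign_comm k j i]
  rcases zmod_two_cases i with rfl | rfl <;> rcases zmod_two_cases j with rfl | rfl <;>
    rcases zmod_two_cases l with rfl | rfl <;>
    simp only [superSign_zero_right, superSign_zero_left, superSign_one_one, one_smul, mul_one,
      neg_smul, neg_neg, mul_neg] <;> noncomm_ring

theorem superBracket_mem_endGrading {i j : ZMod 2} {f g : Module.End k A}
    (hf : f ∈ endGrading 𝒜 i) (hg : g ∈ endGrading 𝒜 j) :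
    superBracket i j f g ∈ endGrading 𝒜 (i + j) := fun l x hx => by
  refine sub_mem ?_ (Submodule.smul_mem _ _ ?_)
  · rw [add_assoc]
    exact hf _ _ (hg _ _ hx)
  · rw [add_comm i j, add_assoc]
    exact hg _ _ (hf _ _ hx)

theorem superBracket_mem_homogeneousDerivations {i j : ZMod 2} {f g : Module.End k A}
    (hf : f ∈ homogeneousDerivations 𝒜 μ i) (hg : g ∈ homogeneousDerivations 𝒜 μ j) :
    superBracket i j f g ∈ homogeneousDerivations 𝒜 μ (i + j) := by
  refine ⟨superBracket_mem_endGrading hf.1 hg.1, fun l x hx y => ?_⟩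
  simp only [superBracket_apply, hf.2 l x hx, hg.2 l x hx, map_add, map_sub, map_smul,
    LinearMap.sub_apply, LinearMap.smul_apply, hf.2 _ _ (hg.1 l x hx), hg.2 _ _ (hf.1 l x hx),
    superSign_add_left, superSign_add_right, superSign_comm k j i]
  rcases zmod_two_cases i with rfl | rfl <;> rcases zmod_two_cases j with rfl | rfl <;>
    rcases zmod_two_cases l with rfl | rfl <;>
    simp only [superSign_zero_right, superSign_zero_left, superSign_one_one] <;> module

theorem superBracket_derivation_mul {i j : ZMod 2} {d : Module.End k A}
    (hd : d ∈ homogeneousDerivations 𝒜 μ i) {x : A} (hx : x ∈ 𝒜 j) :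
    superBracket i j d (μ x) = μ (d x) := by
  ext y
  rw [superBracket_apply, hd.2 j x hx]
  abel

theorem superBracket_mem_superCommutator {L M : Submodule k (Module.End k A)} {i j : ZMod 2}
    {f g : Module.End k A} (hf : f ∈ L) (hfi : f ∈ endGrading 𝒜 i) (hg : g ∈ M)
    (hgj : g ∈ endGrading 𝒜 j) : superBracket i j f g ∈ superCommutator 𝒜 L M :=
  Submodule.subset_span ⟨i, j, f, ⟨hf, hfi⟩, g, ⟨hg, hgj⟩, rfl⟩

theorem superCommutator_le {L M K : Submodule k (Module.End k A)}
    (H : ∀ i j, ∀ f ∈ L, f ∈ endGrading 𝒜 i → ∀ g ∈ M, g ∈ endGrading 𝒜 j →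
      superBracket i j f g ∈ K) : superCommutator 𝒜 L M ≤ K := by
  refine Submodule.span_le.2 ?_
  rintro _ ⟨i, j, f, hf, g, hg, rfl⟩
  exact H i j f hf.1 hf.2 g hg.1 hg.2

theorem isGradedSubspace_span {s : Set (Module.End k A)}
    (hs : ∀ f ∈ s, f ∈ endGrading 𝒜 0 ∨ f ∈ endGrading 𝒜 1) :
    IsGradedSubspace 𝒜 (Submodule.span k s) := by
  refine le_antisymm (Submodule.span_le.2 fun f hf => ?_) (sup_le inf_le_left inf_le_left)
  rcases hs f hf with h0 | h1
  · exact Submodule.mem_sup_left ⟨Submodule.subset_span hf, h0⟩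
  · exact Submodule.mem_sup_right ⟨Submodule.subset_span hf, h1⟩

theorem isGradedSubspace_superCommutator (L M : Submodule k (Module.End k A)) :
    IsGradedSubspace 𝒜 (superCommutator 𝒜 L M) := by
  refine isGradedSubspace_span ?_
  rintro _ ⟨i, j, f, hf, g, hg, rfl⟩
  have := superBracket_mem_endGrading hf.2 hg.2
  rcases zmod_two_cases (i + j) with e | e <;> rw [e] at this
  exacts [Or.inl this, Or.inr this]

theorem isGradedSubspace_superDerivations : IsGradedSubspace 𝒜 (superDerivations 𝒜 μ) :=
  le_antisymm (sup_le_sup (le_inf le_sup_left fun _ hd => hd.1)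
    (le_inf le_sup_right fun _ hd => hd.1)) (sup_le inf_le_left inf_le_left)

end SuperBracket

/-! ### The operators `D_i(a)` and a criterion for derivations of `J`. -/

section OffDiagonalDerivations

variable {k C : Type*} [Field k] [NonAssocRing C] [Module k C]
  [IsScalarTower k C C] [SMulCommClass k C C]
  {𝒞 : ZMod 2 → Submodule k C} [DirectSum.Decomposition 𝒞] {N : QuadraticSuperform 𝒞}

open HermitianSpace

namespace IsHurwitzSuperalgebra

variable (h : IsHurwitzSuperalgebra 𝒞 N)

/-- The inner derivation `2 [L_x, L_e]` of `J`, for `x = h.offDiag i a` and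
`e = h.diag (i + 1)`. -/
def offDiagDer (i : Fin 3) : C →ₗ[k] Module.End k (HermitianSpace N) :=
  (2 : k) • ((LinearMap.mulRight k (jordanProduct h (h.diag (i + 1)))
    - LinearMap.mulLeft k (jordanProduct h (h.diag (i + 1)))) ∘ₗ jordanProduct h ∘ₗ h.offDiag i)

/-- The idempotent is even, so the sign is `+1` for every parity of `a`; the parities `0 0` are
correct for odd `a` as well. -/
theorem offDiagDer_eq (i : Fin 3) (a : C) : h.offDiagDer i a
    = (2 : k) • superBracket 0 0 (jordanProduct h (h.offDiag i a))
      (jordanProduct h (h.diag (i + 1))) := by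
  rw [superBracket, superSign_zero_left, one_smul]
  rfl

theorem offDiagDer_apply (i : Fin 3) (a : C) (X : HermitianSpace N) : h.offDiagDer i a X
    = (2 : k) • (jordanProduct h (h.offDiag i a) (jordanProduct h (h.diag (i + 1)) X)
      - jordanProduct h (h.diag (i + 1)) (jordanProduct h (h.offDiag i a) X)) := rfl

theorem jordanProduct_mem_endGrading {i : ZMod 2} {X : HermitianSpace N}
    (hX : X ∈ hermitianGrading N i) :
    jordanProduct h X ∈ endGrading (hermitianGrading N) i :=
  fun _ _ hY => h.jordanProduct_mem hX hY

theorem offDiagDer_mem_endGrading (i : Fin 3) {p : ZMod 2} {a : C} (ha : a ∈ 𝒞 p) :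
    h.offDiagDer i a ∈ endGrading (hermitianGrading N) p := by
  have h1 := superBracket_mem_endGrading (h.jordanProduct_mem_endGrading (h.offDiag_mem i ha))
    (h.jordanProduct_mem_endGrading (h.diag_mem (i + 1)))
  rw [add_zero, superBracket, superSign_zero_right] at h1
  rw [offDiagDer_eq, superBracket, superSign_zero_left]
  exact Submodule.smul_mem _ _ h1

variable (hk : (2 : k) ≠ 0)
include h hk

theorem jordanProduct_offDiag_diag_self (i : Fin 3) (a : C) :
    jordanProduct h (h.offDiag i a) (h.diag i) = 0 := by
  rw [h.jordanProduct_diag_comm hk, h.jordanProduct_diag_offDiag_self]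

theorem jordanProduct_offDiag_diag {i j : Fin 3} (hij : i ≠ j) (a : C) :
    jordanProduct h (h.offDiag i a) (h.diag j) = (2⁻¹ : k) • h.offDiag i a := by
  rw [h.jordanProduct_diag_comm hk, h.jordanProduct_diag_offDiag hij.symm]

theorem jordanProduct_offDiag_one_two (i : Fin 3) (a b : C) :
    jordanProduct h (h.offDiag (i + 1) a) (h.offDiag (i + 2) b)
      = h.offDiag i (paraProduct N a b) := by
  have := h.jordanProduct_offDiag_succ hk (i + 1) a b
  rwa [Fin.three_add_one_add_one, Fin.three_add_one_add_two] at this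

theorem jordanProduct_offDiag_two_zero (i : Fin 3) (a b : C) :
    jordanProduct h (h.offDiag (i + 2) a) (h.offDiag i b)
      = h.offDiag (i + 1) (paraProduct N a b) := by
  have := h.jordanProduct_offDiag_succ hk (i + 2) a b
  rwa [Fin.three_add_two_add_one, Fin.three_add_two_add_two] at this

theorem jordanProduct_offDiag_two_one (i : Fin 3) {p q : ZMod 2} {a b : C}
    (ha : a ∈ 𝒞 p) (hb : b ∈ 𝒞 q) : jordanProduct h (h.offDiag (i + 2) b) (h.offDiag (i + 1) a)
      = superSign k p q • h.offDiag i (paraProduct N a b) := by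
  have := h.jordanProduct_offDiag_succ_comm hk (i + 1) ha hb
  rwa [Fin.three_add_one_add_one, Fin.three_add_one_add_two] at this

theorem jordanProduct_offDiag_zero_two (i : Fin 3) {p q : ZMod 2} {a b : C}
    (ha : a ∈ 𝒞 p) (hb : b ∈ 𝒞 q) : jordanProduct h (h.offDiag i b) (h.offDiag (i + 2) a)
      = superSign k p q • h.offDiag (i + 1) (paraProduct N a b) := by
  have := h.jordanProduct_offDiag_succ_comm hk (i + 2) ha hb
  rwa [Fin.three_add_two_add_one, Fin.three_add_two_add_two] at this

theorem offDiagDer_diag_self (i : Fin 3) (a : C) : h.offDiagDer i a (h.diag i) = 0 := by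
  rw [offDiagDer_apply, h.jordanProduct_diag_diag (Fin.three_ne_add_one i).symm,
    h.jordanProduct_offDiag_diag_self hk, map_zero, map_zero, sub_zero, smul_zero]

theorem offDiagDer_diag_one (i : Fin 3) (a : C) :
    h.offDiagDer i a (h.diag (i + 1)) = (2⁻¹ : k) • h.offDiag i a := by
  have hi := Fin.three_ne_add_one i
  rw [offDiagDer_apply, h.jordanProduct_diag_diag_self hk, h.jordanProduct_offDiag_diag hk hi,
    map_smul, h.jordanProduct_diag_offDiag hi.symm, smul_smul, ← sub_smul, smul_smul]
  congr 1
  field_simp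
  norm_num

theorem offDiagDer_diag_two (i : Fin 3) (a : C) :
    h.offDiagDer i a (h.diag (i + 2)) = -(2⁻¹ : k) • h.offDiag i a := by
  have hi := Fin.three_ne_add_one i
  rw [offDiagDer_apply, h.jordanProduct_diag_diag (Fin.three_add_one_ne_add_two i), map_zero,
    h.jordanProduct_offDiag_diag hk (Fin.three_ne_add_two i),
    map_smul, h.jordanProduct_diag_offDiag hi.symm, smul_smul, zero_sub, smul_neg, smul_smul,
    neg_smul]
  congr 2
  field_simp

theorem offDiagDer_offDiag_self (i : Fin 3) (a b : C) :
    h.offDiagDer i a (h.offDiag i b) = (2 * N.b a b) • (h.diag (i + 2) - h.diag (i + 1)) := by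
  rw [offDiagDer_apply, h.jordanProduct_diag_offDiag (Fin.three_ne_add_one i).symm, map_smul,
    h.jordanProduct_offDiag_self hk, map_smul, map_add,
    h.jordanProduct_diag_diag_self hk, h.jordanProduct_diag_diag (Fin.three_add_one_ne_add_two i),
    add_zero, smul_smul, ← mul_assoc, inv_mul_cancel₀ hk]
  module

theorem offDiagDer_offDiag_one (i : Fin 3) (a b : C) :
    h.offDiagDer i a (h.offDiag (i + 1) b) = -h.offDiag (i + 2) (paraProduct N a b) := by
  rw [offDiagDer_apply, h.jordanProduct_diag_offDiag_self, map_zero,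
    h.jordanProduct_offDiag_succ hk, h.jordanProduct_diag_offDiag (Fin.three_add_one_ne_add_two i),
    zero_sub, smul_neg, smul_inv_smul₀ hk]

theorem offDiagDer_offDiag_two (i : Fin 3) {p q : ZMod 2} {a b : C} (ha : a ∈ 𝒞 p) (hb : b ∈ 𝒞 q) :
    h.offDiagDer i a (h.offDiag (i + 2) b)
      = superSign k p q • h.offDiag (i + 1) (paraProduct N b a) := by
  rw [offDiagDer_apply, h.jordanProduct_diag_offDiag (Fin.three_add_one_ne_add_two i), map_smul,
    h.jordanProduct_offDiag_zero_two hk i hb ha, map_smul, h.jordanProduct_diag_offDiag_self,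
    smul_zero, sub_zero, smul_inv_smul₀ hk, superSign_comm]

/-- An endomorphism `d` of parity `p` is a derivation of `J` if it satisfies the Leibniz rule for
suitable pairs of spanning elements. -/
theorem mem_homogeneousDerivations {p : ZMod 2} {d : Module.End k (HermitianSpace N)}
    (hd : d ∈ endGrading (hermitianGrading N) p)
    (dd : ∀ i j, d (jordanProduct h (h.diag i) (h.diag j))
      = jordanProduct h (d (h.diag i)) (h.diag j) + jordanProduct h (h.diag i) (d (h.diag j)))
    (od : ∀ i j, ∀ q, ∀ b ∈ 𝒞 q, d (jordanProduct h (h.diag i) (h.offDiag j b))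
      = jordanProduct h (d (h.diag i)) (h.offDiag j b)
        + jordanProduct h (h.diag i) (d (h.offDiag j b)))
    (oo : ∀ i, ∀ q, ∀ a ∈ 𝒞 q, ∀ r, ∀ b ∈ 𝒞 r,
      d (jordanProduct h (h.offDiag i a) (h.offDiag i b))
        = jordanProduct h (d (h.offDiag i a)) (h.offDiag i b)
          + superSign k p q • jordanProduct h (h.offDiag i a) (d (h.offDiag i b)))
    (os : ∀ i, ∀ q, ∀ a ∈ 𝒞 q, ∀ r, ∀ b ∈ 𝒞 r,
      d (jordanProduct h (h.offDiag i a) (h.offDiag (i + 1) b))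
        = jordanProduct h (d (h.offDiag i a)) (h.offDiag (i + 1) b)
          + superSign k p q • jordanProduct h (h.offDiag i a) (d (h.offDiag (i + 1) b))) :
    d ∈ homogeneousDerivations (hermitianGrading N) (jordanProduct h) p := by
  -- By supercommutativity the Leibniz rule for `(X, Y)` gives the one for `(Y, X)`, so only one
  -- order of each pair of spanning elements has to be assumed.
  have swap : ∀ q, ∀ X ∈ hermitianGrading N q, ∀ r, ∀ Y ∈ hermitianGrading N r,
      d (jordanProduct h X Y) = jordanProduct h (d X) Y + superSign k p q • jordanProduct h X (d Y)
      → d (jordanProduct h Y X)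
        = jordanProduct h (d Y) X + superSign k p r • jordanProduct h Y (d X) := by
    intro q X hX r Y hY H
    rw [h.jordanProduct_comm hY hX, map_smul, H, h.jordanProduct_comm (hd _ _ hX) hY,
      h.jordanProduct_comm hX (hd _ _ hY)]
    simp only [superSign_add_left, superSign_add_right, superSign_comm k q p, superSign_comm k r q]
    rcases zmod_two_cases p with rfl | rfl <;> rcases zmod_two_cases q with rfl | rfl <;>
      rcases zmod_two_cases r with rfl | rfl <;>
      simp only [superSign_zero_right, superSign_zero_left, superSign_one_one] <;> module
  have hom : ∀ q, ∀ X ∈ hermitianGrading N q, ∀ r, ∀ Y ∈ hermitianGrading N r,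
      d (jordanProduct h X Y)
        = jordanProduct h (d X) Y + superSign k p q • jordanProduct h X (d Y) := by
    intro q X hX r Y hY
    refine h.grading_induction hk (P := fun X => d (jordanProduct h X Y)
        = jordanProduct h (d X) Y + superSign k p q • jordanProduct h X (d Y)) ?_ ?_ ?_ hX
    · rintro rfl c i
      simp only [map_smul, LinearMap.smul_apply, superSign_zero_right, one_smul, ← smul_add]
      congr 1
      refine h.grading_induction hk (P := fun Y => d (jordanProduct h (h.diag i) Y)
        = jordanProduct h (d (h.diag i)) Y + jordanProduct h (h.diag i) (d Y)) ?_ ?_ ?_ hY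
      · rintro rfl c j
        simp only [map_smul, dd, smul_add]
      · exact fun j b hb => od i j r b hb
      · intro Y Z hY hZ
        simp only [map_add, hY, hZ]
        abel
    · intro i a ha
      refine h.grading_induction hk (P := fun Y => d (jordanProduct h (h.offDiag i a) Y)
        = jordanProduct h (d (h.offDiag i a)) Y
          + superSign k p q • jordanProduct h (h.offDiag i a) (d Y)) ?_ ?_ ?_ hY
      · rintro rfl c j
        simp only [map_smul, smul_comm _ c, ← smul_add]
        congr 1
        refine swap 0 _ (h.diag_mem j) q _ (h.offDiag_mem i ha) ?_
        rw [superSign_zero_right, one_smul]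
        exact od j i q a ha
      · intro j b hb
        rcases Fin.three_cases i j with rfl | rfl | rfl
        · exact oo i q a ha r b hb
        · exact os i q a ha r b hb
        -- The components `i` and `i + 2` are consecutive in the opposite order, because `i = (i +
        -- 2) + 1`.
        · have := os (i + 2) r b hb q a ha
          rw [Fin.three_add_two_add_one] at this
          exact swap r _ (h.offDiag_mem _ hb) q _ (h.offDiag_mem _ ha) this
      · intro Y Z hY hZ
        simp only [map_add, hY, hZ, smul_add]
        abel
    · intro Y Z hY hZ
      simp only [map_add, hY, hZ, smul_add, LinearMap.add_apply]
      abel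
  refine ⟨hd, fun q X hX Y => ?_⟩
  obtain ⟨Y, hY, Z, hZ, rfl⟩ := h.exists_homogeneous hk Y
  simp only [map_add, hom q X hX 0 Y hY, hom q X hX 1 Z hZ, smul_add]
  abel

end IsHurwitzSuperalgebra
end OffDiagonalDerivations

/-! ### The Leibniz rule for `D_i(a)`. -/

section OffDiagonalBrackets

variable {k C : Type*} [Field k] [NonAssocRing C] [Module k C]
  [IsScalarTower k C C] [SMulCommClass k C C]
  {𝒞 : ZMod 2 → Submodule k C} [DirectSum.Decomposition 𝒞] {N : QuadraticSuperform 𝒞}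

open HermitianSpace

namespace IsHurwitzSuperalgebra

variable (h : IsHurwitzSuperalgebra 𝒞 N) (hk : (2 : k) ≠ 0)
include h hk

/-- The Jordan identity of `J` is not used. On two off-diagonal elements the rule amounts to one of
the two composition identities for `•` or to associativity of the form, depending on the positions
of the components; the remaining cases are comparisons of scalars. -/
theorem offDiagDer_mem (l : Fin 3) {p : ZMod 2} {c : C} (hc : c ∈ 𝒞 p) :
    h.offDiagDer l c ∈ homogeneousDerivations (hermitianGrading N) (jordanProduct h) p := by
  have l1 := Fin.three_ne_add_one l
  have l2 := Fin.three_ne_add_two l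
  have l3 := Fin.three_add_one_ne_add_two l
  have l1' := l1.symm
  have l2' := l2.symm
  have l3' := l3.symm
  have hm : (2⁻¹ : k) * (2⁻¹ + 2⁻¹) = 2⁻¹ := by
    rw [← two_mul, mul_inv_cancel₀ hk, mul_one]
  refine h.mem_homogeneousDerivations hk (h.offDiagDer_mem_endGrading l hc) ?_ ?_ ?_ ?_
  · intro i j
    rcases Fin.three_cases l i with rfl | rfl | rfl <;>
    rcases Fin.three_cases l j with rfl | rfl | rfl <;>
    simp only [h.jordanProduct_diag_diag_self hk, h.jordanProduct_diag_diag, h.offDiagDer_diag_self hk,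
      h.offDiagDer_diag_one hk, h.offDiagDer_diag_two hk, ne_eq, l1, l2, l3, l1', l2', l3',
      not_false_eq_true, map_zero, map_smul, LinearMap.zero_apply, LinearMap.smul_apply,
      h.jordanProduct_offDiag_diag_self hk, h.jordanProduct_diag_offDiag_self,
      h.jordanProduct_diag_offDiag, h.jordanProduct_offDiag_diag hk, add_zero, smul_zero]
    all_goals
      simp only [smul_smul, ← add_smul]
      try rw [← zero_smul k (h.offDiag _ c)]
      try congr 1
      try linear_combination -hm
      try linear_combination hm
      try ring
  · intro i j q b hb
    rcases Fin.three_cases l i with rfl | rfl | rfl <;>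
    rcases Fin.three_cases l j with rfl | rfl | rfl <;>
    simp only [h.jordanProduct_diag_diag_self hk, h.jordanProduct_diag_diag, h.offDiagDer_diag_self hk,
      h.offDiagDer_diag_one hk, h.offDiagDer_diag_two hk, ne_eq, l1, l2, l3, l1', l2', l3',
      not_false_eq_true, map_zero, map_smul, map_neg, LinearMap.zero_apply, LinearMap.smul_apply,
      h.jordanProduct_diag_offDiag_self,
      h.jordanProduct_diag_offDiag, add_zero, smul_zero, zero_add,
      h.offDiagDer_offDiag_self hk, h.offDiagDer_offDiag_one hk, h.offDiagDer_offDiag_two hk l hc hb,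
      h.jordanProduct_offDiag_self hk, h.jordanProduct_offDiag_succ hk,
      h.jordanProduct_offDiag_zero_two hk l hb hc, map_sub, sub_zero, zero_sub]
    all_goals
      try simp only [superSign_comm k q p, smul_neg, neg_smul, add_neg_cancel]
      try match_scalars
      all_goals
        try rw [superSign_comm k q p]
        try field_simp
        try ring
  · intro i q a ha r b hb
    -- The form vanishes unless `a` and `b` have the same parity, and then the two signs are equal.
    -- The same trade of signs recurs below.
    have hs : superSign k p q * (superSign k p r * N.b a b) = N.b a b := by
      by_cases hqr : q = r
      · rw [hqr, ← mul_assoc, superSign_mul_self, one_mul]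
      · rw [QuadraticSuperform.form_eq_zero hqr ha hb, mul_zero, mul_zero]
    rcases Fin.three_cases l i with rfl | rfl | rfl
    · simp only [h.jordanProduct_offDiag_self hk, map_smul, map_add, h.offDiagDer_diag_one hk,
        h.offDiagDer_diag_two hk, h.offDiagDer_offDiag_self hk, map_sub, LinearMap.smul_apply,
        LinearMap.sub_apply, h.jordanProduct_diag_offDiag l1', h.jordanProduct_diag_offDiag l2',
        h.jordanProduct_offDiag_diag hk l1, h.jordanProduct_offDiag_diag hk l2]
      module
    · have key := congrArg (h.offDiag l) (h.paraProduct_paraProduct_right ha hc hb)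
      simp only [h.jordanProduct_offDiag_self hk, map_smul, map_add, h.offDiagDer_diag_self hk,
        h.offDiagDer_diag_two hk, h.offDiagDer_offDiag_one hk, map_neg,
        LinearMap.neg_apply, Fin.three_add_one_add_one, Fin.three_add_one_add_two,
        h.jordanProduct_offDiag_two_one hk l hb (h.paraProduct_mem hc ha),
        h.jordanProduct_offDiag_one_two hk] at key ⊢
      rw [superSign_add_right, superSign_comm k r p, superSign_comm k r q]
      rw [superSign_comm k q p] at key
      have e2 : 2 * N.b a b * -2⁻¹ = -(superSign k p q * (superSign k p r * N.b a b)) := by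
        rw [hs]
        linear_combination -N.b a b * mul_inv_cancel₀ hk
      rw [add_zero, smul_smul, e2, neg_smul, mul_smul, ← key, smul_add, smul_smul,
        show superSign k p q * (superSign k p q * superSign k q r * superSign k p r)
          = superSign k p r * superSign k q r by
            linear_combination superSign k p r * superSign k q r * superSign_mul_self k p q]
      module
    · have key := congrArg (h.offDiag l) (h.paraProduct_paraProduct_left ha hc hb)
      simp only [h.jordanProduct_offDiag_self hk, map_smul, map_add, h.offDiagDer_diag_self hk,
        h.offDiagDer_diag_one hk, h.offDiagDer_offDiag_two hk l hc ha,
        h.offDiagDer_offDiag_two hk l hc hb, LinearMap.smul_apply, Fin.three_add_two_add_one, Fin.three_add_two_add_two,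
        h.jordanProduct_offDiag_two_one hk l (h.paraProduct_mem hb hc) ha,
        h.jordanProduct_offDiag_one_two hk] at key ⊢
      rw [superSign_add_left, superSign_comm k r q]
      rw [superSign_comm k q p, mul_smul _ (N.b a b)] at key
      have e2 : 2 * N.b a b * 2⁻¹ = superSign k p q * (superSign k p q * N.b a b) := by
        rw [← mul_assoc, superSign_mul_self]
        linear_combination N.b a b * mul_inv_cancel₀ hk
      rw [zero_add, smul_smul, e2, mul_smul, mul_smul, ← key, smul_add]
      module
  · intro i q a ha r b hb
    rcases Fin.three_cases l i with rfl | rfl | rfl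
    · have key := congrArg (h.offDiag (l + 1)) (h.paraProduct_paraProduct_left ha hb hc)
      simp only [h.jordanProduct_offDiag_succ hk,
        h.offDiagDer_offDiag_two hk l hc (h.paraProduct_mem ha hb), h.offDiagDer_offDiag_self hk,
        map_smul, map_sub, LinearMap.smul_apply, LinearMap.sub_apply,
        h.jordanProduct_diag_offDiag_self, h.jordanProduct_diag_offDiag l3', sub_zero,
        h.offDiagDer_offDiag_one hk, map_neg, map_add,
        h.jordanProduct_offDiag_zero_two hk l (h.paraProduct_mem hc hb) ha] at key ⊢
      have e2 : 2 * N.b c a * 2⁻¹ = N.b c a := by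
        linear_combination N.b c a * mul_inv_cancel₀ hk
      have e3 := N.supersymmetric _ _ _ hc _ ha
      have hs : superSign k q r * N.b a c = superSign k p r * N.b a c := by
        by_cases hqr : q = p
        · rw [hqr]
        · rw [QuadraticSuperform.form_eq_zero hqr ha hc, mul_zero, mul_zero]
      rw [smul_smul, e2, e3]
      rw [hs] at key
      simp only [superSign_add_left, superSign_add_right, superSign_comm k r q,
        superSign_comm k r p, superSign_comm k q p] at key ⊢
      rcases zmod_two_cases p with rfl | rfl <;> rcases zmod_two_cases q with rfl | rfl <;>
        rcases zmod_two_cases r with rfl | rfl <;>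
        simp only [superSign_zero_right, superSign_zero_left, superSign_one_one] at key ⊢ <;>
        first
        | linear_combination (norm := module) key
        | linear_combination (norm := module) -key
    · have e1 := N.supersymmetric _ _ _ (h.paraProduct_mem ha hb) _ hc
      rw [h.form_paraProduct ha hb hc] at e1
      simp only [Fin.three_add_one_add_one, h.jordanProduct_offDiag_one_two hk,
        h.offDiagDer_offDiag_self hk, h.offDiagDer_offDiag_one hk, h.offDiagDer_offDiag_two hk l hc hb,
        h.jordanProduct_offDiag_self hk, map_smul, map_neg, LinearMap.neg_apply,
        Fin.three_add_two_add_one, Fin.three_add_two_add_two, Fin.three_add_one_add_two,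
        h.form_paraProduct hc ha hb, e1]
      rw [superSign_add_left, superSign_comm k r p, superSign_comm k q p]
      rcases zmod_two_cases p with rfl | rfl <;> rcases zmod_two_cases q with rfl | rfl <;>
        rcases zmod_two_cases r with rfl | rfl <;>
        simp only [superSign_zero_right, superSign_zero_left, superSign_one_one] <;>
        module
    · have key := congrArg (h.offDiag (l + 2)) (h.paraProduct_paraProduct_right hc ha hb)
      simp only [Fin.three_add_two_add_one, h.jordanProduct_offDiag_two_zero hk,
        h.offDiagDer_offDiag_one hk, h.offDiagDer_offDiag_two hk l hc ha, map_smul,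
        LinearMap.smul_apply, h.offDiagDer_offDiag_self hk, map_sub,
        h.jordanProduct_offDiag_diag_self hk, h.jordanProduct_offDiag_diag hk l3',
        h.jordanProduct_offDiag_succ_comm hk l hb (h.paraProduct_mem ha hc), map_add] at key ⊢
      have e2 : 2 * N.b c b * 2⁻¹ = N.b c b := by
        linear_combination N.b c b * mul_inv_cancel₀ hk
      have hs : superSign k q r * N.b c b = superSign k p q * N.b c b := by
        by_cases hqr : p = r
        · rw [hqr, superSign_comm]
        · rw [QuadraticSuperform.form_eq_zero hqr hc hb, mul_zero, mul_zero]
      rw [zero_sub, smul_neg, smul_smul (2 * N.b c b), e2]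
      rw [hs] at key
      simp only [superSign_add_right, superSign_comm k r q,
        superSign_comm k r p] at key ⊢
      rcases zmod_two_cases p with rfl | rfl <;> rcases zmod_two_cases q with rfl | rfl <;>
        rcases zmod_two_cases r with rfl | rfl <;>
        simp only [superSign_zero_right, superSign_zero_left, superSign_one_one] at key ⊢ <;>
        first
        | linear_combination (norm := module) key
        | linear_combination (norm := module) -key

end IsHurwitzSuperalgebra
end OffDiagonalBrackets

/-! ### Derivations that kill the idempotents, and the bracket relations. -/

section DiagonalDerivations

variable {k C : Type*} [Field k] [NonAssocRing C] [Module k C]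
  [IsScalarTower k C C] [SMulCommClass k C C]
  {𝒞 : ZMod 2 → Submodule k C} [DirectSum.Decomposition 𝒞] {N : QuadraticSuperform 𝒞}

open HermitianSpace

namespace IsHurwitzSuperalgebra

variable (h : IsHurwitzSuperalgebra 𝒞 N)

/-- The derivations of parity `p` of `J` that vanish on the diagonal idempotents. -/
def diagDer (p : ZMod 2) : Submodule k (Module.End k (HermitianSpace N)) where
  carrier := {d | d ∈ homogeneousDerivations (hermitianGrading N) (jordanProduct h) p
    ∧ ∀ i, d (h.diag i) = 0}
  add_mem' hd he := ⟨add_mem hd.1 he.1, fun i => by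
    rw [LinearMap.add_apply, hd.2, he.2, add_zero]⟩
  zero_mem' := ⟨zero_mem _, fun _ => rfl⟩
  smul_mem' c _ hd := ⟨Submodule.smul_mem _ c hd.1, fun i => by
    rw [LinearMap.smul_apply, hd.2, smul_zero]⟩

/-- The action of an endomorphism of `J` on the `i`-th off-diagonal component. -/
def comp (i : Fin 3) : Module.End k (HermitianSpace N) →ₗ[k] Module.End k C where
  toFun d := offDiagCoord N i ∘ₗ d ∘ₗ h.offDiag i
  map_add' d e := by ext; simp
  map_smul' c d := by ext; simp

theorem comp_apply (i : Fin 3) (d : Module.End k (HermitianSpace N)) (x : C) :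
    h.comp i d x = offDiagCoord N i (d (h.offDiag i x)) := rfl

variable (hk : (2 : k) ≠ 0)
include h hk

/-- Part of the Peirce decomposition: `L_{e_i}` is diagonalizable, with eigenvalue `1` on `e_i`, `0`
on the other idempotents and on component `i`, and `1/2` on the other two components. -/
theorem offDiagCoord_jordanProduct_diag {i j : Fin 3} (hij : i ≠ j) (X : HermitianSpace N) :
    offDiagCoord N j (jordanProduct h (h.diag i) X) = (2⁻¹ : k) • offDiagCoord N j X := by
  have : offDiagCoord N j ∘ₗ jordanProduct h (h.diag i) = (2⁻¹ : k) • offDiagCoord N j := by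
    refine h.hom_ext hk (fun l => ?_) fun l p a ha => ?_
    · by_cases hil : i = l
      · subst hil
        simp [h.jordanProduct_diag_diag_self hk, h.offDiagCoord_diag]
      · simp [h.jordanProduct_diag_diag hil, h.offDiagCoord_diag]
    · by_cases hil : i = l
      · subst hil
        simp [h.jordanProduct_diag_offDiag_self, h.offDiagCoord_offDiag hij.symm]
      · simp [h.jordanProduct_diag_offDiag hil]
  exact LinearMap.congr_fun this X

theorem diagCoord_jordanProduct_diag (i j : Fin 3) (X : HermitianSpace N) :
    diagCoord N j (jordanProduct h (h.diag i) X) = if i = j then diagCoord N j X else 0 := by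
  have : diagCoord N j ∘ₗ jordanProduct h (h.diag i)
      = if i = j then diagCoord N j else 0 := by
    refine h.hom_ext hk (fun l => ?_) fun l p a ha => ?_
    · by_cases hil : i = l
      · subst hil
        split_ifs with hij
        · simp [h.jordanProduct_diag_diag_self hk]
        · simp [h.jordanProduct_diag_diag_self hk, h.diagCoord_diag (Ne.symm hij)]
      · split_ifs with hij
        · subst hij
          simp [h.jordanProduct_diag_diag hil, h.diagCoord_diag hil]
        · simp [h.jordanProduct_diag_diag hil]
    · by_cases hil : i = l
      · subst hil
        split_ifs with hij <;> simp [h.jordanProduct_diag_offDiag_self, h.diagCoord_offDiag]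
      · split_ifs with hij <;> simp [h.jordanProduct_diag_offDiag hil, h.diagCoord_offDiag]
  rw [← LinearMap.comp_apply, this]
  split_ifs <;> rfl

theorem eq_of_coord {X Y : HermitianSpace N} (hd : ∀ i, diagCoord N i X = diagCoord N i Y)
    (ho : ∀ i, offDiagCoord N i X = offDiagCoord N i Y) : X = Y := by
  rw [← h.sum_coord hk X, ← h.sum_coord hk Y]
  simp only [hd, ho]

section
variable {p : ZMod 2} {d : Module.End k (HermitianSpace N)} (hd : d ∈ h.diagDer p)
include hd

/-- Since `d` kills the idempotents, it commutes with every `L_{e_j}` and so preserves their joint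
eigenspaces. -/
theorem diagDer_offDiag (i : Fin 3) (x : C) : d (h.offDiag i x) = h.offDiag i (h.comp i d x) := by
  have hm : ∀ j, d (jordanProduct h (h.diag j) (h.offDiag i x))
      = jordanProduct h (h.diag j) (d (h.offDiag i x)) := fun j => by
    rw [hd.1.2 0 _ (h.diag_mem j), hd.2, map_zero, LinearMap.zero_apply, superSign_zero_right,
      one_smul, zero_add]
  refine h.eq_of_coord hk (fun j => ?_) fun j => ?_
  · rw [h.diagCoord_offDiag]
    by_cases hij : j = i
    · subst hij
      have := congrArg (diagCoord N j) (hm j)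
      rw [h.jordanProduct_diag_offDiag_self, map_zero, map_zero,
        h.diagCoord_jordanProduct_diag hk, if_pos rfl] at this
      exact this.symm
    · have := congrArg (diagCoord N j) (hm j)
      rw [h.jordanProduct_diag_offDiag hij, map_smul, map_smul,
        h.diagCoord_jordanProduct_diag hk, if_pos rfl, smul_eq_mul] at this
      have e : (2⁻¹ : k) * diagCoord N j (d (h.offDiag i x)) = 0 := by
        linear_combination diagCoord N j (d (h.offDiag i x)) * inv_mul_cancel₀ hk - this
      exact (mul_eq_zero.1 e).resolve_left (inv_ne_zero hk)
  · by_cases hij : j = i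
    · subst hij
      rw [h.offDiagCoord_offDiag_self hk, comp_apply]
    · rw [h.offDiagCoord_offDiag hij]
      have := congrArg (offDiagCoord N j) (hm i)
      rw [h.jordanProduct_diag_offDiag_self, map_zero, map_zero,
        h.offDiagCoord_jordanProduct_diag hk (Ne.symm hij)] at this
      exact (smul_eq_zero.1 this.symm).resolve_left (inv_ne_zero hk)

omit hk in
theorem comp_mem (i : Fin 3) {q : ZMod 2} {x : C} (hx : x ∈ 𝒞 q) : h.comp i d x ∈ 𝒞 (p + q) :=
  offDiagCoord_mem i (hd.1.1 _ _ (h.offDiag_mem i hx))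

/-- Skewness of the components: `x_i(x) ∘ x_i(y)` is a combination of idempotents, hence killed by
`d`. -/
theorem form_comp (i : Fin 3) {q : ZMod 2} {x : C} (hx : x ∈ 𝒞 q) (y : C) :
    N.b (h.comp i d x) y + superSign k p q * N.b x (h.comp i d y) = 0 := by
  have := hd.1.2 q _ (h.offDiag_mem i hx) (h.offDiag i y)
  rw [h.diagDer_offDiag hk hd, h.diagDer_offDiag hk hd, h.jordanProduct_offDiag_self hk,
    h.jordanProduct_offDiag_self hk, h.jordanProduct_offDiag_self hk, map_smul, map_add, hd.2, hd.2,
    add_zero, smul_zero, smul_smul, ← add_smul] at this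
  have h1 := congrArg (diagCoord N (i + 1)) this
  rw [map_zero, map_smul, map_add, h.diagCoord_diag_self hk,
    h.diagCoord_diag (Fin.three_add_one_ne_add_two i), add_zero, smul_eq_mul, mul_one] at h1
  refine mul_left_cancel₀ hk ?_
  linear_combination -h1

/-- The local triality relation between the three components. Like skewness, it is the Leibniz rule
read in coordinates. -/
theorem comp_paraProduct (i : Fin 3) {q : ZMod 2} {x : C} (hx : x ∈ 𝒞 q) (y : C) :
    h.comp (i + 2) d (paraProduct N x y) = paraProduct N (h.comp i d x) y
      + superSign k p q • paraProduct N x (h.comp (i + 1) d y) := by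
  have := hd.1.2 q _ (h.offDiag_mem i hx) (h.offDiag (i + 1) y)
  rw [h.diagDer_offDiag hk hd, h.diagDer_offDiag hk hd, h.jordanProduct_offDiag_succ hk,
    h.jordanProduct_offDiag_succ hk, h.jordanProduct_offDiag_succ hk, h.diagDer_offDiag hk hd,
    ← map_smul, ← map_add] at this
  simpa only [h.offDiagCoord_offDiag_self hk] using congrArg (offDiagCoord N (i + 2)) this

theorem eq_of_comp {d' : Module.End k (HermitianSpace N)} {p' : ZMod 2} (hd' : d' ∈ h.diagDer p')
    (H : ∀ i q, ∀ x ∈ 𝒞 q, h.comp i d x = h.comp i d' x) : d = d' :=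
  h.hom_ext hk (fun i => by rw [hd.2, hd'.2]) fun i q x hx => by
    rw [h.diagDer_offDiag hk hd, h.diagDer_offDiag hk hd', H i q x hx]

/-- By the Jacobi identity `d` acts on each factor of `[L_{x_i(a)}, L_{e_{i+1}}]`, and it kills the
second idempotent. -/
theorem superBracket_diagDer_offDiagDer (i : Fin 3) {q : ZMod 2} {a : C} (ha : a ∈ 𝒞 q) :
    superBracket p q d (h.offDiagDer i a) = h.offDiagDer i (h.comp i d a) := by
  have e : ∀ X, superBracket 0 0 X (jordanProduct h (h.diag (i + 1)))
      = superBracket q 0 X (jordanProduct h (h.diag (i + 1))) := fun X => by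
    simp only [superBracket, superSign_zero_right]
  have e' : ∀ X, superBracket 0 0 X (jordanProduct h (h.diag (i + 1)))
      = superBracket (p + q) 0 X (jordanProduct h (h.diag (i + 1))) := fun X => by
    simp only [superBracket, superSign_zero_right]
  rw [offDiagDer_eq, offDiagDer_eq, superBracket_smul_right, e, e', ← h.diagDer_offDiag hk hd]
  have := superBracket_superBracket p q 0 d (jordanProduct h (h.offDiag i a))
    (jordanProduct h (h.diag (i + 1)))
  rw [add_zero, superBracket_derivation_mul hd.1 (h.offDiag_mem i ha),
    superBracket_derivation_mul hd.1 (h.diag_mem _), hd.2, map_zero] at this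
  rw [this]
  simp [superBracket]

end

section
variable {p q : ZMod 2} {a b : C} (ha : a ∈ 𝒞 p) (hb : b ∈ 𝒞 q)
include ha hb

theorem superBracket_offDiagDer_self_mem (i : Fin 3) :
    superBracket p q (h.offDiagDer i a) (h.offDiagDer i b) ∈ h.diagDer (p + q) := by
  refine ⟨superBracket_mem_homogeneousDerivations (h.offDiagDer_mem hk i ha)
    (h.offDiagDer_mem hk i hb), fun j => ?_⟩
  have e := N.supersymmetric _ _ _ ha _ hb
  rw [superBracket_apply]
  rcases Fin.three_cases i j with rfl | rfl | rfl
  · simp only [h.offDiagDer_diag_self hk, map_zero, smul_zero, sub_zero]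
  · simp only [h.offDiagDer_diag_one hk, map_smul, h.offDiagDer_offDiag_self hk, e]
    module
  · simp only [h.offDiagDer_diag_two hk, map_smul, h.offDiagDer_offDiag_self hk, e]
    module

omit ha hb in
-- On its own component the bracket is an elementary skew map, of rank at most two. Sums of such
-- maps will exhaust the skew maps.
theorem comp_superBracket_offDiagDer_zero (i : Fin 3) (x : C) :
    h.comp i (superBracket p q (h.offDiagDer i a) (h.offDiagDer i b)) x
      = (2 * superSign k p q * N.b a x) • b - (2 * N.b b x) • a := by
  rw [comp_apply, superBracket_apply]
  simp only [h.offDiagDer_offDiag_self hk, map_smul, map_sub, h.offDiagDer_diag_one hk,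
    h.offDiagDer_diag_two hk, h.offDiagCoord_offDiag_self hk]
  match_scalars <;> field_simp <;> ring

theorem comp_superBracket_offDiagDer_one (i : Fin 3) {r : ZMod 2} {x : C} (hx : x ∈ 𝒞 r) :
    h.comp (i + 1) (superBracket p q (h.offDiagDer i a) (h.offDiagDer i b)) x
      = superSign k q r • paraProduct N (paraProduct N a x) b
        - (superSign k p q * superSign k p r) • paraProduct N (paraProduct N b x) a := by
  rw [comp_apply, superBracket_apply]
  simp only [h.offDiagDer_offDiag_one hk, map_neg, h.offDiagDer_offDiag_two hk i ha
    (h.paraProduct_mem hb hx), h.offDiagDer_offDiag_two hk i hb (h.paraProduct_mem ha hx),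
    map_smul, h.offDiagCoord_offDiag_self hk, map_sub, superSign_add_right, superSign_comm k q p]
  rw [smul_neg, smul_smul, ← mul_assoc, superSign_mul_self, one_mul]
  abel

theorem comp_superBracket_offDiagDer_two (i : Fin 3) {r : ZMod 2} {x : C} (hx : x ∈ 𝒞 r) :
    h.comp (i + 2) (superBracket p q (h.offDiagDer i a) (h.offDiagDer i b)) x
      = (superSign k p q * superSign k p r) • paraProduct N b (paraProduct N x a)
        - superSign k q r • paraProduct N a (paraProduct N x b) := by
  rw [comp_apply, superBracket_apply]
  simp only [h.offDiagDer_offDiag_one hk, map_neg, h.offDiagDer_offDiag_two hk i ha hx,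
    h.offDiagDer_offDiag_two hk i hb hx,
    map_smul, h.offDiagCoord_offDiag_self hk, map_sub]
  module

/-- The relation that leads from one component to another. On off-diagonal elements it comes down to
the left composition identity, the right one, and associativity of the form, one for each component.
-/
theorem superBracket_offDiagDer_succ (i : Fin 3) :
    superBracket p q (h.offDiagDer i a) (h.offDiagDer (i + 1) b)
      = h.offDiagDer (i + 2) (paraProduct N a b) := by
  have hab := h.paraProduct_mem ha hb
  have d11 := h.offDiagDer_diag_self hk (i + 1)
  have d12 := h.offDiagDer_diag_one hk (i + 1)
  have d10 := h.offDiagDer_diag_two hk (i + 1)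
  have d22 := h.offDiagDer_diag_self hk (i + 2)
  have d20 := h.offDiagDer_diag_one hk (i + 2)
  have d21 := h.offDiagDer_diag_two hk (i + 2)
  have o11 := h.offDiagDer_offDiag_self hk (i + 1)
  have o12 := h.offDiagDer_offDiag_one hk (i + 1)
  have o10 : ∀ {r} {x : C}, x ∈ 𝒞 r → _ := fun {r x} hx =>
    h.offDiagDer_offDiag_two hk (i + 1) hb (q := r) (b := x) hx
  have o22 := h.offDiagDer_offDiag_self hk (i + 2)
  have o20 := h.offDiagDer_offDiag_one hk (i + 2)
  have o21 : ∀ {r} {x : C}, x ∈ 𝒞 r → _ := fun {r x} hx =>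
    h.offDiagDer_offDiag_two hk (i + 2) hab (q := r) (b := x) hx
  have d00 := h.offDiagDer_diag_self hk i
  have d01 := h.offDiagDer_diag_one hk i
  have d02 := h.offDiagDer_diag_two hk i
  have o00 := h.offDiagDer_offDiag_self hk i
  have o01 := h.offDiagDer_offDiag_one hk i
  have o02 : ∀ {r} {x : C}, x ∈ 𝒞 r → _ := fun {r x} hx =>
    h.offDiagDer_offDiag_two hk i ha (q := r) (b := x) hx
  simp only [Fin.three_add_one_add_one, Fin.three_add_one_add_two, Fin.three_add_two_add_one,
    Fin.three_add_two_add_two] at d12 d10 d20 d21 o11 o12 o10 o22 o20 o21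
  refine h.hom_ext hk (fun j => ?_) fun j r x hx => ?_
  · rw [superBracket_apply]
    have s1 := superSign_mul_self k p q
    rcases Fin.three_cases i j with rfl | rfl | rfl
    · simp only [d10, d00, d20, map_smul, map_zero, o01]
      module
    · simp only [d11, d01, d21, map_smul, map_zero, o10 ha]
      rw [superSign_comm k q p, smul_comm _ (2⁻¹ : k), smul_smul (superSign k p q), s1]
      module
    · simp only [d12, d02, d22, map_smul, o01, o10 ha]
      rw [superSign_comm k q p, smul_comm _ (-2⁻¹ : k), smul_smul (superSign k p q), s1]
      module
  · rw [superBracket_apply]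
    rcases Fin.three_cases i j with rfl | rfl | rfl
    · have key := congrArg (h.offDiag (i + 1)) (h.paraProduct_paraProduct_left ha hb hx)
      have hs : superSign k p q * N.b a x = superSign k q r * N.b a x := by
        by_cases hpr : p = r
        · rw [hpr, superSign_comm]
        · rw [QuadraticSuperform.form_eq_zero hpr ha hx, mul_zero, mul_zero]
      simp only [o00, o10 hx, map_smul, map_sub, map_add, d12, d11, o02 (h.paraProduct_mem hx hb),
        o20, superSign_add_right] at key ⊢
      have e2 : 2 * N.b a x * 2⁻¹ = N.b a x := by
        linear_combination N.b a x * mul_inv_cancel₀ hk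
      rw [sub_zero, smul_smul (2 * _), e2, smul_smul, smul_smul]
      linear_combination (norm := module) key
    · simp only [o11, o01, map_neg, o12, map_smul, map_sub, d02, o21 hx,
        superSign_add_left]
      have key := congrArg (h.offDiag i) (h.paraProduct_paraProduct_right hb ha hx)
      have hs : superSign k p r * N.b b x = superSign k p q * N.b b x := by
        by_cases hpr : q = r
        · rw [hpr]
        · rw [QuadraticSuperform.form_eq_zero hpr hb hx, mul_zero, mul_zero]
      rw [hs] at key
      simp only [map_add, map_smul, superSign_comm k q p] at key
      have e4 : 2 * N.b b x * -2⁻¹ = -N.b b x := by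
        linear_combination -N.b b x * mul_inv_cancel₀ hk
      rw [d00, zero_sub, smul_neg (2 * _), smul_smul (2 * _), e4]
      rcases zmod_two_cases p with rfl | rfl <;> rcases zmod_two_cases q with rfl | rfl <;>
        rcases zmod_two_cases r with rfl | rfl <;>
        simp only [superSign_zero_right, superSign_zero_left, superSign_one_one] at key ⊢ <;>
        first
        | linear_combination (norm := module) key
        | linear_combination (norm := module) -key
    · have e := N.supersymmetric _ _ _ hb _ (h.paraProduct_mem hx ha)
      have e1 := h.form_paraProduct hx ha hb
      have e2 := N.supersymmetric _ _ _ hx _ hab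
      have e3 := h.form_paraProduct ha hb hx
      rw [e1, e2] at e
      simp only [o12, o02 hx, o00, o11, map_neg, map_smul, o22, e, ← e3,
        superSign_add_right, superSign_comm k q p, superSign_comm k r p, superSign_comm k r q]
      rcases zmod_two_cases p with rfl | rfl <;> rcases zmod_two_cases q with rfl | rfl <;>
        rcases zmod_two_cases r with rfl | rfl <;>
        simp only [superSign_zero_right, superSign_zero_left, superSign_one_one] <;>
        module

end

end IsHurwitzSuperalgebra
end DiagonalDerivations

/-! ### Generators of `inder J` and the decomposition of a derivation. -/

section InnerDerivations

variable {k C : Type*} [Field k] [NonAssocRing C] [Module k C]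
  [IsScalarTower k C C] [SMulCommClass k C C]
  {𝒞 : ZMod 2 → Submodule k C} [DirectSum.Decomposition 𝒞] {N : QuadraticSuperform 𝒞}

open HermitianSpace

namespace IsHurwitzSuperalgebra

variable (h : IsHurwitzSuperalgebra 𝒞 N) (hk : (2 : k) ≠ 0)
include h hk

theorem offDiagCoord_jordanProduct_diag_self (i : Fin 3) (X : HermitianSpace N) :
    offDiagCoord N i (jordanProduct h (h.diag i) X) = 0 := by
  have : offDiagCoord N i ∘ₗ jordanProduct h (h.diag i) = 0 := by
    refine h.hom_ext hk (fun l => ?_) fun l p a ha => ?_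
    · by_cases hil : i = l
      · subst hil
        simp [h.jordanProduct_diag_diag_self hk, h.offDiagCoord_diag]
      · simp [h.jordanProduct_diag_diag hil]
    · by_cases hil : i = l
      · subst hil
        simp [h.jordanProduct_diag_offDiag_self]
      · simp [h.jordanProduct_diag_offDiag hil, h.offDiagCoord_offDiag hil]
  exact LinearMap.congr_fun this X

theorem jordanProduct_sum_diag (X : HermitianSpace N) :
    jordanProduct h X (∑ i, h.diag i) = X := by
  have : ∑ i, jordanProduct h (h.diag i) = LinearMap.id := by
    refine h.hom_ext hk (fun l => ?_) fun l p a ha => ?_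
    · rw [LinearMap.sum_apply, Finset.sum_eq_single l]
      · rw [h.jordanProduct_diag_diag_self hk, LinearMap.id_apply]
      · exact fun j _ hj => h.jordanProduct_diag_diag hj
      · simp
    · have e : (Finset.univ : Finset (Fin 3)) = {l, l + 1, l + 2} := by
        ext j
        simpa [eq_comm] using Fin.three_cases l j
      have h1 := Fin.three_ne_add_one l
      have h2 := Fin.three_ne_add_two l
      have h3 := Fin.three_add_one_ne_add_two l
      rw [LinearMap.sum_apply, e, Finset.sum_insert (by simp [h1, h2]),
        Finset.sum_insert (by simp [h3]), Finset.sum_singleton, h.jordanProduct_diag_offDiag_self,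
        h.jordanProduct_diag_offDiag h1.symm, h.jordanProduct_diag_offDiag h2.symm, zero_add,
        ← smul_add, ← two_smul k, inv_smul_smul₀ hk, LinearMap.id_apply]
  rw [map_sum]
  simp only [h.jordanProduct_diag_comm hk]
  rw [← LinearMap.sum_apply, this, LinearMap.id_apply]

theorem superBracket_mul_diag_diag (i j : Fin 3) :
    superBracket 0 0 (jordanProduct h (h.diag i)) (jordanProduct h (h.diag j)) = 0 := by
  ext X
  rw [superBracket_apply, superSign_zero_left, one_smul, LinearMap.zero_apply, sub_eq_zero]
  refine h.eq_of_coord hk (fun l => ?_) fun l => ?_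
  · simp only [h.diagCoord_jordanProduct_diag hk]
    split_ifs <;> rfl
  · by_cases hi : i = l <;> by_cases hj : j = l
    · rw [hi, hj]
    · rw [hi, h.offDiagCoord_jordanProduct_diag_self hk, h.offDiagCoord_jordanProduct_diag hk hj,
        h.offDiagCoord_jordanProduct_diag_self hk, smul_zero]
    · rw [hj, h.offDiagCoord_jordanProduct_diag_self hk, h.offDiagCoord_jordanProduct_diag hk hi,
        h.offDiagCoord_jordanProduct_diag_self hk, smul_zero]
    · simp only [h.offDiagCoord_jordanProduct_diag hk hi, h.offDiagCoord_jordanProduct_diag hk hj]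

theorem superBracket_mul_offDiag_diag_self (i : Fin 3) {p : ZMod 2} {a : C} (ha : a ∈ 𝒞 p) :
    superBracket p 0 (jordanProduct h (h.offDiag i a)) (jordanProduct h (h.diag i)) = 0 := by
  have h1 := Fin.three_ne_add_one i
  have h2 := Fin.three_ne_add_two i
  refine h.hom_ext hk (fun l => ?_) fun l q b hb => ?_
  · rw [superBracket_apply, superSign_zero_right, one_smul, LinearMap.zero_apply, sub_eq_zero]
    rcases Fin.three_cases i l with rfl | rfl | rfl
    · rw [h.jordanProduct_diag_diag_self hk, h.jordanProduct_offDiag_diag_self hk, map_zero]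
    · rw [h.jordanProduct_diag_diag h1, h.jordanProduct_offDiag_diag hk h1, map_smul, map_zero,
        h.jordanProduct_diag_offDiag_self, smul_zero]
    · rw [h.jordanProduct_diag_diag h2, h.jordanProduct_offDiag_diag hk h2, map_smul, map_zero,
        h.jordanProduct_diag_offDiag_self, smul_zero]
  · rw [superBracket_apply, superSign_zero_right, one_smul, LinearMap.zero_apply, sub_eq_zero]
    rcases Fin.three_cases i l with rfl | rfl | rfl
    · rw [h.jordanProduct_diag_offDiag_self, map_zero, h.jordanProduct_offDiag_self hk, map_smul,
        map_add, h.jordanProduct_diag_diag h1, h.jordanProduct_diag_diag h2, add_zero, smul_zero]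
    · rw [h.jordanProduct_diag_offDiag h1, map_smul, h.jordanProduct_offDiag_succ hk,
        h.jordanProduct_diag_offDiag h2]
    · rw [h.jordanProduct_diag_offDiag h2, map_smul, h.jordanProduct_offDiag_zero_two hk i hb ha,
        map_smul, h.jordanProduct_diag_offDiag h1, smul_comm]

theorem superBracket_mul_offDiag_diag_one (i : Fin 3) (p : ZMod 2) (a : C) :
    superBracket p 0 (jordanProduct h (h.offDiag i a)) (jordanProduct h (h.diag (i + 1)))
      = (2⁻¹ : k) • h.offDiagDer i a := by
  rw [offDiagDer_eq, inv_smul_smul₀ hk, superBracket, superBracket, superSign_zero_left,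
    superSign_zero_right]

/-- The idempotents add up to the unit, so the brackets with the three `L_{e_j}` add up to zero; the
one with `L_{e_i}` vanishes. -/
theorem superBracket_mul_offDiag_diag_two (i : Fin 3) {p : ZMod 2} {a : C} (ha : a ∈ 𝒞 p) :
    superBracket p 0 (jordanProduct h (h.offDiag i a)) (jordanProduct h (h.diag (i + 2)))
      = -(2⁻¹ : k) • h.offDiagDer i a := by
  have h0 := h.superBracket_mul_offDiag_diag_self hk i ha
  have h1 := h.superBracket_mul_offDiag_diag_one hk i p a
  have e : jordanProduct h (h.diag (i + 2))
      = 1 - jordanProduct h (h.diag i) - jordanProduct h (h.diag (i + 1)) := by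
    ext X
    have e : (Finset.univ : Finset (Fin 3)) = {i, i + 1, i + 2} := by
      ext j
      simpa [eq_comm] using Fin.three_cases i j
    have := h.jordanProduct_sum_diag hk X
    rw [e, Finset.sum_insert (by simp [Fin.three_ne_add_one i, Fin.three_ne_add_two i]),
      Finset.sum_insert (by simp [Fin.three_add_one_ne_add_two i]), Finset.sum_singleton, map_add,
      map_add] at this
    simp only [h.jordanProduct_diag_comm hk] at this
    rw [LinearMap.sub_apply, LinearMap.sub_apply, Module.End.one_apply]
    linear_combination (norm := module) this
  rw [neg_smul, ← h1, e]
  rw [superBracket, superSign_zero_right, one_smul, sub_eq_zero] at h0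
  simp only [superBracket, superSign_zero_right, one_smul, mul_sub, sub_mul, h0, mul_one, one_mul]
  abel

/-- Apply the derivation `D_i(a)` to `[L_{x_i(b)}, L_{e_{i+1}}] = D_i(b) / 2`. It sends `x_i(b)`
into the diagonal, where multiplications commute, and `e_{i+1}` to `x_i(a) / 2`. -/
theorem superBracket_mul_offDiag_offDiag_self (i : Fin 3) {p q : ZMod 2} {a b : C} (ha : a ∈ 𝒞 p)
    (hb : b ∈ 𝒞 q) :
    superBracket p q (jordanProduct h (h.offDiag i a)) (jordanProduct h (h.offDiag i b))
      = -superBracket p q (h.offDiagDer i a) (h.offDiagDer i b) := by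
  have hD := h.offDiagDer_mem hk i ha
  have h1 := superBracket_superBracket p q 0 (h.offDiagDer i a) (jordanProduct h (h.offDiag i b))
    (jordanProduct h (h.diag (i + 1)))
  have hs : superSign k q p * superSign k p q = 1 := by
    rw [superSign_comm, superSign_mul_self]
  rw [h.superBracket_mul_offDiag_diag_one hk, superBracket_smul_right,
    superBracket_derivation_mul hD (h.offDiag_mem i hb),
    superBracket_derivation_mul hD (h.diag_mem _), h.offDiagDer_offDiag_self hk, map_smul, map_sub,
    superBracket_smul_left, h.offDiagDer_diag_one hk, map_smul, superBracket_smul_right,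
    add_zero, add_zero, smul_comm _ (2⁻¹ : k)] at h1
  by_cases hpq : p = q
  · subst hpq
    have e : ∀ j, superBracket (p + p) 0 (jordanProduct h (h.diag j))
        (jordanProduct h (h.diag (i + 1))) = 0 := fun j => by
      rw [← h.superBracket_mul_diag_diag hk j (i + 1), CharTwo.add_self_eq_zero]
    have e' : superBracket (p + p) 0 (jordanProduct h (h.diag (i + 2)) - jordanProduct h (h.diag (i + 1)))
        (jordanProduct h (h.diag (i + 1))) = 0 := by
      rw [sub_eq_add_neg, ← neg_one_smul k, superBracket_add_left, superBracket_smul_left, e, e,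
        smul_zero, add_zero]
    rw [e', smul_zero, zero_add] at h1
    have h2 := smul_right_injective _ (inv_ne_zero hk) h1
    rw [h2, superBracket_swap p p (jordanProduct h _)]
    module
  · rw [QuadraticSuperform.form_eq_zero hpq ha hb, mul_zero, zero_smul, zero_add] at h1
    have h2 := smul_right_injective _ (inv_ne_zero hk) h1
    rw [h2, superBracket_swap q p, smul_smul, superSign_comm k q p, mul_neg, superSign_mul_self]
    module

/-- The same method, with `D_i(a)` applied to `[L_{x_{i+1}(b)}, L_{e_{i+2}}]`. The term with
`x_{i+2}(a • b)` vanishes because `L_{e_{i+2}}` commutes with multiplications by component `i + 2`.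
-/
theorem superBracket_mul_offDiag_offDiag_succ (i : Fin 3) {p q : ZMod 2} {a b : C} (ha : a ∈ 𝒞 p)
    (hb : b ∈ 𝒞 q) :
    superBracket p q (jordanProduct h (h.offDiag i a)) (jordanProduct h (h.offDiag (i + 1) b))
      = h.offDiagDer (i + 2) (paraProduct N a b) := by
  have hD := h.offDiagDer_mem hk i ha
  have h0 := h.superBracket_mul_offDiag_diag_one hk (i + 1) q b
  rw [Fin.three_add_one_add_one] at h0
  have h1 := superBracket_superBracket p q 0 (h.offDiagDer i a)
    (jordanProduct h (h.offDiag (i + 1) b)) (jordanProduct h (h.diag (i + 2)))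
  have h2 := h.superBracket_mul_offDiag_diag_self hk (i + 2) (h.paraProduct_mem ha hb)
  rw [h0, superBracket_smul_right,
    superBracket_derivation_mul hD (h.offDiag_mem _ hb),
    superBracket_derivation_mul hD (h.diag_mem _), h.offDiagDer_offDiag_one hk, map_neg,
    h.offDiagDer_diag_two hk, map_smul, superBracket_smul_right,
    add_zero, add_zero, ← neg_one_smul k, superBracket_smul_left, h2, smul_zero, zero_add,
    neg_smul, smul_neg, ← smul_neg, ← smul_neg, smul_comm _ (2⁻¹ : k),
    h.superBracket_offDiagDer_succ hk ha hb] at h1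
  have h3 := smul_right_injective _ (inv_ne_zero hk) h1
  rw [h3, superBracket_swap p q, superSign_comm]
  module

theorem offDiagDer_mem_inder (i : Fin 3) {p : ZMod 2} {a : C} (ha : a ∈ 𝒞 p) :
    h.offDiagDer i a ∈ inderHermitian h := by
  have := superBracket_mem_superCommutator (LinearMap.mem_range_self (jordanProduct h) _)
    (h.jordanProduct_mem_endGrading (h.offDiag_mem i ha))
    (LinearMap.mem_range_self (jordanProduct h) _)
    (h.jordanProduct_mem_endGrading (h.diag_mem (i + 1)))
  rw [h.superBracket_mul_offDiag_diag_one hk] at this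
  exact (Submodule.smul_mem_iff _ (inv_ne_zero hk)).1 this

theorem superBracket_offDiagDer_mem_inder (i : Fin 3) {p q : ZMod 2} {a b : C} (ha : a ∈ 𝒞 p)
    (hb : b ∈ 𝒞 q) :
    superBracket p q (h.offDiagDer i a) (h.offDiagDer i b) ∈ inderHermitian h := by
  have := superBracket_mem_superCommutator (LinearMap.mem_range_self (jordanProduct h) _)
    (h.jordanProduct_mem_endGrading (h.offDiag_mem i ha))
    (LinearMap.mem_range_self (jordanProduct h) _)
    (h.jordanProduct_mem_endGrading (h.offDiag_mem i hb))
  rw [h.superBracket_mul_offDiag_offDiag_self hk i ha hb] at this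
  exact neg_mem_iff.1 this

/-- `X` is recovered as `L_X` applied to the unit. The definition of `inder` requires parity of the
operator `L_X`, and this carries it back to `X`. -/
theorem mem_grading_of_mul_mem {i : ZMod 2} {X : HermitianSpace N}
    (hX : jordanProduct h X ∈ endGrading (hermitianGrading N) i) : X ∈ hermitianGrading N i := by
  rw [← h.jordanProduct_sum_diag hk X, ← add_zero i]
  exact hX _ _ (Submodule.sum_mem _ fun j _ => h.diag_mem j)

/-- The brackets of multiplications by spanning elements have all been expressed through the
`D_i(a)` and the `[D_i(a), D_i(b)]`, so these suffice to test any containment of `inder J`. -/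
theorem inderHermitian_le {K : Submodule k (Module.End k (HermitianSpace N))}
    (hD : ∀ i p, ∀ a ∈ 𝒞 p, h.offDiagDer i a ∈ K)
    (hT : ∀ i p, ∀ a ∈ 𝒞 p, ∀ q, ∀ b ∈ 𝒞 q,
      superBracket p q (h.offDiagDer i a) (h.offDiagDer i b) ∈ K) :
    inderHermitian h ≤ K := by
  have hdo : ∀ i j p, ∀ a ∈ 𝒞 p, superBracket p 0 (jordanProduct h (h.offDiag i a))
      (jordanProduct h (h.diag j)) ∈ K := fun i j p a ha => by
    rcases Fin.three_cases i j with rfl | rfl | rfl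
    · rw [h.superBracket_mul_offDiag_diag_self hk _ ha]
      exact zero_mem _
    · rw [h.superBracket_mul_offDiag_diag_one hk]
      exact K.smul_mem _ (hD _ _ _ ha)
    · rw [h.superBracket_mul_offDiag_diag_two hk _ ha]
      exact K.smul_mem _ (hD _ _ _ ha)
  have hos : ∀ i p, ∀ a ∈ 𝒞 p, ∀ q, ∀ b ∈ 𝒞 q, superBracket p q (jordanProduct h (h.offDiag i a))
      (jordanProduct h (h.offDiag (i + 1) b)) ∈ K := fun i p a ha q b hb => by
    rw [h.superBracket_mul_offDiag_offDiag_succ hk i ha hb]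
    exact hD _ _ _ (h.paraProduct_mem ha hb)
  refine superCommutator_le ?_
  rintro p q _ ⟨X, rfl⟩ hX _ ⟨Y, rfl⟩ hY
  refine h.grading_induction hk
    (P := fun X => superBracket p q (jordanProduct h X) (jordanProduct h Y) ∈ K) ?_ ?_ ?_ (h.mem_grading_of_mul_mem hk hX)
  · rintro rfl c i
    rw [map_smul, superBracket_smul_left]
    refine K.smul_mem c ?_
    refine h.grading_induction hk (P := fun Y => superBracket 0 q (jordanProduct h (h.diag i))
      (jordanProduct h Y) ∈ K) ?_ ?_ ?_ (h.mem_grading_of_mul_mem hk hY)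
    · rintro rfl c j
      rw [map_smul, superBracket_smul_right, h.superBracket_mul_diag_diag hk, smul_zero]
      exact zero_mem _
    · intro j b hb
      rw [superBracket_swap]
      exact K.smul_mem _ (hdo _ _ _ _ hb)
    · intro Y Z hY hZ
      rw [map_add, superBracket_add_right]
      exact add_mem hY hZ
  · intro i a ha
    refine h.grading_induction hk (P := fun Y => superBracket p q (jordanProduct h (h.offDiag i a))
      (jordanProduct h Y) ∈ K) ?_ ?_ ?_ (h.mem_grading_of_mul_mem hk hY)
    · rintro rfl c j
      rw [map_smul, superBracket_smul_right]
      exact K.smul_mem _ (hdo _ _ _ _ ha)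
    · intro j b hb
      rcases Fin.three_cases i j with rfl | rfl | rfl
      · rw [h.superBracket_mul_offDiag_offDiag_self hk _ ha hb]
        exact neg_mem (hT _ _ _ ha _ _ hb)
      · exact hos _ _ _ ha _ _ hb
      · have := hos (i + 2) _ _ hb _ _ ha
        rw [Fin.three_add_two_add_one] at this
        rw [superBracket_swap]
        exact K.smul_mem _ this
    · intro Y Z hY hZ
      rw [map_add, superBracket_add_right]
      exact add_mem hY hZ
  · intro X Z hX hZ
    rw [map_add, superBracket_add_left]
    exact add_mem hX hZ

omit hk in
theorem homogeneousDerivations_le_der (p : ZMod 2) :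
    homogeneousDerivations (hermitianGrading N) (jordanProduct h) p ≤ derHermitian h := by
  rcases zmod_two_cases p with rfl | rfl
  exacts [le_sup_left, le_sup_right]

theorem endGrading_disjoint {i j : ZMod 2} (hij : i ≠ j) {f : Module.End k (HermitianSpace N)}
    (hi : f ∈ endGrading (hermitianGrading N) i) (hj : f ∈ endGrading (hermitianGrading N) j) :
    f = 0 := by
  ext X
  obtain ⟨Y, hY, Z, hZ, rfl⟩ := h.exists_homogeneous hk X
  have e : ∀ s, i + s ≠ j + s := fun s => by simpa using hij
  rw [map_add, h.grading_disjoint (e _) (hi _ _ hY) (hj _ _ hY),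
    h.grading_disjoint (e _) (hi _ _ hZ) (hj _ _ hZ), add_zero]
  rfl

theorem mem_homogeneousDerivations_of_mem_der {p : ZMod 2}
    {d : Module.End k (HermitianSpace N)} (hd : d ∈ derHermitian h)
    (hp : d ∈ endGrading (hermitianGrading N) p) :
    d ∈ homogeneousDerivations (hermitianGrading N) (jordanProduct h) p := by
  obtain ⟨d0, h0, d1, h1, rfl⟩ := Submodule.mem_sup.1 hd
  rcases zmod_two_cases p with rfl | rfl
  · have : d1 = 0 := h.endGrading_disjoint hk (i := 1) (j := 0) (by decide) h1.1
      (by simpa using sub_mem hp h0.1)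
    rw [this, add_zero]
    exact h0
  · have : d0 = 0 := h.endGrading_disjoint hk (i := 0) (j := 1) (by decide) h0.1
      (by simpa using sub_mem hp h1.1)
    rw [this, zero_add]
    exact h1

theorem isLieSubsuperalgebra_der :
    IsLieSubsuperalgebra (hermitianGrading N) (derHermitian h) :=
  ⟨isGradedSubspace_superDerivations, superCommutator_le fun _ _ _ hf hfi _ hg hgj =>
    h.homogeneousDerivations_le_der _ (superBracket_mem_homogeneousDerivations
      (h.mem_homogeneousDerivations_of_mem_der hk hf hfi)
      (h.mem_homogeneousDerivations_of_mem_der hk hg hgj))⟩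

omit hk in
theorem diagDer_le_der (p : ZMod 2) : h.diagDer p ≤ derHermitian h :=
  fun _ hd => h.homogeneousDerivations_le_der p hd.1

theorem inderHermitian_le_der : inderHermitian h ≤ derHermitian h :=
  h.inderHermitian_le hk
    (fun i p _ ha => h.homogeneousDerivations_le_der p (h.offDiagDer_mem hk i ha))
    fun i _ _ ha _ _ hb => h.diagDer_le_der _ (h.superBracket_offDiagDer_self_mem hk ha hb i)

theorem offDiagCoord_offDiagDer_diag {i l : Fin 3} (hil : i ≠ l) (a : C) (j : Fin 3) :
    offDiagCoord N l (h.offDiagDer i a (h.diag j)) = 0 := by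
  rcases Fin.three_cases i j with rfl | rfl | rfl
  · rw [h.offDiagDer_diag_self hk, map_zero]
  · rw [h.offDiagDer_diag_one hk, map_smul, h.offDiagCoord_offDiag hil.symm, smul_zero]
  · rw [h.offDiagDer_diag_two hk, map_smul, h.offDiagCoord_offDiag hil.symm, smul_zero]

theorem diagCoord_offDiagDer_diag (i l : Fin 3) (a : C) (j : Fin 3) :
    diagCoord N l (h.offDiagDer i a (h.diag j)) = 0 := by
  rcases Fin.three_cases i j with rfl | rfl | rfl
  · rw [h.offDiagDer_diag_self hk, map_zero]
  · rw [h.offDiagDer_diag_one hk, map_smul, h.diagCoord_offDiag, smul_zero]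
  · rw [h.offDiagDer_diag_two hk, map_smul, h.diagCoord_offDiag, smul_zero]

/-- Applying `X` to `e_i ∘ e_i = e_i` leaves in `X(e_i)` only the components other than `i`.
Applying it to `e_{i+1} ∘ e_{i+2} = 0` shows that `X(e_{i+1})` and `X(e_{i+2})` have opposite
entries in component `i`. These are also the features of a sum of `D_i(a_i)`. -/
theorem exists_diagDer_add_sum {p : ZMod 2} {X : Module.End k (HermitianSpace N)}
    (hX : X ∈ homogeneousDerivations (hermitianGrading N) (jordanProduct h) p) :
    ∃ d ∈ h.diagDer p, ∃ a : Fin 3 → C, (∀ i, a i ∈ 𝒞 p) ∧ X = d + ∑ i, h.offDiagDer i (a i) := by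
  have leib : ∀ i j, X (jordanProduct h (h.diag i) (h.diag j))
      = jordanProduct h (h.diag j) (X (h.diag i)) + jordanProduct h (h.diag i) (X (h.diag j)) :=
    fun i j => by
      rw [hX.2 0 _ (h.diag_mem i), superSign_zero_right, one_smul, h.jordanProduct_diag_comm hk j]
  have hself : ∀ i, X (h.diag i)
      = jordanProduct h (h.diag i) (X (h.diag i)) + jordanProduct h (h.diag i) (X (h.diag i)) :=
    fun i => by
      rw [← leib, h.jordanProduct_diag_diag_self hk]
  have c1 : ∀ i l, diagCoord N l (X (h.diag i)) = 0 := fun i l => by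
    have := congrArg (diagCoord N l) (hself i)
    rw [map_add, h.diagCoord_jordanProduct_diag hk] at this
    split_ifs at this
    · simpa using this
    · simpa using this
  have c2 : ∀ i, offDiagCoord N i (X (h.diag i)) = 0 := fun i => by
    have := congrArg (offDiagCoord N i) (hself i)
    rwa [map_add, h.offDiagCoord_jordanProduct_diag_self hk, add_zero] at this
  have c3 : ∀ i, offDiagCoord N i (X (h.diag (i + 2))) = -offDiagCoord N i (X (h.diag (i + 1))) :=
    fun i => by
      have := congrArg (offDiagCoord N i) (leib (i + 1) (i + 2))
      rw [h.jordanProduct_diag_diag (Fin.three_add_one_ne_add_two i), map_zero, map_zero, map_add,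
        h.offDiagCoord_jordanProduct_diag hk (Fin.three_ne_add_one i).symm,
        h.offDiagCoord_jordanProduct_diag hk (Fin.three_ne_add_two i).symm, ← smul_add] at this
      have := (smul_eq_zero.1 this.symm).resolve_left (inv_ne_zero hk)
      linear_combination (norm := module) this
  -- The factor `2` compensates `D_i(a)(e_{i+1}) = x_i(a) / 2`.
  set a : Fin 3 → C := fun i => (2 : k) • offDiagCoord N i (X (h.diag (i + 1)))
  have ha : ∀ i, a i ∈ 𝒞 p := fun i => Submodule.smul_mem _ _ (offDiagCoord_mem i (by
    have := hX.1 0 _ (h.diag_mem (i + 1))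
    rwa [add_zero] at this))
  refine ⟨X - ∑ i, h.offDiagDer i (a i), ⟨sub_mem hX (Submodule.sum_mem _ fun i _ =>
    h.offDiagDer_mem hk i (ha i)), fun j => ?_⟩, a, ha, by abel⟩
  refine h.eq_of_coord hk (fun l => ?_) fun l => ?_
  · rw [LinearMap.sub_apply, LinearMap.sum_apply, map_sub, map_sum, c1, map_zero,
      Finset.sum_eq_zero fun i _ => h.diagCoord_offDiagDer_diag hk i l _ j, sub_zero]
  · rw [LinearMap.sub_apply, LinearMap.sum_apply, map_sub, map_sum, map_zero,
      Finset.sum_eq_single l (fun i _ hi => h.offDiagCoord_offDiagDer_diag hk hi _ j) (by simp),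
      sub_eq_zero]
    rcases Fin.three_cases l j with rfl | rfl | rfl
    · rw [c2, h.offDiagDer_diag_self hk, map_zero]
    · rw [h.offDiagDer_diag_one hk, map_smul, h.offDiagCoord_offDiag_self hk, inv_smul_smul₀ hk]
    · rw [h.offDiagDer_diag_two hk, map_smul, h.offDiagCoord_offDiag_self hk, c3, neg_smul,
        inv_smul_smul₀ hk]

end IsHurwitzSuperalgebra
end InnerDerivations

/-! ### Simplicity of `inder J`. -/

section Simplicity

variable {k C : Type*} [Field k] [NonAssocRing C] [Module k C]
  [IsScalarTower k C C] [SMulCommClass k C C]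
  {𝒞 : ZMod 2 → Submodule k C} [DirectSum.Decomposition 𝒞] {N : QuadraticSuperform 𝒞}

open HermitianSpace

namespace IsHurwitzSuperalgebra

variable (h : IsHurwitzSuperalgebra 𝒞 N)

/-- The subspaces of `Module.End k J` that are stable under bracketing with the elements
`h.offDiagDer i a`; for instance all ideals of `inder J`. -/
def IsOffDiagStable (I : Submodule k (Module.End k (HermitianSpace N))) : Prop :=
  ∀ i p, ∀ a ∈ 𝒞 p, ∀ q, ∀ X ∈ I, X ∈ endGrading (hermitianGrading N) q →
    superBracket p q (h.offDiagDer i a) X ∈ I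

variable (hk : (2 : k) ≠ 0)
include h hk

theorem superBracket_offDiagDer_pred (i : Fin 3) {p q : ZMod 2} {a b : C} (ha : a ∈ 𝒞 p)
    (hb : b ∈ 𝒞 q) : superBracket p q (h.offDiagDer i a) (h.offDiagDer (i + 2) b)
      = -superSign k p q • h.offDiagDer (i + 1) (paraProduct N b a) := by
  have := h.superBracket_offDiagDer_succ hk hb ha (i + 2)
  rw [Fin.three_add_two_add_one, Fin.three_add_two_add_two] at this
  rw [superBracket_swap, this]

theorem superBracket_offDiagDer_diagDer (i : Fin 3) {p q : ZMod 2} {a : C} (ha : a ∈ 𝒞 p)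
    {d : Module.End k (HermitianSpace N)} (hd : d ∈ h.diagDer q) :
    superBracket p q (h.offDiagDer i a) d
      = -superSign k p q • h.offDiagDer i (h.comp i d a) := by
  rw [superBracket_swap, h.superBracket_diagDer_offDiagDer hk hd i ha]

/-- The operator `ad x ad y + ad y ad x`, for `x = h.offDiagDer i 1` and `y = h.offDiagDer i v`
with `v` orthogonal to `1`, annihilates the two other off-diagonal components. -/
theorem adAdOne_offDiagDer_one (i : Fin 3) {p q : ZMod 2} {v b : C} (hv : v ∈ 𝒞 p)
    (hv1 : N.b v 1 = 0) (hb : b ∈ 𝒞 q) :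
    superBracket 0 (p + q) (h.offDiagDer i 1)
        (superBracket p q (h.offDiagDer i v) (h.offDiagDer (i + 1) b))
      + superBracket p (0 + q) (h.offDiagDer i v)
        (superBracket 0 q (h.offDiagDer i 1) (h.offDiagDer (i + 1) b)) = 0 := by
  have key := congrArg (h.offDiagDer (i + 1)) (h.paraProduct_paraProduct_left hv hb h.one_mem)
  rw [hv1, mul_zero, zero_smul, map_zero, map_add, map_smul, superSign_zero_right,
    superSign_zero_right, mul_one, mul_one] at key
  rw [h.superBracket_offDiagDer_succ hk hv hb, h.superBracket_offDiagDer_succ hk h.one_mem hb,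
    h.superBracket_offDiagDer_pred hk i h.one_mem (h.paraProduct_mem hv hb),
    h.superBracket_offDiagDer_pred hk i hv (h.paraProduct_mem h.one_mem hb), superSign_zero_left,
    zero_add]
  linear_combination (norm := module) -key

theorem adAdOne_offDiagDer_two (i : Fin 3) {p q : ZMod 2} {v b : C} (hv : v ∈ 𝒞 p)
    (hv1 : N.b v 1 = 0) (hb : b ∈ 𝒞 q) :
    superBracket 0 (p + q) (h.offDiagDer i 1)
        (superBracket p q (h.offDiagDer i v) (h.offDiagDer (i + 2) b))
      + superBracket p (0 + q) (h.offDiagDer i v)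
        (superBracket 0 q (h.offDiagDer i 1) (h.offDiagDer (i + 2) b)) = 0 := by
  have key := congrArg (h.offDiagDer (i + 2)) (h.paraProduct_paraProduct_right hv hb h.one_mem)
  rw [hv1, mul_zero, zero_smul, map_zero, map_add, map_smul, superSign_zero_right,
    superSign_zero_right, mul_one, mul_one] at key
  have e1 := h.superBracket_offDiagDer_succ hk h.one_mem (h.paraProduct_mem hb hv) i
  have e2 := h.superBracket_offDiagDer_succ hk hv (h.paraProduct_mem hb h.one_mem) i
  rw [add_comm q p] at e1
  rw [add_comm q 0] at e2
  rw [h.superBracket_offDiagDer_pred hk i hv hb, h.superBracket_offDiagDer_pred hk i h.one_mem hb,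
    superBracket_smul_right, superBracket_smul_right, e1, e2, superSign_zero_left]
  linear_combination (norm := module) -key

/-- On component `i` the operator does not vanish. This is what makes it a projection tool: it
erases components `i + 1` and `i + 2` and retains information about `a`. -/
theorem adAdOne_offDiagDer_zero (i : Fin 3) {p q : ZMod 2} {v a : C} (hv : v ∈ 𝒞 p)
    (hv1 : N.b v 1 = 0) (ha : a ∈ 𝒞 q) :
    superBracket 0 (p + q) (h.offDiagDer i 1)
        (superBracket p q (h.offDiagDer i v) (h.offDiagDer i a))
      + superBracket p (0 + q) (h.offDiagDer i v)
        (superBracket 0 q (h.offDiagDer i 1) (h.offDiagDer i a))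
      = h.offDiagDer i ((2 * N.b a 1) • v + (2 * superSign k p q * N.b a v) • (1 : C)) := by
  rw [h.superBracket_offDiagDer_diagDer hk i h.one_mem (h.superBracket_offDiagDer_self_mem hk hv ha i),
    h.superBracket_offDiagDer_diagDer hk i hv
      (h.superBracket_offDiagDer_self_mem hk h.one_mem ha i),
    h.comp_superBracket_offDiagDer_zero hk, h.comp_superBracket_offDiagDer_zero hk, hv1,
    h.form_one_left v, hv1, superSign_zero_left, zero_add]
  simp only [map_sub, map_smul, map_add]
  module

theorem adAdOne_diagDer (i : Fin 3) {p q : ZMod 2} {v : C} (hv : v ∈ 𝒞 p)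
    {d : Module.End k (HermitianSpace N)} (hd : d ∈ h.diagDer q) :
    superBracket 0 (p + q) (h.offDiagDer i 1) (superBracket p q (h.offDiagDer i v) d)
      + superBracket p (0 + q) (h.offDiagDer i v) (superBracket 0 q (h.offDiagDer i 1) d)
      ∈ h.diagDer (p + q) := by
  have m1 := h.comp_mem hd i hv
  have m2 := h.comp_mem hd i h.one_mem
  have t1 := h.superBracket_offDiagDer_self_mem hk h.one_mem m1 i
  have t2 := h.superBracket_offDiagDer_self_mem hk hv m2 i
  rw [zero_add, add_comm q p] at t1
  rw [add_zero] at t2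
  rw [h.superBracket_offDiagDer_diagDer hk i h.one_mem hd,
    h.superBracket_offDiagDer_diagDer hk i hv hd, superBracket_smul_right, superBracket_smul_right,
    zero_add]
  exact add_mem (Submodule.smul_mem _ _ t1) (Submodule.smul_mem _ _ t2)

section Stable

variable {I : Submodule k (Module.End k (HermitianSpace N))} (hI : h.IsOffDiagStable I)
include hI

/-- Apply the operator `ad D_i(1) ad D_i(v) + ad D_i(v) ad D_i(1)` with `v` orthogonal to `1`. The
clause `d = 0 → d' = 0` serves a second application that starts without diagonal part. -/
theorem IsOffDiagStable.exists_diagDer_add {i : Fin 3} {q : ZMod 2}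
    {d : Module.End k (HermitianSpace N)} {a b c : C} (hd : d ∈ h.diagDer q) (ha : a ∈ 𝒞 q)
    (hb : b ∈ 𝒞 q) (hc : c ∈ 𝒞 q) (hX : d + h.offDiagDer i a + h.offDiagDer (i + 1) b
      + h.offDiagDer (i + 2) c ∈ I) (ha0 : a ≠ 0)
    (hw : ∃ p, ∃ w ∈ 𝒞 p, w ≠ 0 ∧ N.b w 1 = 0) :
    ∃ r, ∃ d' ∈ h.diagDer r, ∃ a' ∈ 𝒞 r, (d = 0 → d' = 0) ∧ a' ≠ 0 ∧
      d' + h.offDiagDer i a' ∈ I := by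
  -- The new entry is `2 b(a,1) v ± 2 b(a,v) 1`. If `b(a,1) = 0`, a suitable `v` is the projection
  -- to the complement of `1` of some `y` with `b(a,y) ≠ 0`. Otherwise any nonzero `w` orthogonal to
  -- `1` works.
  obtain ⟨p, v, hv, hv1, hne⟩ : ∃ p, ∃ v ∈ 𝒞 p, N.b v 1 = 0 ∧
      (2 * N.b a 1) • v + (2 * superSign k p q * N.b a v) • (1 : C) ≠ 0 := by
    by_cases ha1 : N.b a 1 = 0
    · obtain ⟨y, hy, hay⟩ := h.exists_form_ne_zero ha ha0
      refine ⟨q, y - (2⁻¹ * N.b y 1) • (1 : C), ?_, ?_, ?_⟩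
      · refine sub_mem hy ?_
        rcases zmod_two_cases q with rfl | rfl
        · exact Submodule.smul_mem _ _ h.one_mem
        · rw [h.form_one_of_odd hy, mul_zero, zero_smul]
          exact zero_mem _
      · rw [map_sub, map_smul, LinearMap.sub_apply, LinearMap.smul_apply, h.form_one_one,
          smul_eq_mul]
        linear_combination -N.b y 1 * inv_mul_cancel₀ hk
      · rw [ha1, mul_zero, zero_smul, zero_add, map_sub, map_smul, ha1, smul_zero, sub_zero]
        refine smul_ne_zero (mul_ne_zero (mul_ne_zero hk ?_) hay) h.one_ne_zero
        exact left_ne_zero_of_mul_eq_one (superSign_mul_self k q q)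
    · obtain ⟨p, w, hw, hw0, hw1⟩ := hw
      refine ⟨p, w, hw, hw1, fun H => ?_⟩
      have e := congrArg (fun z => N.b z 1) H
      simp only [map_add, map_smul, LinearMap.add_apply, LinearMap.smul_apply, hw1, h.form_one_one,
        map_zero, LinearMap.zero_apply, zero_add, smul_eq_mul, mul_zero] at e
      rw [(mul_eq_zero.1 e).resolve_right hk, zero_smul, add_zero] at H
      exact smul_ne_zero (mul_ne_zero hk ha1) hw0 H
  have hXq : d + h.offDiagDer i a + h.offDiagDer (i + 1) b + h.offDiagDer (i + 2) c
      ∈ endGrading (hermitianGrading N) q :=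
    add_mem (add_mem (add_mem hd.1.1 (h.offDiagDer_mem_endGrading i ha))
      (h.offDiagDer_mem_endGrading _ hb)) (h.offDiagDer_mem_endGrading _ hc)
  have m1 := hI i 0 1 h.one_mem _ _ (hI i p v hv q _ hX hXq)
    (superBracket_mem_endGrading (h.offDiagDer_mem_endGrading i hv) hXq)
  have m2 := hI i p v hv _ _ (hI i 0 1 h.one_mem q _ hX hXq)
    (superBracket_mem_endGrading (h.offDiagDer_mem_endGrading i h.one_mem) hXq)
  have m := add_mem m1 m2
  simp only [superBracket_add_right] at m
  refine ⟨p + q, _, h.adAdOne_diagDer hk i hv hd, _, ?_, ?_, hne, ?_⟩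
  · refine add_mem ?_ ?_
    · rcases zmod_two_cases q with rfl | rfl
      · rw [add_zero]
        exact Submodule.smul_mem _ _ hv
      · rw [h.form_one_of_odd ha, mul_zero, zero_smul]
        exact zero_mem _
    · by_cases hpq : p = q
      · rw [hpq, CharTwo.add_self_eq_zero]
        exact Submodule.smul_mem _ _ h.one_mem
      · rw [QuadraticSuperform.form_eq_zero (Ne.symm hpq) ha hv, mul_zero, zero_smul]
        exact zero_mem _
  · rintro rfl
    simp [superBracket]
  · rw [← h.adAdOne_offDiagDer_zero hk i hv hv1 ha]
    have e1 := h.adAdOne_offDiagDer_one hk i hv hv1 hb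
    have e2 := h.adAdOne_offDiagDer_two hk i hv hv1 hc
    convert m using 1
    linear_combination (norm := module) -e1 - e2

/-- A purely diagonal `X` becomes some `D_i(d_i(x))` after one bracket. Otherwise the projection
tool reduces `X` to `d' + D_i(a')`; a bracket with `D_{i+1}(1)` removes the diagonal part, and the
tool applied again leaves a single component. -/
theorem IsOffDiagStable.exists_offDiagDer_mem {q : ZMod 2} {X : Module.End k (HermitianSpace N)}
    (hXI : X ∈ I) (hX : X ∈ homogeneousDerivations (hermitianGrading N) (jordanProduct h) q)
    (hX0 : X ≠ 0) : ∃ i r, ∃ c ∈ 𝒞 r, c ≠ 0 ∧ h.offDiagDer i c ∈ I := by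
  obtain ⟨d, hd, a, ha, rfl⟩ := h.exists_diagDer_add_sum hk hX
  by_cases ha0 : ∀ i, a i = 0
  · simp only [ha0, map_zero, Finset.sum_const_zero, add_zero] at hXI hX0
    obtain ⟨i, p, x, hx, hdx⟩ : ∃ i p, ∃ x ∈ 𝒞 p, h.comp i d x ≠ 0 := by
      by_contra! H
      exact hX0 (h.eq_of_comp hk hd (zero_mem (h.diagDer q)) fun i p x hx => by
        rw [H i p x hx, map_zero, LinearMap.zero_apply])
    refine ⟨i, q + p, h.comp i d x, h.comp_mem hd i hx, hdx, ?_⟩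
    have m := hI i p x hx q d hXI hd.1.1
    rw [h.superBracket_offDiagDer_diagDer hk i hx hd] at m
    exact (Submodule.smul_mem_iff _
      (neg_ne_zero.2 (left_ne_zero_of_mul_eq_one (superSign_mul_self k p q)))).1 m
  · push Not at ha0
    obtain ⟨i, hi⟩ := ha0
    have e : (Finset.univ : Finset (Fin 3)) = {i, i + 1, i + 2} := by
      ext j
      simpa [eq_comm] using Fin.three_cases i j
    rw [e, Finset.sum_insert (by simp [Fin.three_ne_add_one i, Fin.three_ne_add_two i]),
      Finset.sum_insert (by simp [Fin.three_add_one_ne_add_two i]), Finset.sum_singleton,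
      ← add_assoc, ← add_assoc] at hXI
    have hpara : ∀ x, x ≠ 0 → paraProduct N x 1 ≠ 0 := fun x hx => by
      rw [h.paraProduct_one]
      exact fun H => hx (h.conj_injective (by rw [H, map_zero]))
    by_cases hw : ∃ p, ∃ w ∈ 𝒞 p, w ≠ 0 ∧ N.b w 1 = 0
    · obtain ⟨r, d', hd', a', ha', -, ha0, hm⟩ := hI.exists_diagDer_add h hk hd (ha i) (ha _) (ha _)
        hXI hi hw
      have m := hI (i + 1) 0 1 h.one_mem r _ hm
        (add_mem hd'.1.1 (h.offDiagDer_mem_endGrading i ha'))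
      rw [superBracket_add_right, h.superBracket_offDiagDer_diagDer hk (i + 1) h.one_mem hd',
        superBracket_swap 0 r, h.superBracket_offDiagDer_succ hk ha' h.one_mem,
        ← map_smul (h.offDiagDer (i + 1)), ← map_smul (h.offDiagDer (i + 2))] at m
      have hb := h.comp_mem hd' (i + 1) h.one_mem
      have hc := h.paraProduct_mem ha' h.one_mem
      rw [add_zero] at hb hc
      have hb' := Submodule.smul_mem _ (-superSign k 0 r) hb
      have hc' := Submodule.smul_mem _ (-superSign k 0 r) hc
      -- The bracket is now a sum over components `i + 1` and `i + 2`, with nonzero entry in the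
      -- latter. Either the former is zero, or the projection to it is nonzero.
      by_cases hb0 : -superSign k 0 r • h.comp (i + 1) d' 1 = 0
      · rw [hb0, map_zero, zero_add] at m
        refine ⟨_, _, _, hc', smul_ne_zero ?_ (hpara _ ha0), m⟩
        rw [superSign_zero_left]
        exact neg_ne_zero.2 _root_.one_ne_zero
      · have m' : (0 : Module.End k (HermitianSpace N))
            + h.offDiagDer (i + 1) (-superSign k 0 r • h.comp (i + 1) d' 1)
            + h.offDiagDer (i + 1 + 1) (-superSign k 0 r • paraProduct N a' 1)
            + h.offDiagDer (i + 1 + 2) 0 ∈ I := by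
          rw [map_zero, add_zero, zero_add, Fin.three_add_one_add_one]
          exact m
        obtain ⟨r', d'', hd'', a'', ha'', h0, ha0', hm'⟩ :=
          IsOffDiagStable.exists_diagDer_add h hk hI (i := i + 1) (q := r) (d := 0)
            (a := -superSign k 0 r • h.comp (i + 1) d' 1)
            (b := -superSign k 0 r • paraProduct N a' 1) (c := 0)
            (zero_mem _) hb' hc' (zero_mem _) m' hb0 hw
        rw [h0 rfl, zero_add] at hm'
        exact ⟨_, _, _, ha'', ha0', hm'⟩
    -- Here `C = k 1`, where no `v` is available. Skew scalars are zero, so `d = 0`, and `D_j(1)`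
    -- commutes with component `j`. Brackets with `D_{i+1}(1)` and then with `D_i(1)` therefore
    -- leave a single component.
    · push Not at hw
      have hone : ∀ p, ∀ x ∈ 𝒞 p, x = (2⁻¹ * N.b x 1) • (1 : C) := fun p x hx => by
        by_contra H
        refine hw p (x - (2⁻¹ * N.b x 1) • (1 : C)) ?_ (sub_ne_zero.2 H) ?_
        · refine sub_mem hx ?_
          rcases zmod_two_cases p with rfl | rfl
          · exact Submodule.smul_mem _ _ h.one_mem
          · rw [h.form_one_of_odd hx, mul_zero, zero_smul]
            exact zero_mem _
        · rw [map_sub, map_smul, LinearMap.sub_apply, LinearMap.smul_apply, h.form_one_one,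
            smul_eq_mul]
          linear_combination -N.b x 1 * inv_mul_cancel₀ hk
      have hd0 : d = 0 := by
        refine h.eq_of_comp hk hd (zero_mem (h.diagDer q)) fun j p x hx => ?_
        rw [map_zero, LinearMap.zero_apply, hone p x hx, map_smul]
        have e1 := h.form_comp hk hd j h.one_mem 1
        rw [superSign_zero_right, h.form_one_left, one_mul, ← two_mul] at e1
        have m1 := h.comp_mem hd j h.one_mem
        rw [hone _ _ m1, (mul_eq_zero.1 e1).resolve_left hk, mul_zero, zero_smul, smul_zero]
      have hcomm : ∀ j p, ∀ x ∈ 𝒞 p, superBracket 0 p (h.offDiagDer j 1) (h.offDiagDer j x) = 0 :=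
        fun j p x hx => by
          rw [hone p x hx, map_smul, superBracket_smul_right, superBracket, superSign_zero_left,
            one_smul, sub_self, smul_zero]
      have m1 := hI (i + 1) 0 1 h.one_mem q _ hXI (add_mem (add_mem (add_mem hd.1.1
        (h.offDiagDer_mem_endGrading i (ha _))) (h.offDiagDer_mem_endGrading _ (ha _)))
        (h.offDiagDer_mem_endGrading _ (ha _)))
      have e1 := h.superBracket_offDiagDer_succ hk h.one_mem (ha (i + 2)) (i + 1)
      have hc1 := h.paraProduct_mem (ha i) h.one_mem
      have hc2 := h.paraProduct_mem h.one_mem (ha (i + 2))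
      rw [add_zero] at hc1
      rw [zero_add] at hc2
      rw [Fin.three_add_one_add_one, Fin.three_add_one_add_two] at e1
      rw [hd0, zero_add, superBracket_add_right, superBracket_add_right, hcomm _ _ _ (ha _),
        superBracket_swap 0 q, h.superBracket_offDiagDer_succ hk (ha i) h.one_mem, e1,
        superSign_zero_left, add_zero] at m1
      have m2 := hI i 0 1 h.one_mem q _ m1 (add_mem
        (Submodule.smul_mem _ _ (h.offDiagDer_mem_endGrading _ hc1))
        (h.offDiagDer_mem_endGrading _ hc2))
      rw [superBracket_add_right, hcomm _ _ _ hc2, superBracket_smul_right,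
        h.superBracket_offDiagDer_pred hk i h.one_mem hc1, smul_smul, superSign_zero_left, add_zero,
        neg_one_mul, neg_neg, one_smul] at m2
      exact ⟨_, _, _, h.paraProduct_mem hc1 h.one_mem, hpara _ (hpara _ hi), m2⟩

/-- Choose `y` with `b(c,y) ≠ 0`. Both terms of `(c • x) • y ± (y • x) • c = ± b(c,y) x` come from
brackets that start at `D_i(c)`, which gives all of component `i + 1`. Products with `1` are
conjugations and reach the other components. -/
theorem IsOffDiagStable.offDiagDer_mem {i : Fin 3} {r : ZMod 2} {c : C} (hc : c ∈ 𝒞 r)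
    (hc0 : c ≠ 0) (hcI : h.offDiagDer i c ∈ I) {j : Fin 3} {p : ZMod 2} {x : C} (hx : x ∈ 𝒞 p) :
    h.offDiagDer j x ∈ I := by
  have right : ∀ j p q, ∀ a ∈ 𝒞 p, ∀ b ∈ 𝒞 q, h.offDiagDer (j + 1) b ∈ I →
      h.offDiagDer (j + 2) (paraProduct N a b) ∈ I := fun j p q a ha b hb hbI => by
    rw [← h.superBracket_offDiagDer_succ hk ha hb]
    exact hI _ _ _ ha _ _ hbI (h.offDiagDer_mem_endGrading _ hb)
  have left : ∀ j p q, ∀ a ∈ 𝒞 p, ∀ b ∈ 𝒞 q, h.offDiagDer j a ∈ I →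
      h.offDiagDer (j + 2) (paraProduct N a b) ∈ I := fun j p q a ha b hb haI => by
    rw [← h.superBracket_offDiagDer_succ hk ha hb, superBracket_swap]
    exact I.smul_mem _ (hI _ _ _ hb _ _ haI (h.offDiagDer_mem_endGrading _ ha))
  have h1 : ∀ p, ∀ x ∈ 𝒞 p, h.offDiagDer (i + 1) x ∈ I := fun p x hx => by
    obtain ⟨y, hy, hcy⟩ := h.exists_form_ne_zero hc hc0
    have key := congrArg (h.offDiagDer (i + 1)) (h.paraProduct_paraProduct_left hc hx hy)
    have t1 : h.offDiagDer (i + 2) (paraProduct N c x) ∈ I := left i r p c hc x hx hcI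
    have m1 := left (i + 2) _ _ _ (h.paraProduct_mem hc hx) _ hy t1
    have t2 : h.offDiagDer (i + 2 + 1) c ∈ I := by
      rw [Fin.three_add_two_add_one]
      exact hcI
    have m2 := right (i + 2) _ _ _ (h.paraProduct_mem hy hx) _ hc t2
    rw [Fin.three_add_two_add_two] at m1 m2
    rw [map_add, map_smul, map_smul] at key
    have m := add_mem m1 (I.smul_mem (superSign k r p * superSign k r r * superSign k p r) m2)
    rw [key] at m
    exact (Submodule.smul_mem_iff _ (mul_ne_zero
      (left_ne_zero_of_mul_eq_one (superSign_mul_self k r p)) hcy)).1 m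
  have h0 : ∀ p, ∀ x ∈ 𝒞 p, h.offDiagDer i x ∈ I := fun p x hx => by
    have := left (i + 1) _ _ _ (standardInvolution_mem h hx) _ h.one_mem
      (h1 _ _ (standardInvolution_mem h hx))
    rwa [Fin.three_add_one_add_two, h.paraProduct_one, h.conj_conj] at this
  rcases Fin.three_cases i j with rfl | rfl | rfl
  · exact h0 p x hx
  · exact h1 p x hx
  · have := left i _ _ _ (standardInvolution_mem h hx) _ h.one_mem
      (h0 _ _ (standardInvolution_mem h hx))
    rwa [h.paraProduct_one, h.conj_conj] at this

theorem IsOffDiagStable.inderHermitian_le {q : ZMod 2} {X : Module.End k (HermitianSpace N)}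
    (hXI : X ∈ I) (hX : X ∈ homogeneousDerivations (hermitianGrading N) (jordanProduct h) q)
    (hX0 : X ≠ 0) : inderHermitian h ≤ I := by
  obtain ⟨i, r, c, hc, hc0, hcI⟩ := hI.exists_offDiagDer_mem h hk hXI hX hX0
  have hD : ∀ i p, ∀ a ∈ 𝒞 p, h.offDiagDer i a ∈ I := fun j p a ha =>
    hI.offDiagDer_mem h hk hc hc0 hcI ha
  exact h.inderHermitian_le hk hD fun i p a ha q b hb =>
    hI i p a ha q _ (hD i q b hb) (h.offDiagDer_mem_endGrading i hb)

end Stable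

/-- By the Jacobi identity, `[d, [L_X, L_Y]] = [L_{dX}, L_Y] ± [L_X, L_{dY}]`. -/
theorem superBracket_mem_inder {p q : ZMod 2} {d g : Module.End k (HermitianSpace N)}
    (hd : d ∈ homogeneousDerivations (hermitianGrading N) (jordanProduct h) p)
    (hg : g ∈ inderHermitian h) (hgq : g ∈ endGrading (hermitianGrading N) q) :
    superBracket p q d g ∈ inderHermitian h := by
  -- The bracket with `d` depends on the parity, and generators of both parities may occur in `g`.
  -- The generators are therefore collected parity by parity, and the parity of `g` selects one part
  -- at the end.
  let K : ZMod 2 → Submodule k (Module.End k (HermitianSpace N)) := fun j =>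
    { carrier := {f | f ∈ endGrading (hermitianGrading N) j ∧
        superBracket p j d f ∈ inderHermitian h}
      add_mem' := fun hf hf' => ⟨add_mem hf.1 hf'.1, by
        rw [superBracket_add_right]
        exact add_mem hf.2 hf'.2⟩
      zero_mem' := ⟨zero_mem _, by simp [superBracket]⟩
      smul_mem' := fun c _ hf => ⟨Submodule.smul_mem _ c hf.1, by
        rw [superBracket_smul_right]
        exact Submodule.smul_mem _ c hf.2⟩ }
  have hK : ∀ j, K j ≤ K 0 ⊔ K 1 := fun j => by
    rcases zmod_two_cases j with rfl | rfl
    exacts [le_sup_left, le_sup_right]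
  have mulmul : ∀ i j, ∀ X ∈ hermitianGrading N i, ∀ Y ∈ hermitianGrading N j,
      superBracket i j (jordanProduct h X) (jordanProduct h Y) ∈ K (i + j) :=
    fun i j X hX Y hY => by
      refine ⟨superBracket_mem_endGrading (h.jordanProduct_mem_endGrading hX)
        (h.jordanProduct_mem_endGrading hY), ?_⟩
      have m : ∀ i j, ∀ X ∈ hermitianGrading N i, ∀ Y ∈ hermitianGrading N j,
          superBracket i j (jordanProduct h X) (jordanProduct h Y) ∈ inderHermitian h :=
        fun i j X hX Y hY =>
        superBracket_mem_superCommutator (LinearMap.mem_range_self _ _)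
          (h.jordanProduct_mem_endGrading hX) (LinearMap.mem_range_self _ _)
          (h.jordanProduct_mem_endGrading hY)
      rw [superBracket_superBracket, superBracket_derivation_mul hd hX,
        superBracket_derivation_mul hd hY]
      exact add_mem (m _ _ _ (hd.1 _ _ hX) _ hY)
        (Submodule.smul_mem _ _ (m _ _ _ hX _ (hd.1 _ _ hY)))
  have hle : inderHermitian h ≤ K 0 ⊔ K 1 := by
    refine h.inderHermitian_le hk (fun i p a ha => ?_) fun i p a ha q b hb => ?_
    · have := hK _ (mulmul _ _ _ (h.offDiag_mem i ha) _ (h.diag_mem (i + 1)))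
      rw [h.superBracket_mul_offDiag_diag_one hk] at this
      exact (Submodule.smul_mem_iff _ (inv_ne_zero hk)).1 this
    · have := hK _ (mulmul _ _ _ (h.offDiag_mem i ha) _ (h.offDiag_mem i hb))
      rw [h.superBracket_mul_offDiag_offDiag_self hk i ha hb] at this
      exact neg_mem_iff.1 this
  obtain ⟨g0, hg0, g1, hg1, rfl⟩ := Submodule.mem_sup.1 (hle hg)
  rcases zmod_two_cases q with rfl | rfl
  · have : g1 = 0 := h.endGrading_disjoint hk (i := 1) (j := 0) (by decide) hg1.1
      (by simpa using sub_mem hgq hg0.1)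
    rw [this, add_zero]
    exact hg0.2
  · have : g0 = 0 := h.endGrading_disjoint hk (i := 0) (j := 1) (by decide) hg0.1
      (by simpa using sub_mem hgq hg1.1)
    rw [this, zero_add]
    exact hg1.2

theorem isLieSuperideal_inder_der :
    IsLieSuperideal (hermitianGrading N) (inderHermitian h) (derHermitian h) :=
  ⟨h.inderHermitian_le_der hk, isGradedSubspace_superCommutator _ _, superCommutator_le
    fun _ _ _ hf hfi _ hg hgj => h.superBracket_mem_inder hk
      (h.mem_homogeneousDerivations_of_mem_der hk hf hfi) hg hgj⟩

theorem isSimpleLieSuperalgebra_inder :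
    IsSimpleLieSuperalgebra (hermitianGrading N) (inderHermitian h) where
  graded := isGradedSubspace_superCommutator _ _
  bracket_le := superCommutator_le fun _ _ _ hf hfi _ hg hgj => h.superBracket_mem_inder hk
    (h.mem_homogeneousDerivations_of_mem_der hk (h.inderHermitian_le_der hk hf) hfi) hg hgj
  not_abelian H := by
    have m := superBracket_mem_superCommutator (h.offDiagDer_mem_inder hk 0 h.one_mem)
      (h.offDiagDer_mem_endGrading 0 h.one_mem) (h.offDiagDer_mem_inder hk (0 + 1) h.one_mem)
      (h.offDiagDer_mem_endGrading _ h.one_mem)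
    rw [H, Submodule.mem_bot, h.superBracket_offDiagDer_succ hk h.one_mem h.one_mem,
      h.paraProduct_one, h.conj_one] at m
    have e := h.offDiagDer_diag_one hk (0 + 2) 1
    rw [m, LinearMap.zero_apply] at e
    have e1 := congrArg (offDiagCoord N (0 + 2)) e
    rw [map_zero, map_smul, h.offDiagCoord_offDiag_self hk] at e1
    exact smul_ne_zero (inv_ne_zero hk) h.one_ne_zero e1.symm
  eq_bot_or_eq I hI := by
    by_cases h0 : ∀ q, ∀ X ∈ I, X ∈ endGrading (hermitianGrading N) q → X = 0
    · left
      rw [hI.graded, eq_bot_iff, sup_le_iff]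
      exact ⟨fun X hX => h0 0 X hX.1 hX.2, fun X hX => h0 1 X hX.1 hX.2⟩
    · right
      push Not at h0
      obtain ⟨q, X, hXI, hXq, hX0⟩ := h0
      have hst : h.IsOffDiagStable I := fun i p a ha q X hX hXq =>
        hI.bracket_le (superBracket_mem_superCommutator (h.offDiagDer_mem_inder hk i ha)
          (h.offDiagDer_mem_endGrading i ha) hX hXq)
      exact le_antisymm hI.le (hst.inderHermitian_le h hk hXI
        (h.mem_homogeneousDerivations_of_mem_der hk
          (h.inderHermitian_le_der hk (hI.le hXI)) hXq) hX0)

end IsHurwitzSuperalgebra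
end Simplicity

/-! ### Hurwitz superalgebras have finite dimension. -/

section FiniteDimension

variable {k C : Type*} [Field k] [NonAssocRing C] [Module k C]
  [IsScalarTower k C C] [SMulCommClass k C C]
  {𝒞 : ZMod 2 → Submodule k C} [DirectSum.Decomposition 𝒞] {N : QuadraticSuperform 𝒞}

/-- The even elements that are orthogonal to `1`. -/
def evenImaginary (N : QuadraticSuperform 𝒞) : Submodule k C where
  carrier := {x | x ∈ 𝒞 0 ∧ N.b x 1 = 0}
  add_mem' hx hy := ⟨add_mem hx.1 hy.1, by simp [hx.2, hy.2]⟩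
  zero_mem' := ⟨zero_mem _, by simp⟩
  smul_mem' c _ hx := ⟨Submodule.smul_mem _ c hx.1, by simp [hx.2]⟩

theorem QuadraticSuperform.form_comm {x y : C} (hx : x ∈ 𝒞 0) (hy : y ∈ 𝒞 0) :
    N.b x y = N.b y x := by
  rw [N.supersymmetric 0 0 x hx y hy, superSign_zero_left, one_mul]

namespace IsHurwitzSuperalgebra

variable (h : IsHurwitzSuperalgebra 𝒞 N)
include h

theorem mul_mul_add_mul_mul {i j l : ZMod 2} {x y z : C} (hx : x ∈ 𝒞 i) (hx1 : N.b x 1 = 0)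
    (hy : y ∈ 𝒞 j) (hy1 : N.b y 1 = 0) (hz : z ∈ 𝒞 l) :
    x * (y * z) + superSign k i j • (y * (x * z)) = -N.b x y • z := by
  have := h.conj_mul_mul hx hy hz
  rw [h.conj_of_form_one_eq_zero hx1, h.conj_of_form_one_eq_zero hy1, neg_mul, neg_mul] at this
  linear_combination (norm := module) -this

theorem mul_mul_add_mul_mul' {i j l : ZMod 2} {x y z : C} (hx : x ∈ 𝒞 i) (hx1 : N.b x 1 = 0)
    (hy : y ∈ 𝒞 j) (hy1 : N.b y 1 = 0) (hz : z ∈ 𝒞 l) :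
    z * x * y + superSign k i j • (z * y * x) = -N.b x y • z := by
  have := h.mul_mul_conj hx hy hz
  rw [h.conj_of_form_one_eq_zero hx1, h.conj_of_form_one_eq_zero hy1, mul_neg, mul_neg] at this
  linear_combination (norm := module) -this

theorem mul_add_mul {i j : ZMod 2} {x y : C} (hx : x ∈ 𝒞 i) (hx1 : N.b x 1 = 0)
    (hy : y ∈ 𝒞 j) (hy1 : N.b y 1 = 0) :
    x * y + superSign k i j • (y * x) = -N.b x y • (1 : C) := by
  simpa using h.mul_mul_add_mul_mul hx hx1 hy hy1 h.one_mem

theorem form_mul_left_of_imaginary {i j l : ZMod 2} {x y z : C} (hx : x ∈ 𝒞 i) (hx1 : N.b x 1 = 0)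
    (hy : y ∈ 𝒞 j) (hz : z ∈ 𝒞 l) : N.b (x * y) z = -superSign k i j * N.b y (x * z) := by
  have := form_standardInvolution_mul h hx hy hz
  rw [h.conj_of_form_one_eq_zero hx1, neg_mul, map_neg, LinearMap.neg_apply] at this
  linear_combination -this

section Even

variable {x y z : C} (hx : x ∈ evenImaginary N) (hy : y ∈ evenImaginary N)
include hx hy

theorem mul_comm_of_orthogonal (hxy : N.b x y = 0) : y * x = -(x * y) := by
  have := h.mul_add_mul hx.1 hx.2 hy.1 hy.2
  rw [superSign_zero_left, one_smul, hxy, neg_zero, zero_smul] at this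
  linear_combination (norm := module) this

theorem form_mul_left_of_evenImaginary {i : ZMod 2} {t : C} (ht : t ∈ 𝒞 i) :
    N.b (x * y) t = -N.b y (x * t) := by
  rw [h.form_mul_left_of_imaginary hx.1 hx.2 hy.1 ht, superSign_zero_left, neg_one_mul]

theorem mul_mem_evenImaginary (hxy : N.b x y = 0) : x * y ∈ evenImaginary N := by
  refine ⟨h.mul_mem 0 0 x hx.1 y hy.1, ?_⟩
  rw [h.form_mul_left_of_evenImaginary hx hy h.one_mem, mul_one,
    QuadraticSuperform.form_comm hy.1 hx.1, hxy, neg_zero]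

end Even

theorem mul_self_mul {i : ZMod 2} {x z : C} (hx : x ∈ evenImaginary N) (hz : z ∈ 𝒞 i) :
    (2 : k) • (x * (x * z)) = -N.b x x • z := by
  have := h.mul_mul_add_mul_mul hx.1 hx.2 hx.1 hx.2 hz
  rw [superSign_zero_left] at this
  linear_combination (norm := module) this

theorem mul_mul_self {i : ZMod 2} {x z : C} (hx : x ∈ evenImaginary N) (hz : z ∈ 𝒞 i) :
    (2 : k) • (z * x * x) = -N.b x x • z := by
  have := h.mul_mul_add_mul_mul' hx.1 hx.2 hx.1 hx.2 hz
  rw [superSign_zero_left] at this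
  linear_combination (norm := module) this

theorem form_mul_right_self {x y : C} (hx : x ∈ evenImaginary N) (hy : y ∈ evenImaginary N) :
    N.b (x * y) y = 0 := by
  have h1 := h.form_mul_right ⟨y, hy.1⟩ x 1
  simp only [one_mul] at h1
  rw [h1, hx.2, mul_zero]

theorem form_mul_left_self {x y : C} (hx : x ∈ evenImaginary N) (hy : y ∈ evenImaginary N) :
    N.b (x * y) x = 0 := by
  have h1 := h.form_mul_left ⟨x, hx.1⟩ y 1
  simp only [mul_one] at h1
  rw [h1, hy.2, mul_zero]

/-- Orthogonal imaginary elements anticommute, and `z (x y) = -x (z y)`. Since `z` also anticommutes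
with `x y` and with `y`, the triple associates up to a sign. -/
theorem mul_assoc_of_orthogonal {x y z : C} (hx : x ∈ evenImaginary N) (hy : y ∈ evenImaginary N)
    (hz : z ∈ evenImaginary N) (hxy : N.b x y = 0) (hxz : N.b x z = 0)
    (hxyz : N.b (x * y) z = 0) (hyz : N.b y z = 0) : x * y * z = -(x * (y * z)) := by
  have h1 := h.mul_comm_of_orthogonal (h.mul_mem_evenImaginary hx hy hxy) hz hxyz
  have h2 := h.mul_mul_add_mul_mul hz.1 hz.2 hx.1 hx.2 hy.1
  rw [QuadraticSuperform.form_comm hz.1 hx.1, hxz, superSign_zero_left, one_smul,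
    h.mul_comm_of_orthogonal hy hz hyz, mul_neg, h1] at h2
  linear_combination (norm := module) -h2

theorem eq_zero_of_mul_eq_zero {i : ZMod 2} {x z : C} (hx : x ∈ evenImaginary N)
    (hx0 : N.b x x ≠ 0) (hz : z ∈ 𝒞 i) (hxz : x * z = 0) : z = 0 := by
  have := h.mul_self_mul hx hz
  rw [hxz, mul_zero, smul_zero] at this
  exact (smul_eq_zero.1 this.symm).resolve_left (neg_ne_zero.2 hx0)

/-- There is no orthogonal family in a Cayley-Dickson process of length four. -/
theorem eq_zero_of_orthogonal (hk : (2 : k) ≠ 0) {a b c z : C} (ha : a ∈ evenImaginary N)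
    (hb : b ∈ evenImaginary N) (hc : c ∈ evenImaginary N) (hz : z ∈ evenImaginary N)
    (ha0 : N.b a a ≠ 0) (hb0 : N.b b b ≠ 0) (hc0 : N.b c c ≠ 0) (hab : N.b a b = 0)
    (hac : N.b a c = 0) (hbc : N.b b c = 0) (habc : N.b (a * b) c = 0) (hza : N.b z a = 0)
    (hzb : N.b z b = 0) (hzc : N.b z c = 0) (hzab : N.b z (a * b) = 0) (hzac : N.b z (a * c) = 0)
    (hzbc : N.b z (b * c) = 0) (hzabc : N.b z (a * b * c) = 0) : z = 0 := by
  have cm : ∀ {x y : C}, x ∈ evenImaginary N → y ∈ evenImaginary N → N.b x y = 0 → N.b y x = 0 :=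
    fun hx hy e => by rw [QuadraticSuperform.form_comm hy.1 hx.1, e]
  have mab := h.mul_mem_evenImaginary ha hb hab
  have mbc := h.mul_mem_evenImaginary hb hc hbc
  have mac := h.mul_mem_evenImaginary ha hc hac
  have mcz := h.mul_mem_evenImaginary hc hz (cm hz hc hzc)
  have mabc := h.mul_mem_evenImaginary mab hc habc
  -- The five reassociations of a product of four factors form a pentagon. Each contributes a sign,
  -- so going round gives `a (b (c z)) = -a (b (c z))`; left multiplication by a nonisotropic
  -- imaginary element is injective.
  have e1 : a * b * c * z = -(a * b * (c * z)) :=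
    h.mul_assoc_of_orthogonal mab hc hz habc (cm hz mab hzab) (cm hz mabc hzabc) (cm hz hc hzc)
  have hczx : ∀ {x : C}, x ∈ evenImaginary N → N.b x c = 0 → N.b z (x * c) = 0 →
      N.b x (c * z) = 0 := fun {x} hx hxc e => by
    rw [QuadraticSuperform.form_comm hx.1 mcz.1, h.form_mul_left_of_evenImaginary hc hz hx.1,
      h.mul_comm_of_orthogonal hx hc hxc, map_neg, e, neg_zero, neg_zero]
  have hacz := hczx ha hac hzac
  have hbcz := hczx hb hbc hzbc
  have habcz := hczx mab habc hzabc
  have e2 : a * b * (c * z) = -(a * (b * (c * z))) :=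
    h.mul_assoc_of_orthogonal ha hb mcz hab hacz habcz hbcz
  have e3 : a * b * c = -(a * (b * c)) := h.mul_assoc_of_orthogonal ha hb hc hab hac habc hbc
  have habc' : N.b a (b * c) = 0 := by
    rw [h.form_mul_left_of_evenImaginary ha hb hc.1, h.mul_comm_of_orthogonal hc ha (cm ha hc hac),
      map_neg, neg_neg, h.mul_comm_of_orthogonal ha hc hac, map_neg, neg_eq_zero] at habc
    rw [QuadraticSuperform.form_comm ha.1 mbc.1, h.form_mul_left_of_evenImaginary hb hc ha.1,
      h.mul_comm_of_orthogonal ha hb hab, map_neg, neg_neg,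
      QuadraticSuperform.form_comm hc.1 mab.1, h.form_mul_left_of_evenImaginary ha hb hc.1,
      habc, neg_zero]
  have e4 : a * (b * c) * z = -(a * (b * c * z)) :=
    h.mul_assoc_of_orthogonal ha mbc hz habc' (cm hz ha hza)
      (by rw [← neg_eq_iff_eq_neg.2 e3, map_neg, LinearMap.neg_apply, cm hz mabc hzabc, neg_zero])
      (cm hz mbc hzbc)
  have e5 : b * c * z = -(b * (c * z)) :=
    h.mul_assoc_of_orthogonal hb hc hz hbc (cm hz hb hzb) (cm hz mbc hzbc) (cm hz hc hzc)
  have e6 : (2 : k) • (a * (b * (c * z))) = 0 := by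
    rw [e3, neg_mul, e4, e5, e2, mul_neg] at e1
    linear_combination (norm := module) -e1
  have mbcz := h.mul_mem 0 0 b hb.1 _ mcz.1
  exact h.eq_zero_of_mul_eq_zero hc hc0 hz.1 (h.eq_zero_of_mul_eq_zero hb hb0 mcz.1
    (h.eq_zero_of_mul_eq_zero ha ha0 mbcz ((smul_eq_zero.1 e6).resolve_left hk)))

/-- If the orthogonal complement were nonzero and totally isotropic, polarization would make the
form vanish on it. But an element `y` not orthogonal to `x` stays so after Gram–Schmidt. -/
theorem exists_nonisotropic_or_eq_zero (hk : (2 : k) ≠ 0) {n : ℕ} (e : Fin n → C) (he : ∀ i, e i ∈ 𝒞 0)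
    (h0 : ∀ i, N.b (e i) (e i) ≠ 0) (horth : ∀ i j, i ≠ j → N.b (e i) (e j) = 0) :
    (∃ c ∈ 𝒞 0, (∀ i, N.b c (e i) = 0) ∧ N.b c c ≠ 0) ∨
      ∀ x ∈ 𝒞 0, (∀ i, N.b x (e i) = 0) → x = 0 := by
  by_contra! H
  obtain ⟨H, x, hx, hxe, hx0⟩ := H
  obtain ⟨y, hy, hxy⟩ := h.exists_form_ne_zero hx hx0
  set y' := y - ∑ i, (N.b y (e i) * (N.b (e i) (e i))⁻¹) • e i
  have hy' : y' ∈ 𝒞 0 := sub_mem hy (Submodule.sum_mem _ fun i _ => Submodule.smul_mem _ _ (he i))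
  have hy'e : ∀ j, N.b y' (e j) = 0 := fun j => by
    simp only [y', map_sub, map_sum, map_smul, LinearMap.sub_apply, LinearMap.sum_apply,
      LinearMap.smul_apply, smul_eq_mul]
    rw [Finset.sum_eq_single j (fun i _ hi => by rw [horth i j hi, mul_zero]) (by simp), mul_assoc,
      inv_mul_cancel₀ (h0 j), mul_one, sub_self]
  have hxy' : N.b x y' = N.b x y := by
    simp [y', hxe]
  have e1 := H _ (add_mem hx hy') fun i => by simp [hxe i, hy'e i]
  simp only [map_add, LinearMap.add_apply, H x hx hxe, H y' hy' hy'e,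
    QuadraticSuperform.form_comm hy' hx, hxy', zero_add, add_zero, ← two_mul] at e1
  exact hxy ((mul_eq_zero.1 e1).resolve_left hk)

theorem form_mul_mul_evenImaginary {x y : C} (hx : x ∈ evenImaginary N)
    (hy : y ∈ 𝒞 0) : 2 * N.b (x * y) (x * y) = N.b x x * N.b y y := by
  have := h.form_mul_left_of_imaginary hx.1 hx.2 hy (h.mul_mem 0 0 x hx.1 y hy)
  have e := congrArg (N.b y) (h.mul_self_mul hx hy)
  rw [map_smul, map_smul, smul_eq_mul, smul_eq_mul] at e
  rw [superSign_zero_left] at this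
  linear_combination 2 * this - e

theorem even_trichotomy (hk : (2 : k) ≠ 0) :
    (∀ x ∈ evenImaginary N, x = 0) ∨
    (∃ a ∈ evenImaginary N, N.b a a ≠ 0 ∧ ∀ x ∈ evenImaginary N, N.b x a = 0 → x = 0) ∨
    ∃ a ∈ evenImaginary N, ∃ b ∈ evenImaginary N, N.b a a ≠ 0 ∧ N.b b b ≠ 0 ∧ N.b a b = 0 := by
  have h11 : N.b 1 1 ≠ 0 := by rwa [h.form_one_one]
  rcases h.exists_nonisotropic_or_eq_zero hk ![1] (by simp [h.one_mem]) (by simp [h11])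
    (by simp [Fin.forall_fin_one]) with ⟨a, ha, ha1, ha0⟩ | H
  · have ha' : a ∈ evenImaginary N := ⟨ha, by simpa using ha1⟩
    rcases h.exists_nonisotropic_or_eq_zero hk ![1, a] (by simp [Fin.forall_fin_two, h.one_mem, ha])
      (by simp [Fin.forall_fin_two, h11, ha0])
      (by simp [Fin.forall_fin_two, h.form_one_left, ha'.2]) with ⟨b, hb, hb1, hb0⟩ | H
    · simp only [Fin.forall_fin_two, Matrix.cons_val_zero, Matrix.cons_val_one] at hb1
      refine .inr (.inr ⟨a, ha', b, ⟨hb, hb1.1⟩, ha0, hb0, ?_⟩)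
      rw [QuadraticSuperform.form_comm ha hb, hb1.2]
    · exact .inr (.inl ⟨a, ha', ha0, fun x hx hxa => H x hx.1 (by
        simp [Fin.forall_fin_two, hx.2, hxa])⟩)
  · exact .inl fun x hx => H x hx.1 (by simp [hx.2])

omit h in
theorem finite_even {n : ℕ} (e : Fin n → C) (H : ∀ x ∈ 𝒞 0, (∀ i, N.b x (e i) = 0) → x = 0) :
    Module.Finite k (𝒞 0) := by
  refine Module.Finite.of_injective (LinearMap.pi fun i => (N.b.flip (e i)) ∘ₗ (𝒞 0).subtype)
    ((injective_iff_map_eq_zero _).2 fun x hx => ?_)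
  exact Subtype.ext (H x x.2 fun i => congrFun hx i)

/-- The argument of Hurwitz: the doubling process stops after three steps, so an even element is
determined by its products with at most eight vectors. -/
theorem finiteDimensional_even (hk : (2 : k) ≠ 0) : Module.Finite k (𝒞 0) := by
  have h11 : N.b 1 1 ≠ 0 := by rwa [h.form_one_one]
  rcases h.even_trichotomy hk with H | ⟨a, -, -, H⟩ | ⟨a, ha, b, hb, ha0, hb0, hab⟩
  · exact finite_even (N := N) ![1] fun x hx hx1 => H x ⟨hx, by simpa using hx1⟩
  · refine finite_even (N := N) ![1, a] fun x hx hx1 => ?_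
    simp only [Fin.forall_fin_two, Matrix.cons_val_zero, Matrix.cons_val_one] at hx1
    exact H x ⟨hx, hx1.1⟩ hx1.2
  have mab := h.mul_mem_evenImaginary ha hb hab
  have mab0 : N.b (a * b) (a * b) ≠ 0 := fun H => by
    have := h.form_mul_mul_evenImaginary ha hb.1
    rw [H, mul_zero] at this
    exact mul_ne_zero ha0 hb0 this.symm
  have cm : ∀ {x y : C}, x ∈ evenImaginary N → y ∈ evenImaginary N → N.b x y = 0 → N.b y x = 0 :=
    fun hx hy e => by rw [QuadraticSuperform.form_comm hy.1 hx.1, e]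
  have o1 := h.form_mul_left_self ha hb
  have o2 := h.form_mul_right_self ha hb
  rcases h.exists_nonisotropic_or_eq_zero hk ![1, a, b, a * b]
    (by simp [Fin.forall_fin_succ, h.one_mem, ha.1, hb.1, mab.1])
    (by simp [Fin.forall_fin_succ, h11, ha0, hb0, mab0])
    (by simp [Fin.forall_fin_succ, h.form_one_left, ha.2, hb.2, mab.2, hab, cm ha hb hab, o1, o2,
      cm mab ha o1, cm mab hb o2]) with ⟨c, hc, hc1, hc0⟩ | H
  · simp only [Fin.forall_fin_succ, Matrix.cons_val_zero, Matrix.cons_val_succ,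
      IsEmpty.forall_iff, and_true] at hc1
    obtain ⟨hc1, hca, hcb, hcab⟩ := hc1
    have hc' : c ∈ evenImaginary N := ⟨hc, hc1⟩
    refine finite_even (N := N) ![1, a, b, c, a * b, a * c, b * c, a * b * c] fun z hz H => ?_
    simp only [Fin.forall_fin_succ, Matrix.cons_val_zero, Matrix.cons_val_succ,
      IsEmpty.forall_iff, and_true] at H
    obtain ⟨z1, z2, z3, z4, z5, z6, z7, z8⟩ := H
    exact h.eq_zero_of_orthogonal hk ha hb hc' ⟨hz, z1⟩ ha0 hb0 hc0 hab (cm hc' ha hca)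
      (cm hc' hb hcb) (cm hc' mab hcab) z2 z3 z4 z5 z6 z7 z8
  · exact finite_even (N := N) _ H

/-- For a nonzero odd `u`, the map `z ↦ (u z, b(u,z))` takes values in a space of finite dimension.
Its kernel is totally isotropic: for `z, w` in it `u (z w) = 0`, while `z w - w z = -b(z,w) 1`. A
totally isotropic subspace with a complement of finite dimension embeds in the dual of that
complement. -/
theorem finiteDimensional_odd (hk : (2 : k) ≠ 0) : Module.Finite k (𝒞 1) := by
  by_cases hu : ∀ u ∈ 𝒞 1, u = 0
  · have : Subsingleton (𝒞 1) := ⟨fun x y => Subtype.ext (by rw [hu x x.2, hu y y.2])⟩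
    infer_instance
  push Not at hu
  obtain ⟨u, hu, hu0⟩ := hu
  have hu1 := h.form_one_of_odd hu
  have := h.finiteDimensional_even hk
  let f : 𝒞 1 →ₗ[k] 𝒞 0 × k := LinearMap.prod
    (LinearMap.codRestrict (𝒞 0) (LinearMap.mulLeft k u ∘ₗ (𝒞 1).subtype) fun z => by
      have := h.mul_mem 1 1 u hu z z.2
      rwa [ZMod.one_add_one_eq_zero] at this)
    (N.b u ∘ₗ (𝒞 1).subtype)
  have hf : ∀ z, z ∈ LinearMap.ker f → u * z = 0 ∧ N.b u z = 0 := fun z hz => by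
    rw [LinearMap.mem_ker, Prod.ext_iff] at hz
    exact ⟨congrArg Subtype.val hz.1, hz.2⟩
  have hiso : ∀ z ∈ LinearMap.ker f, ∀ w ∈ LinearMap.ker f, N.b z w = 0 := fun z hz w hw => by
    have key : ∀ z ∈ LinearMap.ker f, ∀ w ∈ LinearMap.ker f, u * ((z : C) * w) = 0 :=
      fun z hz w hw => by
        have := h.mul_mul_add_mul_mul hu hu1 z.2 (h.form_one_of_odd z.2) w.2
        rwa [(hf w hw).1, (hf z hz).2, mul_zero, smul_zero, add_zero, neg_zero, zero_smul] at this
    have e := congrArg (u * ·) (h.mul_add_mul z.2 (h.form_one_of_odd z.2) w.2 (h.form_one_of_odd w.2))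
    simp only [mul_add, mul_smul_comm, key z hz w hw, key w hw z hz, smul_zero, add_zero,
      mul_one] at e
    exact neg_eq_zero.1 ((smul_eq_zero.1 e.symm).resolve_right hu0)
  obtain ⟨P, hP⟩ := (LinearMap.ker f).exists_isCompl
  have hPfin : Module.Finite k P := by
    refine Module.Finite.of_injective (f ∘ₗ P.subtype) ((injective_iff_map_eq_zero _).2 fun x hx => ?_)
    exact Subtype.ext (Submodule.disjoint_def.1 hP.disjoint x hx x.2)
  have hW : Module.Finite k (LinearMap.ker f) := by
    let g : LinearMap.ker f →ₗ[k] Module.Dual k P :=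
      { toFun := fun w => N.b w ∘ₗ (𝒞 1).subtype ∘ₗ P.subtype
        map_add' := fun w w' => by ext; simp
        map_smul' := fun c w => by ext; simp }
    refine Module.Finite.of_injective g ((injective_iff_map_eq_zero _).2 fun w hw => ?_)
    refine Subtype.ext (Subtype.ext (h.regular.nondegenerate_odd w w.1.2 fun y hy => ?_))
    obtain ⟨y1, hy1, y2, hy2, e⟩ := Submodule.mem_sup.1
      (hP.sup_eq_top ▸ Submodule.mem_top : (⟨y, hy⟩ : 𝒞 1) ∈ LinearMap.ker f ⊔ P)
    have e' : y = y1 + y2 := congrArg Subtype.val e.symm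
    rw [e', map_add, hiso w w.2 y1 hy1, zero_add]
    exact LinearMap.congr_fun hw ⟨y2, hy2⟩
  have hfin : Module.Finite k ↥(LinearMap.ker f ⊔ P) := inferInstance
  rw [hP.sup_eq_top] at hfin
  exact Module.Finite.equiv Submodule.topEquiv

end IsHurwitzSuperalgebra
end FiniteDimension

/-! ### Diagonal derivations modulo inner ones. -/

section DiagonalDerivations

variable {k C : Type*} [Field k] [NonAssocRing C] [Module k C]
  [IsScalarTower k C C] [SMulCommClass k C C]
  {𝒞 : ZMod 2 → Submodule k C} [DirectSum.Decomposition 𝒞] {N : QuadraticSuperform 𝒞}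

open HermitianSpace

theorem QuadraticSuperform.form_swap {i : ZMod 2} {x : C} (hx : x ∈ 𝒞 i) (y : C) :
    N.b x y = superSign k i i * N.b y x := by
  induction y using superspace_induction 𝒞 with
  | hom j y hy =>
    by_cases hij : i = j
    · subst hij
      exact N.supersymmetric _ _ _ hx _ hy
    · rw [QuadraticSuperform.form_eq_zero hij hx hy,
        QuadraticSuperform.form_eq_zero (Ne.symm hij) hy hx, mul_zero]
  | add y z hy hz => rw [map_add, map_add, hy, hz, LinearMap.add_apply, mul_add]

namespace IsHurwitzSuperalgebra

variable (h : IsHurwitzSuperalgebra 𝒞 N)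
include h

theorem eq_of_form_eq {x y : C} (H : ∀ z, N.b x z = N.b y z) : x = y := by
  have key : ∀ x, (∀ z, N.b x z = 0) → x = 0 := fun x hx => by
    obtain ⟨x0, h0, x1, h1, rfl⟩ : ∃ x0 ∈ 𝒞 0, ∃ x1 ∈ 𝒞 1, x = x0 + x1 := by
      clear hx
      induction x using superspace_induction 𝒞 with
      | hom i x hx =>
        rcases zmod_two_cases i with rfl | rfl
        exacts [⟨x, hx, 0, zero_mem _, (add_zero x).symm⟩, ⟨0, zero_mem _, x, hx, (zero_add x).symm⟩]
      | add x y hx hy =>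
        obtain ⟨x0, h0, x1, h1, rfl⟩ := hx
        obtain ⟨y0, h0', y1, h1', rfl⟩ := hy
        exact ⟨x0 + y0, add_mem h0 h0', x1 + y1, add_mem h1 h1', by abel⟩
    rw [h.regular.nondegenerate_even x0 h0 fun y hy => by
        have := hx y
        rwa [map_add, LinearMap.add_apply,
          QuadraticSuperform.form_eq_zero (by decide) h1 hy, add_zero] at this,
      h.regular.nondegenerate_odd x1 h1 fun y hy => by
        have := hx y
        rwa [map_add, LinearMap.add_apply,
          QuadraticSuperform.form_eq_zero (by decide) h0 hy, zero_add] at this, add_zero]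
  exact sub_eq_zero.1 (key _ fun z => by rw [map_sub, LinearMap.sub_apply, H, sub_self])

variable (hk : (2 : k) ≠ 0)
include hk

theorem exists_dual_family : ∃ (ι : Type) (_ : Fintype ι) (par : ι → ZMod 2) (e e' : ι → C),
    (∀ i, e i ∈ 𝒞 (par i)) ∧ (∀ i, e' i ∈ 𝒞 (par i)) ∧ ∀ x, x = ∑ i, N.b x (e' i) • e i := by
  have hfin : ∀ p, Module.Finite k (𝒞 p) := fun p => by
    rcases zmod_two_cases p with rfl | rfl
    exacts [h.finiteDimensional_even hk, h.finiteDimensional_odd hk]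
  let B : ∀ p, LinearMap.BilinForm k (𝒞 p) := fun p => N.b.restrict (𝒞 p)
  have hB : ∀ p, (B p).Nondegenerate := fun p => by
    have key : ∀ x : 𝒞 p, (∀ y : 𝒞 p, N.b x y = 0) → x = 0 := fun x hx => by
      by_contra hx0
      obtain ⟨y, hy, hxy⟩ := h.exists_form_ne_zero x.2 fun H => hx0 (Subtype.ext H)
      exact hxy (hx ⟨y, hy⟩)
    refine ⟨key, fun x hx => key x fun y => ?_⟩
    rw [QuadraticSuperform.form_swap x.2, show N.b y x = 0 from hx y, mul_zero]
  let v : ∀ p, Module.Basis (Fin (Module.finrank k (𝒞 p))) k (𝒞 p) := fun p =>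
    Module.finBasis k (𝒞 p)
  refine ⟨Σ p : ZMod 2, Fin (Module.finrank k (𝒞 p)), inferInstance, Sigma.fst,
    fun i => (B i.1).dualBasis (hB i.1) (v i.1) i.2, fun i => v i.1 i.2, fun i => SetLike.coe_mem _,
    fun i => SetLike.coe_mem _, fun x => ?_⟩
  induction x using superspace_induction 𝒞 with
  | hom p x hx =>
    rw [Fintype.sum_sigma, Finset.sum_eq_single p (fun q _ hq => Finset.sum_eq_zero fun i _ => by
      rw [QuadraticSuperform.form_eq_zero (Ne.symm hq) hx (SetLike.coe_mem _), zero_smul]) (by simp)]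
    have := congrArg Subtype.val (((B p).dualBasis (hB p) (v p)).sum_repr ⟨x, hx⟩)
    simp only [LinearMap.BilinForm.dualBasis_repr_apply] at this
    rw [AddSubmonoidClass.coe_finsetSum] at this
    exact this.symm
  | add x y hx hy =>
    simp only [map_add, LinearMap.add_apply, add_smul, Finset.sum_add_distrib]
    rw [← hx, ← hy]

/-- With dual families `e`, `e'`, a skew map `s` is the sum of the elementary skew maps attached to
the pairs `(e_i, s e'_i)`, up to signs and a scalar. The factor `4⁻¹` occurs because each elementary
map has two terms with coefficient `2`, and each of the two sums equals `s`. -/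
theorem exists_mem_inder_comp_eq {p : ZMod 2} {d : Module.End k (HermitianSpace N)}
    (hd : d ∈ h.diagDer p) (l : Fin 3) :
    ∃ t ∈ inderHermitian h, t ∈ h.diagDer p ∧ h.comp l t = h.comp l d := by
  obtain ⟨ι, _, par, e, e', he, he', hsum⟩ := h.exists_dual_family hk
  have hsum' : ∀ x, x = ∑ i, N.b (e i) x • e' i := fun x => h.eq_of_form_eq fun y => by
    have e1 := congrArg (N.b x) (hsum y)
    rw [map_sum] at e1
    rw [e1]
    simp only [map_sum, LinearMap.sum_apply, map_smul, LinearMap.smul_apply, smul_eq_mul]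
    refine Finset.sum_congr rfl fun i _ => ?_
    rw [QuadraticSuperform.form_swap (he' i) y, QuadraticSuperform.form_swap (he i) x]
    linear_combination -(N.b y (e' i) * N.b x (e i)) * superSign_mul_self k (par i) (par i)
  have hm : ∀ i, h.comp l d (e' i) ∈ 𝒞 (p + par i) := fun i => h.comp_mem hd l (he' i)
  refine ⟨∑ i, (4⁻¹ * superSign k p (par i) * superSign k (par i) (par i)) •
    superBracket (par i) (p + par i) (h.offDiagDer l (e i)) (h.offDiagDer l (h.comp l d (e' i))),
    Submodule.sum_mem _ fun i _ => Submodule.smul_mem _ _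
      (h.superBracket_offDiagDer_mem_inder hk l (he i) (hm i)),
    Submodule.sum_mem _ fun i _ => Submodule.smul_mem _ _ ?_, ?_⟩
  · have := h.superBracket_offDiagDer_self_mem hk (he i) (hm i) l
    rwa [add_left_comm, CharTwo.add_self_eq_zero, add_zero] at this
  · ext x
    have e1 := hsum (h.comp l d x)
    have e2 := congrArg (h.comp l d) (hsum' x)
    rw [map_sum] at e2
    have h4 : (4 : k) ≠ 0 := by
      rw [show (4 : k) = 2 * 2 by norm_num]
      exact mul_ne_zero hk hk
    have : ∀ i, h.comp l ((4⁻¹ * superSign k p (par i) * superSign k (par i) (par i)) •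
        superBracket (par i) (p + par i) (h.offDiagDer l (e i))
          (h.offDiagDer l (h.comp l d (e' i)))) x
        = (4⁻¹ * 2 : k) • (h.comp l d (N.b (e i) x • e' i)
          + N.b (h.comp l d x) (e' i) • e i) := fun i => by
      have e3 := h.form_comp hk hd l (he' i) x
      rw [QuadraticSuperform.form_swap (he' i) (h.comp l d x)] at e3
      rw [map_smul, LinearMap.smul_apply, h.comp_superBracket_offDiagDer_zero hk, map_smul,
        eq_neg_of_add_eq_zero_left e3, superSign_add_right, superSign_comm k (par i) p]
      have s1 := superSign_mul_self k p (par i)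
      have s2 := superSign_mul_self k (par i) (par i)
      match_scalars
      · linear_combination (4⁻¹ * 2 * N.b (e i) x) *
          (superSign k (par i) (par i) * superSign k (par i) (par i) * s1 + s2)
      · linear_combination (4⁻¹ * 2 * N.b (h.comp l d x) (e' i)) *
          (superSign k (par i) (par i) * superSign k (par i) (par i) * s1 + s2)
    rw [map_sum, LinearMap.sum_apply, Finset.sum_congr rfl fun i _ => this i, ← Finset.smul_sum,
      Finset.sum_add_distrib, ← e1, ← e2]
    match_scalars
    field_simp
    norm_num

section Nucleus

variable {p : ZMod 2} {d : Module.End k (HermitianSpace N)} (hd : d ∈ h.diagDer p) {i : Fin 3}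
  (hd0 : h.comp i d = 0)
include hd hd0

theorem form_comp_one_one (j : Fin 3) : N.b (h.comp j d 1) 1 = 0 := by
  have := h.form_comp hk hd j h.one_mem 1
  rw [superSign_zero_right, h.form_one_left, one_mul, ← two_mul] at this
  exact (mul_eq_zero.1 this).resolve_left hk

/-- The triality relation with `d_i = 0` and first argument `1`. The relation with the roles
exchanged gives left multiplication in the next lemma. -/
theorem comp_two_of_comp_eq_zero {q : ZMod 2} {x : C} (hx : x ∈ 𝒞 q) :
    h.comp (i + 2) d x = -superSign k p q • (x * h.comp (i + 1) d 1) := by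
  have m := h.comp_mem hd (i + 1) h.one_mem
  have e := h.comp_paraProduct hk hd (i + 1) h.one_mem x
  rw [Fin.three_add_one_add_two, hd0, LinearMap.zero_apply, superSign_zero_right, one_smul,
    h.one_paraProduct, Fin.three_add_one_add_one] at e
  have e' := congrArg (standardInvolution N) e
  rw [map_zero, map_add, h.conj_conj, h.conj_paraProduct m hx, add_zero] at e'
  linear_combination (norm := module) -e'

theorem comp_one_of_comp_eq_zero {q : ZMod 2} {x : C} (hx : x ∈ 𝒞 q) :
    h.comp (i + 1) d x = h.comp (i + 1) d 1 * x := by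
  have m := h.comp_mem hd (i + 1) h.one_mem
  rw [add_zero] at m
  have e := h.comp_paraProduct hk hd (i + 2) (standardInvolution_mem h hx) 1
  rw [Fin.three_add_two_add_two, Fin.three_add_two_add_one, hd0, LinearMap.zero_apply, map_zero,
    smul_zero, add_zero, h.paraProduct_one, h.conj_conj, h.paraProduct_one,
    h.comp_two_of_comp_eq_zero hk hd hd0 (standardInvolution_mem h hx), map_smul,
    standardInvolution_mul h (standardInvolution_mem h hx) m, h.conj_conj,
    h.conj_of_form_one_eq_zero (h.form_comp_one_one hk hd hd0 _), smul_smul, superSign_comm k q p,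
    neg_mul, superSign_mul_self] at e
  rw [e]
  simp

/-- Once `d_{i+1}` and `d_{i+2}` are multiplications by `c`, each of the three cyclic forms of the
triality relation states that `c` associates in one position; this one is the form starting at `i`.
-/
theorem mul_assoc_right_of_comp_eq_zero {q r : ZMod 2} {x y : C} (hx : x ∈ 𝒞 q) (hy : y ∈ 𝒞 r) :
    x * y * h.comp (i + 1) d 1 = x * (y * h.comp (i + 1) d 1) := by
  have m := h.comp_mem hd (i + 1) h.one_mem
  have hy' := standardInvolution_mem h hy
  rw [add_zero] at m
  have e := h.comp_paraProduct hk hd i (standardInvolution_mem h hx) (standardInvolution N y)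
  rw [hd0, LinearMap.zero_apply, map_zero, LinearMap.zero_apply, zero_add, paraProduct_apply,
    h.conj_conj, h.conj_conj, h.comp_two_of_comp_eq_zero hk hd hd0 (h.mul_mem _ _ _ hx _ hy),
    h.comp_one_of_comp_eq_zero hk hd hd0 hy', paraProduct_apply, h.conj_conj,
    standardInvolution_mul h m hy', h.conj_conj,
    h.conj_of_form_one_eq_zero (h.form_comp_one_one hk hd hd0 _), superSign_add_right, mul_neg,
    smul_neg, mul_neg, mul_smul_comm, smul_neg, smul_smul, neg_smul, neg_inj] at e
  exact smul_right_injective _ (mul_ne_zero (left_ne_zero_of_mul_eq_one (superSign_mul_self k p q))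
    (left_ne_zero_of_mul_eq_one (superSign_mul_self k p r))) e

theorem mul_assoc_left_of_comp_eq_zero {q r : ZMod 2} {x y : C} (hx : x ∈ 𝒞 q) (hy : y ∈ 𝒞 r) :
    h.comp (i + 1) d 1 * x * y = h.comp (i + 1) d 1 * (x * y) := by
  have m := h.comp_mem hd (i + 1) h.one_mem
  have hx' := standardInvolution_mem h hx
  rw [add_zero] at m
  have e := h.comp_paraProduct hk hd (i + 2) hx' (standardInvolution N y)
  rw [Fin.three_add_two_add_one, hd0, LinearMap.zero_apply, map_zero, smul_zero, add_zero,
    Fin.three_add_two_add_two, paraProduct_apply, h.conj_conj, h.conj_conj,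
    h.comp_one_of_comp_eq_zero hk hd hd0 (h.mul_mem _ _ _ hx _ hy),
    h.comp_two_of_comp_eq_zero hk hd hd0 hx', paraProduct_apply, h.conj_conj, map_smul,
    standardInvolution_mul h hx' m, h.conj_conj,
    h.conj_of_form_one_eq_zero (h.form_comp_one_one hk hd hd0 _), smul_smul, superSign_comm k q p,
    neg_mul, superSign_mul_self] at e
  simpa using e.symm

theorem mul_assoc_middle_of_comp_eq_zero {q r : ZMod 2} {x y : C} (hx : x ∈ 𝒞 q) (hy : y ∈ 𝒞 r) :
    x * h.comp (i + 1) d 1 * y = x * (h.comp (i + 1) d 1 * y) := by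
  have m := h.comp_mem hd (i + 1) h.one_mem
  have hx' := standardInvolution_mem h hx
  have hy' := standardInvolution_mem h hy
  rw [add_zero] at m
  have e := h.comp_paraProduct hk hd (i + 1) hx' (standardInvolution N y)
  rw [Fin.three_add_one_add_two, hd0, LinearMap.zero_apply, Fin.three_add_one_add_one,
    h.comp_one_of_comp_eq_zero hk hd hd0 hx', h.comp_two_of_comp_eq_zero hk hd hd0 hy',
    paraProduct_apply, paraProduct_apply, h.conj_conj, h.conj_conj, map_smul,
    standardInvolution_mul h m hx', standardInvolution_mul h hy' m, h.conj_conj, h.conj_conj,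
    h.conj_of_form_one_eq_zero (h.form_comp_one_one hk hd hd0 _), smul_smul, superSign_comm k r p,
    neg_mul (superSign k p r), superSign_mul_self] at e
  have e' : superSign k p q • (x * h.comp (i + 1) d 1 * y)
      = superSign k p q • (x * (h.comp (i + 1) d 1 * y)) := by
    simp only [mul_neg, neg_mul, smul_mul_assoc, neg_smul, one_smul, neg_neg, smul_neg] at e
    linear_combination (norm := module) e
  exact smul_right_injective _ (left_ne_zero_of_mul_eq_one (superSign_mul_self k p q)) e'

theorem eq_zero_of_comp_eq_zero (h1 : h.comp (i + 1) d 1 = 0) : d = 0 := by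
  refine h.eq_of_comp hk hd (zero_mem (h.diagDer p)) fun j q x hx => ?_
  rw [map_zero, LinearMap.zero_apply]
  rcases Fin.three_cases i j with rfl | rfl | rfl
  · rw [hd0, LinearMap.zero_apply]
  · rw [h.comp_one_of_comp_eq_zero hk hd hd0 hx, h1, zero_mul]
  · rw [h.comp_two_of_comp_eq_zero hk hd hd0 hx, h1, mul_zero, smul_zero]

end Nucleus

end IsHurwitzSuperalgebra
end DiagonalDerivations

/-! ### Imaginary elements of the nucleus, and when `der J = inder J`. -/

section Nucleus

variable {k C : Type*} [Field k] [NonAssocRing C] [Module k C]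
  [IsScalarTower k C C] [SMulCommClass k C C]
  {𝒞 : ZMod 2 → Submodule k C} [DirectSum.Decomposition 𝒞] {N : QuadraticSuperform 𝒞}

open HermitianSpace

/-- The elements of parity `p` that are orthogonal to `1` and lie in the nucleus. -/
structure IsImaginaryNuclear (N : QuadraticSuperform 𝒞) (p : ZMod 2) (c : C) : Prop where
  mem : c ∈ 𝒞 p
  form_one : N.b c 1 = 0
  left : ∀ q r, ∀ x ∈ 𝒞 q, ∀ y ∈ 𝒞 r, c * x * y = c * (x * y)
  middle : ∀ q r, ∀ x ∈ 𝒞 q, ∀ y ∈ 𝒞 r, x * c * y = x * (c * y)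
  right : ∀ q r, ∀ x ∈ 𝒞 q, ∀ y ∈ 𝒞 r, x * y * c = x * (y * c)

namespace IsHurwitzSuperalgebra

variable (h : IsHurwitzSuperalgebra 𝒞 N) (hk : (2 : k) ≠ 0)
include h hk

theorem isImaginaryNuclear_comp {p : ZMod 2} {d : Module.End k (HermitianSpace N)}
    (hd : d ∈ h.diagDer p) {i : Fin 3} (hd0 : h.comp i d = 0) :
    IsImaginaryNuclear N p (h.comp (i + 1) d 1) where
  mem := by simpa using h.comp_mem hd (i + 1) h.one_mem
  form_one := h.form_comp_one_one hk hd hd0 _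
  left _ _ _ hx _ hy := h.mul_assoc_left_of_comp_eq_zero hk hd hd0 hx hy
  middle _ _ _ hx _ hy := h.mul_assoc_middle_of_comp_eq_zero hk hd hd0 hx hy
  right _ _ _ hx _ hy := h.mul_assoc_right_of_comp_eq_zero hk hd hd0 hx hy

/-- Comparing left and right composition identities gives `c² v = -b(c,v) c` for odd `v`. As `b(c,c)
= 0`, this yields `c² c = 0`; multiplication by `c` then yields `b(c,v) c² = 0`. Choosing `b(c,v) ≠
0` forces `c² = 0` and then `c = 0`. -/
theorem eq_zero_of_isImaginaryNuclear_odd {c : C} (hc : IsImaginaryNuclear N 1 c) : c = 0 := by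
  by_contra hc0
  have hcc : c * c ∈ evenImaginary N := by
    refine ⟨ZMod.one_add_one_eq_zero ▸ h.mul_mem 1 1 c hc.mem c hc.mem, ?_⟩
    have e := N.supersymmetric _ _ _ hc.mem _ hc.mem
    rw [superSign_one_one] at e
    rw [h.form_mul_left_of_imaginary hc.mem hc.form_one hc.mem h.one_mem, mul_one]
    have : 2 * N.b c c = 0 := by linear_combination e
    rw [(mul_eq_zero.1 this).resolve_left hk, mul_zero]
  have key : ∀ v ∈ 𝒞 1, c * c * v = -N.b c v • c := fun v hv => by
    have hv1 := h.form_one_of_odd hv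
    have e1 := h.mul_mul_add_mul_mul hc.mem hc.form_one hv hv1 hc.mem
    have e2 := h.mul_mul_add_mul_mul' hc.mem hc.form_one hv hv1 hc.mem
    have e3 := h.mul_add_mul hcc.1 hcc.2 hv hv1
    rw [QuadraticSuperform.form_eq_zero (by decide) hcc.1 hv, superSign_zero_left, neg_zero,
      zero_smul, one_smul] at e3
    rw [superSign_one_one] at e1 e2
    rw [hc.left _ _ _ hv _ hc.mem] at e2
    have e4 : (2 : k) • (c * c * v) = (2 : k) • (-N.b c v • c) := by
      linear_combination (norm := module) e1 + e2 + e3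
    exact smul_right_injective _ hk e4
  obtain ⟨v, hv, hcv⟩ := h.exists_form_ne_zero hc.mem hc0
  have hccc : c * c * c = 0 := by
    have e := N.supersymmetric _ _ _ hc.mem _ hc.mem
    rw [superSign_one_one] at e
    have : 2 * N.b c c = 0 := by linear_combination e
    rw [key c hc.mem, (mul_eq_zero.1 this).resolve_left hk, neg_zero, zero_smul]
  have e1 : N.b c v • (c * c) = 0 := by
    have := congrArg (c * ·) (key v hv)
    simp only [mul_smul_comm] at this
    rw [← hc.left _ _ _ hcc.1 _ hv, ← hc.left _ _ _ hc.mem _ hc.mem, hccc, zero_mul] at this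
    linear_combination (norm := module) this
  have e2 := key v hv
  rw [(smul_eq_zero.1 e1).resolve_left hcv, zero_mul] at e2
  exact hc0 ((smul_eq_zero.1 e2.symm).resolve_left (neg_ne_zero.2 hcv))

section Inner

variable {a b c : C} (j : Fin 3)

omit hk in
theorem comp_one_orthogonal (hk : (2 : k) ≠ 0) (ha : a ∈ evenImaginary N)
    (hb : b ∈ evenImaginary N) (hab : N.b a b = 0) {r : ZMod 2} {x : C} (hx : x ∈ 𝒞 r) :
    h.comp (j + 1) (superBracket 0 0 (h.offDiagDer j a) (h.offDiagDer j b)) x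
      = (2 : k) • (x * b * a) := by
  have e := h.mul_mul_add_mul_mul' ha.1 ha.2 hb.1 hb.2 hx
  rw [hab, neg_zero, zero_smul, superSign_zero_left, one_smul] at e
  rw [h.comp_superBracket_offDiagDer_one hk ha.1 hb.1 j hx, paraProduct_apply, paraProduct_apply _ a,
    h.conj_paraProduct ha.1 hx, h.conj_paraProduct hb.1 hx, h.conj_of_form_one_eq_zero ha.2,
    h.conj_of_form_one_eq_zero hb.2, superSign_zero_left, superSign_zero_left]
  simp only [one_smul, mul_neg]
  linear_combination (norm := module) -e

theorem comp_two_one_orthogonal (ha : a ∈ evenImaginary N) (hb : b ∈ evenImaginary N)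
    (hab : N.b a b = 0) :
    h.comp (j + 2) (superBracket 0 0 (h.offDiagDer j a) (h.offDiagDer j b)) 1
      = (2 : k) • (a * b) := by
  have e := h.mul_comm_of_orthogonal ha hb hab
  rw [h.comp_superBracket_offDiagDer_two hk ha.1 hb.1 j h.one_mem, h.one_paraProduct,
    h.one_paraProduct, paraProduct_apply, paraProduct_apply, h.conj_conj, h.conj_conj,
    h.conj_of_form_one_eq_zero ha.2, h.conj_of_form_one_eq_zero hb.2, superSign_zero_left,
    neg_mul, e, neg_mul]
  module

variable (hc : c ∈ evenImaginary N)
include hc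

theorem comp_zero_one_mul : h.comp j (superBracket 0 0 (h.offDiagDer j c) (h.offDiagDer j 1)) 1
    = -(4 : k) • c := by
  rw [h.comp_superBracket_offDiagDer_zero hk, hc.2, h.form_one_one]
  module

theorem comp_one_mul {r : ZMod 2} {x : C} (hx : x ∈ 𝒞 r) :
    h.comp (j + 1) (superBracket 0 0 (h.offDiagDer j c) (h.offDiagDer j 1)) x
      = (2 : k) • (x * c) := by
  rw [h.comp_superBracket_offDiagDer_one hk hc.1 h.one_mem j hx, h.paraProduct_one,
    h.conj_paraProduct hc.1 hx, h.one_paraProduct, paraProduct_apply, h.conj_conj,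
    h.conj_of_form_one_eq_zero hc.2, superSign_zero_left, superSign_zero_left, mul_neg]
  module

theorem comp_two_mul {r : ZMod 2} {x : C} (hx : x ∈ 𝒞 r) :
    h.comp (j + 2) (superBracket 0 0 (h.offDiagDer j c) (h.offDiagDer j 1)) x
      = (2 : k) • (c * x) := by
  rw [h.comp_superBracket_offDiagDer_two hk hc.1 h.one_mem j hx, h.paraProduct_one,
    h.one_paraProduct, h.conj_paraProduct hx hc.1, paraProduct_apply, h.conj_conj,
    h.conj_of_form_one_eq_zero hc.2, superSign_zero_left, superSign_zero_left, superSign_zero_right,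
    neg_mul]
  module

end Inner

/-- In component `i = (i + 2) + 1` both brackets used act as multiples of right multiplication by
`c`, because `c` is nuclear and anticommutes with `a`; the coefficient `2⁻¹ b(a,a)` makes them
cancel. On `1` in component `i + 1` they add up to `-2 b(a,a) c`, which explains the scalar in
front. -/
theorem exists_mem_inder_of_orthogonal {a c : C} (hc : IsImaginaryNuclear N 0 c)
    (ha : a ∈ evenImaginary N) (ha0 : N.b a a ≠ 0) (hac : N.b a c = 0) (i : Fin 3) :
    ∃ t ∈ inderHermitian h, t ∈ h.diagDer 0 ∧ h.comp i t = 0 ∧ h.comp (i + 1) t 1 = c := by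
  have hc' : c ∈ evenImaginary N := ⟨hc.mem, hc.form_one⟩
  have mac := h.mul_mem_evenImaginary ha hc' hac
  have hao : N.b a (a * c) = 0 := by
    rw [QuadraticSuperform.form_comm ha.1 mac.1, h.form_mul_left_self ha hc']
  have d1 := h.superBracket_offDiagDer_self_mem hk ha.1 mac.1 (i + 2)
  have d2 := h.superBracket_offDiagDer_self_mem hk hc.mem h.one_mem (i + 2)
  rw [add_zero] at d1 d2
  refine ⟨(-(2 * N.b a a)⁻¹) • (superBracket 0 0 (h.offDiagDer (i + 2) a)
    (h.offDiagDer (i + 2) (a * c)) - (2⁻¹ * N.b a a) • superBracket 0 0 (h.offDiagDer (i + 2) c)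
    (h.offDiagDer (i + 2) 1)), Submodule.smul_mem _ _ (sub_mem
      (h.superBracket_offDiagDer_mem_inder hk _ ha.1 mac.1)
      (Submodule.smul_mem _ _ (h.superBracket_offDiagDer_mem_inder hk _ hc.mem h.one_mem))),
    Submodule.smul_mem _ _ (sub_mem d1 (Submodule.smul_mem _ _ d2)), ?_, ?_⟩
  · ext x
    induction x using superspace_induction 𝒞 with
    | hom r x hx =>
      have e1 := h.comp_one_orthogonal (i + 2) hk ha mac hao hx
      have e2 := h.comp_one_mul hk (i + 2) hc' hx
      have mxa := h.mul_mem _ _ _ hx _ ha.1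
      rw [← hc.right _ _ _ hx _ ha.1, hc.middle _ _ _ mxa _ ha.1,
        h.mul_comm_of_orthogonal ha hc' hac, mul_neg, ← hc.right _ _ _ mxa _ ha.1, smul_neg,
        ← smul_mul_assoc, h.mul_mul_self ha hx, smul_mul_assoc] at e1
      rw [Fin.three_add_two_add_one] at e1 e2
      rw [map_smul, map_sub, map_smul, LinearMap.smul_apply, LinearMap.sub_apply,
        LinearMap.smul_apply, e1, e2, LinearMap.zero_apply]
      match_scalars
      field_simp
      ring
    | add x y hx hy => rw [map_add, hx, hy, map_add]
  · have e1 := h.comp_two_one_orthogonal hk (i + 2) ha mac hao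
    have e2 := h.comp_two_mul hk (i + 2) hc' h.one_mem
    rw [h.mul_self_mul ha hc.mem] at e1
    rw [Fin.three_add_two_add_two] at e1 e2
    rw [map_smul, map_sub, map_smul, LinearMap.smul_apply, LinearMap.sub_apply,
      LinearMap.smul_apply, e1, e2, mul_one]
    match_scalars
    field_simp
    ring

omit hk in
-- For orthogonal `x, y` the vector `b(y,c) x - b(x,c) y` is orthogonal to `c`. If all three such
-- vectors from `u, v, w` were isotropic, their norms would combine to `2 b(v,c)² b(w,c)² b(u,u) =
-- 0`.
theorem exists_orthogonal_of_triple {u v w : C} (hk : (2 : k) ≠ 0) (hu : u ∈ evenImaginary N)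
    (hv : v ∈ evenImaginary N) (hw : w ∈ evenImaginary N) (hu0 : N.b u u ≠ 0) (hv0 : N.b v v ≠ 0)
    (hw0 : N.b w w ≠ 0) (huv : N.b u v = 0) (huw : N.b u w = 0) (hvw : N.b v w = 0) (c : C) :
    ∃ a ∈ evenImaginary N, N.b a a ≠ 0 ∧ N.b a c = 0 := by
  by_contra! H
  have key : ∀ {x y}, x ∈ evenImaginary N → y ∈ evenImaginary N → N.b x y = 0 →
      N.b y c * N.b y c * N.b x x + N.b x c * N.b x c * N.b y y = 0 := fun {x y} hx hy hxy => by
    by_contra h0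
    refine H (N.b y c • x - N.b x c • y) (sub_mem (Submodule.smul_mem _ _ hx)
      (Submodule.smul_mem _ _ hy)) (fun e => h0 ?_) ?_
    · simp only [map_sub, map_smul, LinearMap.sub_apply, LinearMap.smul_apply, smul_eq_mul, hxy,
        QuadraticSuperform.form_comm hy.1 hx.1] at e
      linear_combination e
    · simp only [map_sub, map_smul, LinearMap.sub_apply, LinearMap.smul_apply, smul_eq_mul]
      ring
  have e1 := key hu hv huv
  have e2 := key hu hw huw
  have e3 := key hv hw hvw
  have : 2 * (N.b v c * N.b v c) * (N.b w c * N.b w c) * N.b u u = 0 := by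
    linear_combination N.b w c * N.b w c * e1 + N.b v c * N.b v c * e2 - N.b u c * N.b u c * e3
  exact mul_ne_zero (mul_ne_zero (mul_ne_zero hk (mul_self_ne_zero.2 (H v hv hv0)))
    (mul_self_ne_zero.2 (H w hw hw0))) hu0 this

/-- The square of an odd element is a multiple of `c`, and the composition identities force that
multiple to be zero. Hence `2 u v = -b(u,v) 1` for odd `u, v`, and `(c u) v = c (u v)` shows that
`b(u,v) c` is a multiple of `1`; so the form is zero on the odd part. -/
theorem odd_eq_zero_of_isImaginaryNuclear {c u : C} (hc : IsImaginaryNuclear N 0 c)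
    (hc0 : N.b c c ≠ 0) (H : ∀ x ∈ evenImaginary N, N.b x c = 0 → x = 0) (hu : u ∈ 𝒞 1) :
    u = 0 := by
  have hc' : c ∈ evenImaginary N := ⟨hc.mem, hc.form_one⟩
  have comm : ∀ u ∈ 𝒞 1, u * c = -(c * u) := fun u hu => by
    have := h.mul_add_mul hc.mem hc.form_one hu (h.form_one_of_odd hu)
    rw [QuadraticSuperform.form_eq_zero (by decide) hc.mem hu, superSign_zero_left, neg_zero,
      zero_smul, one_smul] at this
    linear_combination (norm := module) this
  have sq : ∀ u ∈ 𝒞 1, u * u = 0 := fun u hu => by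
    have hu1 := h.form_one_of_odd hu
    have hcu : c * u ∈ 𝒞 1 := by simpa using h.mul_mem _ _ _ hc.mem _ hu
    have huu : u * u ∈ evenImaginary N := by
      refine ⟨ZMod.one_add_one_eq_zero ▸ h.mul_mem 1 1 u hu u hu, ?_⟩
      have e := N.supersymmetric _ _ _ hu _ hu
      rw [superSign_one_one] at e
      rw [h.form_mul_left_of_imaginary hu hu1 hu h.one_mem, mul_one]
      have : 2 * N.b u u = 0 := by linear_combination e
      rw [(mul_eq_zero.1 this).resolve_left hk, mul_zero]
    obtain ⟨l, hl⟩ : ∃ l : k, u * u = l • c := by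
      refine ⟨N.b (u * u) c * (N.b c c)⁻¹, sub_eq_zero.1 (H _ (sub_mem huu
        (Submodule.smul_mem _ _ hc')) ?_)⟩
      rw [map_sub, map_smul, LinearMap.sub_apply, LinearMap.smul_apply, smul_eq_mul, mul_assoc,
        inv_mul_cancel₀ hc0, mul_one, sub_self]
    have e1 : N.b u (c * u) = -(l * N.b c c) := by
      have := h.form_mul_left_of_imaginary hu hu1 hu hc.mem
      rw [hl, comm u hu, map_smul, map_neg, superSign_one_one, LinearMap.smul_apply,
        smul_eq_mul] at this
      linear_combination this
    have e2 := h.mul_mul_add_mul_mul hu hu1 hcu (h.form_one_of_odd hcu) hu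
    have e3 := h.mul_self_mul hc' h.one_mem
    have e4 := h.mul_mul_self hc' hu
    have e5 : c * u * c = -(u * c * c) := by rw [comm u hu, neg_mul, neg_neg]
    rw [mul_one] at e3
    rw [superSign_one_one, e1, hc.left _ _ _ hu _ hu, hl, mul_smul_comm, mul_smul_comm,
      mul_smul_comm, e5] at e2
    have e6 := congrArg (u * ·) e3
    simp only [mul_smul_comm, mul_one] at e6
    have e7 : (2 * (2 * l) * N.b c c) • u = 0 := by
      linear_combination (norm := module) l • e6 + l • e4 - (2 : k) • e2
    rcases smul_eq_zero.1 e7 with e8 | e8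
    · rw [hl, (mul_eq_zero.1 ((mul_eq_zero.1 ((mul_eq_zero.1 e8).resolve_right hc0)).resolve_left
        hk)).resolve_left hk, zero_smul]
    · rw [e8, mul_zero]
  have mul : ∀ u ∈ 𝒞 1, ∀ v ∈ 𝒞 1, (2 : k) • (u * v) = -N.b u v • (1 : C) := fun u hu v hv => by
    have e1 := h.mul_add_mul hu (h.form_one_of_odd hu) hv (h.form_one_of_odd hv)
    have e2 := sq _ (add_mem hu hv)
    rw [add_mul, mul_add, mul_add, sq u hu, sq v hv, zero_add, add_zero] at e2
    rw [superSign_one_one] at e1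
    linear_combination (norm := module) e1 + e2
  refine h.regular.nondegenerate_odd u hu fun v hv => ?_
  have hcu : c * u ∈ 𝒞 1 := by simpa using h.mul_mem _ _ _ hc.mem _ hu
  have e1 := mul _ hcu v hv
  rw [hc.left _ _ _ hu _ hv, ← mul_smul_comm, mul u hu v hv, mul_smul_comm, mul_one] at e1
  have e2 := congrArg (fun x => N.b x c) e1
  simp only [map_smul, LinearMap.smul_apply, smul_eq_mul, h.form_one_left, hc.form_one,
    mul_zero] at e2
  exact neg_eq_zero.1 ((mul_eq_zero.1 e2).resolve_right hc0)

omit h hk in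
/-- `C` is the two-dimensional Hurwitz algebra with basis `1, c`, where `c` is orthogonal to `1`. -/
structure _root_.IsBinary (N : QuadraticSuperform 𝒞) (c : C) : Prop where
  mem : c ∈ evenImaginary N
  form_ne_zero : N.b c c ≠ 0
  exists_eq : ∀ x, ∃ r s : k, x = r • (1 : C) + s • c

omit hk in
theorem mul_comm_of_isBinary {c : C} (hc : IsBinary N c) (x y : C) : x * y = y * x := by
  obtain ⟨r, s, rfl⟩ := hc.exists_eq x
  obtain ⟨t, u, rfl⟩ := hc.exists_eq y
  simp only [add_mul, mul_add, smul_mul_assoc, mul_smul_comm, one_mul, mul_one]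
  module

omit hk in
theorem mem_even_of_isBinary {c : C} (hc : IsBinary N c) (x : C) : x ∈ 𝒞 0 := by
  obtain ⟨r, s, rfl⟩ := hc.exists_eq x
  exact add_mem (Submodule.smul_mem _ _ h.one_mem) (Submodule.smul_mem _ _ hc.mem.1)

theorem isBinary_of_isImaginaryNuclear {c : C} (hc : IsImaginaryNuclear N 0 c)
    (hc0 : N.b c c ≠ 0) (H : ∀ x ∈ evenImaginary N, N.b x c = 0 → x = 0) : IsBinary N c where
  mem := ⟨hc.mem, hc.form_one⟩
  form_ne_zero := hc0
  exists_eq x := by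
    induction x using superspace_induction 𝒞 with
    | hom i x hx =>
      rcases zmod_two_cases i with rfl | rfl
      · refine ⟨2⁻¹ * N.b x 1, N.b x c * (N.b c c)⁻¹, ?_⟩
        have hx' : x - (2⁻¹ * N.b x 1) • (1 : C) - (N.b x c * (N.b c c)⁻¹) • c
            ∈ evenImaginary N := by
          refine ⟨sub_mem (sub_mem hx (Submodule.smul_mem _ _ h.one_mem))
            (Submodule.smul_mem _ _ hc.mem), ?_⟩
          simp only [map_sub, map_smul, LinearMap.sub_apply, LinearMap.smul_apply, smul_eq_mul,
            h.form_one_one, hc.form_one]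
          field_simp
          ring
        have := H _ hx' (by
          simp only [map_sub, map_smul, LinearMap.sub_apply, LinearMap.smul_apply, smul_eq_mul,
            h.form_one_left, hc.form_one]
          field_simp
          ring)
        linear_combination (norm := module) this
      · exact ⟨0, 0, by rw [h.odd_eq_zero_of_isImaginaryNuclear hk hc hc0 H hx]; simp⟩
    | add x y hx hy =>
      obtain ⟨r, s, rfl⟩ := hx
      obtain ⟨t, u, rfl⟩ := hy
      exact ⟨r + t, s + u, by module⟩

/-- With two orthogonal nonisotropic imaginary elements `a, b`, the triple `a, b, a b` provides a
nonisotropic element orthogonal to `c`. Otherwise the even imaginary part is at most a line, spanned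
by `c` if `c ≠ 0`. -/
theorem mem_inder_or_isBinary {p : ZMod 2} {d : Module.End k (HermitianSpace N)}
    (hd : d ∈ h.diagDer p) {i : Fin 3} (hd0 : h.comp i d = 0) :
    d ∈ inderHermitian h ∨ p = 0 ∧ IsBinary N (h.comp (i + 1) d 1) := by
  have hc := h.isImaginaryNuclear_comp hk hd hd0
  have zero : h.comp (i + 1) d 1 = 0 → d ∈ inderHermitian h := fun e => by
    rw [h.eq_zero_of_comp_eq_zero hk hd hd0 e]
    exact zero_mem _
  rcases zmod_two_cases p with rfl | rfl
  swap
  · exact .inl (zero (h.eq_zero_of_isImaginaryNuclear_odd hk hc))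
  rcases h.even_trichotomy hk with H | ⟨a, ha, ha0, H⟩ | ⟨a, ha, b, hb, ha0, hb0, hab⟩
  · exact .inl (zero (H _ ⟨hc.mem, hc.form_one⟩))
  · by_cases hc0 : h.comp (i + 1) d 1 = 0
    · exact .inl (zero hc0)
    refine .inr ⟨rfl, h.isBinary_of_isImaginaryNuclear hk hc ?_ ?_⟩
    all_goals
      set c := h.comp (i + 1) d 1
      have hca : c = (N.b c a * (N.b a a)⁻¹) • a := sub_eq_zero.1 (H _ (sub_mem
        ⟨hc.mem, hc.form_one⟩ (Submodule.smul_mem _ _ ha)) (by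
          rw [map_sub, map_smul, LinearMap.sub_apply, LinearMap.smul_apply, smul_eq_mul, mul_assoc,
            inv_mul_cancel₀ ha0, mul_one, sub_self]))
      generalize N.b c a * (N.b a a)⁻¹ = g at hca
      have hg : g ≠ 0 := by
        rintro rfl
        exact hc0 (by rw [hca, zero_smul])
      rw [hca]
    · simp [hg, ha0]
    · intro x hx hxa
      rw [map_smul, smul_eq_mul] at hxa
      exact H x hx ((mul_eq_zero.1 hxa).resolve_left hg)
  · left
    have mab := h.mul_mem_evenImaginary ha hb hab
    have mab0 : N.b (a * b) (a * b) ≠ 0 := fun H => by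
      have := h.form_mul_mul_evenImaginary ha hb.1
      rw [H, mul_zero] at this
      exact mul_ne_zero ha0 hb0 this.symm
    obtain ⟨w, hw, hw0, hwc⟩ := h.exists_orthogonal_of_triple hk ha hb mab ha0 hb0 mab0 hab
      (by rw [QuadraticSuperform.form_comm ha.1 mab.1, h.form_mul_left_self ha hb])
      (by rw [QuadraticSuperform.form_comm hb.1 mab.1, h.form_mul_right_self ha hb])
      (h.comp (i + 1) d 1)
    obtain ⟨t, ht, htd, ht0, ht1⟩ := h.exists_mem_inder_of_orthogonal hk hc hw hw0 hwc i
    have := h.eq_zero_of_comp_eq_zero hk (sub_mem hd htd) (i := i)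
      (by rw [map_sub, hd0, ht0, sub_self])
      (by rw [map_sub, LinearMap.sub_apply, ht1, sub_self])
    rwa [sub_eq_zero.1 this]

/-- The bracket `[D_j(c), D_j(1)]` acts on `1` with weights `-4, 2, 2` in components `j, j + 1, j +
2`. The difference for `j = i + 1` and `j = i + 2` has weights `0, -6, 6` in components `i, i + 1, i
+ 2`; this is where `3` must be invertible. -/
theorem mem_inder_of_isBinary (h3 : (3 : k) ≠ 0) {d : Module.End k (HermitianSpace N)}
    (hd : d ∈ h.diagDer 0) {i : Fin 3} (hd0 : h.comp i d = 0)
    (hc : IsBinary N (h.comp (i + 1) d 1)) : d ∈ inderHermitian h := by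
  set c := h.comp (i + 1) d 1 with hcd
  have d1 := h.superBracket_offDiagDer_self_mem hk hc.mem.1 h.one_mem (i + 1)
  have d2 := h.superBracket_offDiagDer_self_mem hk hc.mem.1 h.one_mem (i + 2)
  rw [add_zero] at d1 d2
  set t := (-(6 : k)⁻¹) • (superBracket 0 0 (h.offDiagDer (i + 1) c) (h.offDiagDer (i + 1) 1)
    - superBracket 0 0 (h.offDiagDer (i + 2) c) (h.offDiagDer (i + 2) 1)) with ht
  have htd : t ∈ h.diagDer 0 := Submodule.smul_mem _ _ (sub_mem d1 d2)
  have hti : t ∈ inderHermitian h := Submodule.smul_mem _ _ (sub_mem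
    (h.superBracket_offDiagDer_mem_inder hk _ hc.mem.1 h.one_mem)
    (h.superBracket_offDiagDer_mem_inder hk _ hc.mem.1 h.one_mem))
  have ht0 : h.comp i t = 0 := by
    ext x
    have hx := h.mem_even_of_isBinary hc x
    have e1 := h.comp_two_mul hk (i + 1) hc.mem hx
    have e2 := h.comp_one_mul hk (i + 2) hc.mem hx
    rw [Fin.three_add_one_add_two] at e1
    rw [Fin.three_add_two_add_one] at e2
    rw [ht, map_smul, map_sub, LinearMap.smul_apply, LinearMap.sub_apply, e1, e2,
      h.mul_comm_of_isBinary hc x, sub_self, smul_zero, LinearMap.zero_apply]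
  have ht1 : h.comp (i + 1) t 1 = c := by
    have e1 := h.comp_zero_one_mul hk (i + 1) hc.mem
    have e2 := h.comp_two_mul hk (i + 2) hc.mem h.one_mem
    rw [Fin.three_add_two_add_two] at e2
    have h6 : (6 : k) ≠ 0 := by
      rw [show (6 : k) = 2 * 3 by norm_num]
      exact mul_ne_zero hk h3
    rw [ht, map_smul, map_sub, LinearMap.smul_apply, LinearMap.sub_apply, e1, e2, mul_one]
    match_scalars
    field_simp
    ring
  have := h.eq_zero_of_comp_eq_zero hk (sub_mem hd htd) (i := i)
    (by rw [map_sub, hd0, ht0, sub_self])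
    (by rw [map_sub, LinearMap.sub_apply, ht1, sub_self])
  rwa [sub_eq_zero.1 this]

/-- A derivation of `J` is inner up to a derivation that annihilates the diagonal idempotents and
one of the off-diagonal components. -/
theorem exists_sub_mem_inder {p : ZMod 2} {X : Module.End k (HermitianSpace N)}
    (hX : X ∈ homogeneousDerivations (hermitianGrading N) (jordanProduct h) p) (i : Fin 3) :
    ∃ d ∈ h.diagDer p, h.comp i d = 0 ∧ X - d ∈ inderHermitian h := by
  obtain ⟨d, hd, a, ha, rfl⟩ := h.exists_diagDer_add_sum hk hX
  obtain ⟨t, ht, htd, hti⟩ := h.exists_mem_inder_comp_eq hk hd i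
  refine ⟨d - t, sub_mem hd htd, by rw [map_sub, hti, sub_self], ?_⟩
  rw [show d + ∑ i, h.offDiagDer i (a i) - (d - t) = t + ∑ i, h.offDiagDer i (a i) by abel]
  exact add_mem ht (Submodule.sum_mem _ fun i _ => h.offDiagDer_mem_inder hk i (ha i))

theorem mem_inder_of_mem_homogeneousDerivations {p : ZMod 2}
    (H : p = 0 → ∀ c, IsBinary N c → (3 : k) ≠ 0) {X : Module.End k (HermitianSpace N)}
    (hX : X ∈ homogeneousDerivations (hermitianGrading N) (jordanProduct h) p) :
    X ∈ inderHermitian h := by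
  obtain ⟨d, hd, hd0, hXd⟩ := h.exists_sub_mem_inder hk hX 0
  rw [← sub_add_cancel X d]
  refine add_mem hXd ?_
  rcases h.mem_inder_or_isBinary hk hd hd0 with hdi | ⟨rfl, hb⟩
  · exact hdi
  · exact h.mem_inder_of_isBinary hk (H rfl _ hb) hd hd0 hb

theorem derHermitian_eq_inderHermitian (H : ∀ c, IsBinary N c → (3 : k) ≠ 0) :
    derHermitian h = inderHermitian h :=
  le_antisymm (sup_le (fun _ hX => h.mem_inder_of_mem_homogeneousDerivations hk (fun _ => H) hX)
    fun _ hX => h.mem_inder_of_mem_homogeneousDerivations hk (fun _ => H) hX)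
    (h.inderHermitian_le_der hk)

end IsHurwitzSuperalgebra
end Nucleus

/-! ### The case of dimension two, and the outer derivation in characteristic 3. -/

section Binary

variable {k C : Type*} [Field k] [NonAssocRing C] [Module k C]
  [IsScalarTower k C C] [SMulCommClass k C C]
  {𝒞 : ZMod 2 → Submodule k C} [DirectSum.Decomposition 𝒞] {N : QuadraticSuperform 𝒞}

open HermitianSpace

namespace IsHurwitzSuperalgebra

variable (h : IsHurwitzSuperalgebra 𝒞 N)
include h

theorem linearIndependent_one_pair {w : C} (hk : (2 : k) ≠ 0) (hw0 : w ≠ 0)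
    (hw1 : N.b w 1 = 0) : LinearIndependent k ![1, w] := by
  refine (LinearIndependent.pair_iff' h.one_ne_zero).2 fun r hr => hw0 ?_
  have := congrArg (fun x => N.b x 1) hr
  simp only [map_smul, LinearMap.smul_apply, smul_eq_mul, h.form_one_one, hw1] at this
  rw [← hr, (mul_eq_zero.1 this).resolve_right hk, zero_smul]

theorem finrank_of_isBinary (hk : (2 : k) ≠ 0) {c : C} (hc : IsBinary N c) :
    Module.finrank k C = 2 := by
  have hli := h.linearIndependent_one_pair hk (w := c) (fun e => hc.form_ne_zero (by
    rw [e, map_zero])) hc.mem.2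
  have hs : Submodule.span k (Set.range ![1, c]) = ⊤ := by
    refine eq_top_iff.2 fun x _ => ?_
    obtain ⟨r, s, rfl⟩ := hc.exists_eq x
    rw [Matrix.range_cons, Matrix.range_cons, Matrix.range_empty, Set.union_empty,
      Set.singleton_union]
    exact Submodule.mem_span_pair.2 ⟨r, s, rfl⟩
  have := finrank_span_eq_card hli
  rwa [hs, finrank_top, Fintype.card_fin] at this

theorem exists_isBinary (hk : (2 : k) ≠ 0) (hf : Module.finrank k C = 2) :
    ∃ c, IsBinary N c := by
  obtain ⟨p, w, hw, hw0, hw1⟩ : ∃ p, ∃ w ∈ 𝒞 p, w ≠ 0 ∧ N.b w 1 = 0 := by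
    by_contra! H
    have hone : ∀ x : C, ∃ r : k, r • (1 : C) = x := fun x => by
      induction x using superspace_induction 𝒞 with
      | hom p x hx =>
        refine ⟨2⁻¹ * N.b x 1, ?_⟩
        by_contra hne
        refine H p (x - (2⁻¹ * N.b x 1) • (1 : C)) ?_ (sub_ne_zero.2 (Ne.symm hne)) ?_
        · refine sub_mem hx ?_
          rcases zmod_two_cases p with rfl | rfl
          · exact Submodule.smul_mem _ _ h.one_mem
          · rw [h.form_one_of_odd hx, mul_zero, zero_smul]
            exact zero_mem _
        · rw [map_sub, map_smul, LinearMap.sub_apply, LinearMap.smul_apply, h.form_one_one,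
            smul_eq_mul]
          linear_combination -N.b x 1 * inv_mul_cancel₀ hk
      | add x y hx hy =>
        obtain ⟨r, rfl⟩ := hx
        obtain ⟨s, rfl⟩ := hy
        exact ⟨r + s, add_smul _ _ _⟩
    have := finrank_le_one (1 : C) hone
    omega
  have hex : ∀ x, ∃ r s : k, x = r • (1 : C) + s • w := fun x => by
    have hs := (h.linearIndependent_one_pair hk hw0 hw1).span_eq_top_of_card_eq_finrank
      (by rw [hf, Fintype.card_fin])
    rw [Matrix.range_cons, Matrix.range_cons, Matrix.range_empty, Set.union_empty,
      Set.singleton_union] at hs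
    obtain ⟨r, s, e⟩ := Submodule.mem_span_pair.1 (hs ▸ Submodule.mem_top : x ∈ _)
    exact ⟨r, s, e.symm⟩
  have hww : N.b w w ≠ 0 := fun H => by
    obtain ⟨y, -, hwy⟩ := h.exists_form_ne_zero hw hw0
    obtain ⟨r, s, rfl⟩ := hex y
    exact hwy (by simp [hw1, H])
  rcases zmod_two_cases p with rfl | rfl
  · exact ⟨w, ⟨hw, hw1⟩, hww, hex⟩
  -- An odd `w` would be isotropic, as the form is alternating on the odd part.
  · have := N.supersymmetric _ _ _ hw _ hw
    rw [superSign_one_one] at this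
    exact absurd ((mul_eq_zero.1 (by linear_combination this : 2 * N.b w w = 0)).resolve_left hk) hww

variable {c : C} (hc : IsBinary N c)
include hc

theorem mul_assoc_of_isBinary (x y z : C) : x * y * z = x * (y * z) := by
  obtain ⟨r, s, rfl⟩ := hc.exists_eq x
  obtain ⟨t, u, rfl⟩ := hc.exists_eq y
  obtain ⟨v, w, rfl⟩ := hc.exists_eq z
  have e := h.mul_comm_of_isBinary hc (c * c) c
  simp only [add_mul, mul_add, smul_mul_assoc, mul_smul_comm, one_mul, mul_one, e]

omit h hc in
/-- The endomorphism of `J` that annihilates the diagonal and acts on the off-diagonal components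
as the multiplications by the multiples `w i • c` of `c`. -/
def weightedMul (h : IsHurwitzSuperalgebra 𝒞 N) (w : Fin 3 → k) (c : C) :
    Module.End k (HermitianSpace N) :=
  ∑ j, w j • (h.offDiag j ∘ₗ LinearMap.mulLeft k c ∘ₗ offDiagCoord N j)

omit hc in
theorem weightedMul_apply (w : Fin 3 → k) (c : C) (X : HermitianSpace N) :
    h.weightedMul w c X = ∑ j, w j • h.offDiag j (c * offDiagCoord N j X) := by
  simp [weightedMul]

omit hc in
theorem weightedMul_diag (w : Fin 3 → k) (c : C) (i : Fin 3) :
    h.weightedMul w c (h.diag i) = 0 := by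
  rw [weightedMul_apply, Finset.sum_eq_zero fun j _ => by
    rw [h.offDiagCoord_diag, mul_zero, map_zero, smul_zero]]

variable (hk : (2 : k) ≠ 0)
include hk

omit hc in
theorem weightedMul_offDiag (w : Fin 3 → k) (c : C) (i : Fin 3) (x : C) :
    h.weightedMul w c (h.offDiag i x) = w i • h.offDiag i (c * x) := by
  rw [weightedMul_apply, Finset.sum_eq_single i (fun j _ hj => by
    rw [h.offDiagCoord_offDiag hj, mul_zero, map_zero, smul_zero]) (by simp),
    h.offDiagCoord_offDiag_self hk]

omit hc in
theorem comp_weightedMul (w : Fin 3 → k) (c : C) (i : Fin 3) (x : C) :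
    h.comp i (h.weightedMul w c) x = w i • (c * x) := by
  rw [comp_apply, h.weightedMul_offDiag hk, map_smul, h.offDiagCoord_offDiag_self hk]

/-- Since `c̄ = -c` and `C` is commutative and associative, `(c a) • b = a • (c b) = -c (a • b)`.
The triality relation thus holds exactly because the weights have sum zero; skewness holds because
`c` is imaginary. -/
theorem weightedMul_mem_diagDer {w : Fin 3 → k} (hw : w 0 + w 1 + w 2 = 0) :
    h.weightedMul w c ∈ h.diagDer 0 := by
  refine ⟨h.mem_homogeneousDerivations hk (fun p X hX => ?_) (fun i j => ?_)
    (fun i j q b hb => ?_) (fun i q a ha r b hb => ?_) fun i q a ha r b hb => ?_,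
    h.weightedMul_diag w c⟩
  · rw [weightedMul_apply]
    exact Submodule.sum_mem _ fun j _ => Submodule.smul_mem _ _ (h.offDiag_mem j
      (h.mul_mem _ _ _ hc.mem.1 _ (offDiagCoord_mem j hX)))
  · rw [h.weightedMul_diag, h.weightedMul_diag, map_zero, map_zero, LinearMap.zero_apply, add_zero]
    by_cases hij : i = j
    · rw [hij, h.jordanProduct_diag_diag_self hk, h.weightedMul_diag]
    · rw [h.jordanProduct_diag_diag hij, map_zero]
  · rw [h.weightedMul_diag, map_zero, LinearMap.zero_apply, zero_add, h.weightedMul_offDiag hk,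
      map_smul]
    by_cases hij : i = j
    · rw [hij, h.jordanProduct_diag_offDiag_self, h.jordanProduct_diag_offDiag_self, map_zero,
        smul_zero]
    · rw [h.jordanProduct_diag_offDiag hij, h.jordanProduct_diag_offDiag hij, map_smul,
        h.weightedMul_offDiag hk, smul_comm]
  · rw [h.weightedMul_offDiag hk, h.weightedMul_offDiag hk, map_smul, map_smul,
      LinearMap.smul_apply, h.jordanProduct_offDiag_self hk, h.jordanProduct_offDiag_self hk,
      h.jordanProduct_offDiag_self hk, map_smul, map_add, h.weightedMul_diag, h.weightedMul_diag,
      superSign_zero_left, h.form_mul_left_of_imaginary hc.mem.1 hc.mem.2 ha hb,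
      superSign_zero_left]
    module
  · have hw' : w i + w (i + 1) + w (i + 2) = 0 := by
      fin_cases i
      · exact hw
      · exact Eq.trans (show w 1 + w 2 + w 0 = w 0 + w 1 + w 2 by ring) hw
      · exact Eq.trans (show w 2 + w 0 + w 1 = w 0 + w 1 + w 2 by ring) hw
    have e0 := h.conj_of_form_one_eq_zero hc.mem.2
    have e1 : paraProduct N (c * a) b = -(c * paraProduct N a b) := by
      rw [paraProduct_apply, paraProduct_apply, standardInvolution_mul h hc.mem.1 ha, e0,
        superSign_zero_left, one_smul, h.mul_comm_of_isBinary hc _ (-c),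
        h.mul_assoc_of_isBinary hc, neg_mul]
    have e2 : paraProduct N a (c * b) = -(c * paraProduct N a b) := by
      rw [paraProduct_apply, paraProduct_apply, standardInvolution_mul h hc.mem.1 hb, e0,
        superSign_zero_left, one_smul, ← h.mul_assoc_of_isBinary hc,
        h.mul_comm_of_isBinary hc _ (-c), neg_mul]
    rw [h.weightedMul_offDiag hk, h.weightedMul_offDiag hk, map_smul, map_smul,
      LinearMap.smul_apply, h.jordanProduct_offDiag_succ hk, h.jordanProduct_offDiag_succ hk,
      h.jordanProduct_offDiag_succ hk, h.weightedMul_offDiag hk, e1, e2, superSign_zero_left,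
      map_neg, eq_neg_of_add_eq_zero_right hw']
    module

omit h hc hk in
/-- A derivation of `J` that is not inner in characteristic `3`. -/
def outerDer (h : IsHurwitzSuperalgebra 𝒞 N) (c : C) :
    Module.End k (HermitianSpace N) :=
  h.weightedMul ![0, 1, -1] c

theorem outerDer_mem : h.outerDer c ∈ h.diagDer 0 :=
  h.weightedMul_mem_diagDer hc hk (by simp)

omit hc in
theorem comp_offDiagDer (i j : Fin 3) (a x : C) (hx : x ∈ 𝒞 0) (ha : a ∈ 𝒞 0) :
    h.comp j (h.offDiagDer i a) x = 0 := by
  rw [comp_apply]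
  rcases Fin.three_cases i j with rfl | rfl | rfl
  · rw [h.offDiagDer_offDiag_self hk, map_smul, map_sub, h.offDiagCoord_diag, h.offDiagCoord_diag,
      sub_self, smul_zero]
  · rw [h.offDiagDer_offDiag_one hk, map_neg,
      h.offDiagCoord_offDiag (Fin.three_add_one_ne_add_two i), neg_zero]
  · rw [h.offDiagDer_offDiag_two hk i ha hx, map_smul,
      h.offDiagCoord_offDiag (Fin.three_add_one_ne_add_two i).symm, smul_zero]

/-- As `-4 = 2` in characteristic 3, a bracket `[D_i(a), D_i(b)]` takes the same value on `1` in all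
three components, and `D_i(a)` contributes zero. These are linear conditions, so checking generators
suffices. The weights `(0, 1, -1)` violate them. -/
theorem comp_one_eq_of_mem_inder (h3 : (3 : k) = 0) {X : Module.End k (HermitianSpace N)}
    (hX : X ∈ inderHermitian h) (i : Fin 3) : h.comp (i + 1) X 1 = h.comp i X 1 := by
  let f : Fin 3 → Module.End k (HermitianSpace N) →ₗ[k] C := fun j =>
    LinearMap.applyₗ 1 ∘ₗ h.comp j
  have hle : inderHermitian h ≤ ⨅ j, LinearMap.ker (f j - f 0) := by
    have ev := h.mem_even_of_isBinary hc
    have key : ∀ i j a b, h.comp j (superBracket 0 0 (h.offDiagDer i a) (h.offDiagDer i b)) 1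
        = N.b b 1 • a - N.b a 1 • b := fun i j a b => by
      have h2 : (2 : k) = -1 := by linear_combination h3
      rcases Fin.three_cases i j with rfl | rfl | rfl
      · rw [h.comp_superBracket_offDiagDer_zero hk, superSign_zero_left, h2]
        module
      · rw [h.comp_superBracket_offDiagDer_one hk (ev a) (ev b) i h.one_mem, h.paraProduct_one,
          h.paraProduct_one, paraProduct_apply, paraProduct_apply, h.conj_conj, h.conj_conj,
          standardInvolution_apply, standardInvolution_apply, superSign_zero_left, mul_sub, mul_sub,
          mul_smul_comm, mul_smul_comm, mul_one a, mul_one b, h.mul_comm_of_isBinary hc b a]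
        module
      · rw [h.comp_superBracket_offDiagDer_two hk (ev a) (ev b) i h.one_mem, h.one_paraProduct,
          h.one_paraProduct, paraProduct_apply, paraProduct_apply, h.conj_conj, h.conj_conj,
          standardInvolution_apply, standardInvolution_apply, superSign_zero_left, sub_mul, sub_mul,
          smul_mul_assoc, smul_mul_assoc, one_mul a, one_mul b, h.mul_comm_of_isBinary hc b a]
        module
    refine h.inderHermitian_le hk (fun i p a _ => ?_) fun i p a ha q b hb => ?_
    · simp [f, Submodule.mem_iInf, h.comp_offDiagDer hk _ _ _ _ h.one_mem (ev a)]
    · have odd : ∀ {x}, x ∈ 𝒞 1 → x = 0 := fun {x} hx =>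
        superspace_disjoint 𝒞 zero_ne_one (ev x) hx
      rcases zmod_two_cases p with rfl | rfl
      · rcases zmod_two_cases q with rfl | rfl
        · simp [f, Submodule.mem_iInf, key]
        · rw [odd hb, map_zero, superBracket, mul_zero, zero_mul, smul_zero, sub_zero]
          exact zero_mem _
      · rw [odd ha, map_zero, superBracket, mul_zero, zero_mul, smul_zero, sub_zero]
        exact zero_mem _
  have := Submodule.mem_iInf _ |>.1 (hle hX)
  have e1 := this (i + 1)
  have e2 := this i
  rw [LinearMap.mem_ker, LinearMap.sub_apply, sub_eq_zero] at e1 e2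
  exact e1.trans e2.symm

theorem outerDer_not_mem_inder (h3 : (3 : k) = 0) : h.outerDer c ∉ inderHermitian h := fun H => by
  have := h.comp_one_eq_of_mem_inder hc hk h3 H 0
  rw [outerDer, h.comp_weightedMul hk, h.comp_weightedMul hk] at this
  simp only [mul_one, Matrix.cons_val_zero, zero_smul, zero_add, Matrix.cons_val_one,
    one_smul] at this
  exact hc.form_ne_zero (by rw [this, map_zero])

/-- Modulo inner derivations `X` is diagonal with zero component `0`, hence determined by its value
on `1` in component `1`. That value is imaginary, so it is a multiple of `c`. -/
theorem exists_sub_smul_outerDer_mem {X : Module.End k (HermitianSpace N)}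
    (hX : X ∈ homogeneousDerivations (hermitianGrading N) (jordanProduct h) 0) :
    ∃ g : k, X - g • h.outerDer c ∈ inderHermitian h := by
  obtain ⟨d, hd, hd0, hXd⟩ := h.exists_sub_mem_inder hk hX 0
  obtain ⟨r, g, hrg⟩ := hc.exists_eq (h.comp (0 + 1) d 1)
  refine ⟨g, ?_⟩
  have hr : r = 0 := by
    have e := h.form_comp_one_one hk hd hd0 (0 + 1)
    rw [hrg] at e
    simp only [map_add, map_smul, LinearMap.add_apply, LinearMap.smul_apply, h.form_one_one,
      hc.mem.2, mul_zero, add_zero, smul_eq_mul] at e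
    exact (mul_eq_zero.1 e).resolve_right hk
  have hn0 : h.comp 0 (h.outerDer c) = 0 := by
    ext x
    rw [outerDer, h.comp_weightedMul hk, Matrix.cons_val_zero, zero_smul, LinearMap.zero_apply]
  have hn1 : h.comp (0 + 1) (h.outerDer c) 1 = c := by
    rw [outerDer, h.comp_weightedMul hk, mul_one, zero_add, Matrix.cons_val_one,
      Matrix.cons_val_zero, one_smul]
  have := h.eq_zero_of_comp_eq_zero hk (sub_mem hd (Submodule.smul_mem _ g (h.outerDer_mem hc hk)))
    (i := 0) (by rw [map_sub, map_smul, hd0, hn0, smul_zero, sub_zero])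
    (by rw [map_sub, map_smul, LinearMap.sub_apply, LinearMap.smul_apply, hn1, hrg, hr, zero_smul,
      zero_add, sub_self])
  rwa [← sub_eq_zero.1 this]

theorem codimensionIn_inder_der (h3 : (3 : k) = 0) :
    codimensionIn (inderHermitian h) (derHermitian h) = 1 := by
  have hn := h.diagDer_le_der _ (h.outerDer_mem hc hk)
  refine finrank_eq_one (Submodule.Quotient.mk ⟨h.outerDer c, hn⟩) (fun H => ?_) fun w => ?_
  · exact h.outerDer_not_mem_inder hc hk h3 
      ((Submodule.Quotient.mk_eq_zero ((inderHermitian h).submoduleOf (derHermitian h))).1 H)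
  · obtain ⟨⟨X, hX⟩, rfl⟩ := Submodule.Quotient.mk_surjective _ w
    obtain ⟨d0, h0, d1, h1, rfl⟩ := Submodule.mem_sup.1 hX
    obtain ⟨g, hg⟩ := h.exists_sub_smul_outerDer_mem hc hk h0
    have h1' := h.mem_inder_of_mem_homogeneousDerivations hk (p := 1)
      (fun e => absurd e _root_.one_ne_zero) h1
    refine ⟨g, ?_⟩
    rw [← Submodule.Quotient.mk_smul, eq_comm, Submodule.Quotient.eq]
    change d0 + d1 - g • h.outerDer c ∈ inderHermitian h
    have := add_mem hg h1'
    rwa [sub_add_eq_add_sub] at this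

/-- `D_i(a)` is the bracket of `D_{i+1}(ā)` and `D_{i+2}(1)`. Conversely, odd derivations are inner
and even ones are inner up to a multiple of one fixed derivation, which commutes with itself;
brackets with inner derivations are inner. -/
theorem inderHermitian_eq_superCommutator : inderHermitian h
    = superCommutator (hermitianGrading N) (derHermitian h) (derHermitian h) := by
  refine le_antisymm (h.inderHermitian_le hk (fun i p a ha => ?_) fun i p a ha q b hb => ?_)
    (superCommutator_le fun p q f hf hfp g hg hgq => ?_)
  · have := superBracket_mem_superCommutator
      (h.homogeneousDerivations_le_der _ (h.offDiagDer_mem hk (i + 1) (standardInvolution_mem h ha)))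
      (h.offDiagDer_mem_endGrading (i + 1) (standardInvolution_mem h ha))
      (h.homogeneousDerivations_le_der _ (h.offDiagDer_mem hk (i + 1 + 1) h.one_mem))
      (h.offDiagDer_mem_endGrading (i + 1 + 1) h.one_mem)
    rwa [h.superBracket_offDiagDer_succ hk (standardInvolution_mem h ha) h.one_mem,
      h.paraProduct_one, h.conj_conj, Fin.three_add_one_add_two] at this
  · exact superBracket_mem_superCommutator
      (h.homogeneousDerivations_le_der _ (h.offDiagDer_mem hk i ha))
      (h.offDiagDer_mem_endGrading i ha)
      (h.homogeneousDerivations_le_der _ (h.offDiagDer_mem hk i hb))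
      (h.offDiagDer_mem_endGrading i hb)
  · have hf' := h.mem_homogeneousDerivations_of_mem_der hk hf hfp
    have hg' := h.mem_homogeneousDerivations_of_mem_der hk hg hgq
    have odd : ∀ {X}, X ∈ homogeneousDerivations (hermitianGrading N) (jordanProduct h) 1 →
        X ∈ inderHermitian h := fun hX => h.mem_inder_of_mem_homogeneousDerivations hk
          (fun e => absurd e _root_.one_ne_zero) hX
    rcases zmod_two_cases q with rfl | rfl
    swap
    · exact h.superBracket_mem_inder hk hf' (odd hg') hgq
    rcases zmod_two_cases p with rfl | rfl
    swap
    · rw [superBracket_swap]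
      exact Submodule.smul_mem _ _ (h.superBracket_mem_inder hk hg' (odd hf') hfp)
    have hn := (h.outerDer_mem hc hk).1
    obtain ⟨r, hr⟩ := h.exists_sub_smul_outerDer_mem hc hk hf'
    obtain ⟨s, hs⟩ := h.exists_sub_smul_outerDer_mem hc hk hg'
    have m1 := h.superBracket_mem_inder hk hf' hs (sub_mem hgq (Submodule.smul_mem _ s hn.1))
    have m2 := h.superBracket_mem_inder hk hn hr (sub_mem hfp (Submodule.smul_mem _ r hn.1))
    -- With `n` the outer derivation, `[f, g] = [f, g - s n] - s [n, f - r n]`, because `[n, n] =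
    -- 0`.
    have := sub_mem m1 (Submodule.smul_mem _ s m2)
    simp only [superBracket, superSign_zero_left, one_smul, mul_sub, sub_mul, mul_smul_comm,
      smul_mul_assoc, smul_sub] at this ⊢
    convert this using 1
    module

end IsHurwitzSuperalgebra
end Binary

/-! ### The theorem. -/

theorem mainTheorem5 {k C S : Type*} [Field k] (hk : ringChar k ≠ 2)
    [NonAssocRing C] [Module k C] [IsScalarTower k C C] [SMulCommClass k C C]
    (𝒞 : ZMod 2 → Submodule k C) [DirectSum.Decomposition 𝒞] (N : QuadraticSuperform 𝒞)
    [NonUnitalNonAssocRing S] [Module k S]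
    (𝒮 : ZMod 2 → Submodule k S) (NS : QuadraticSuperform 𝒮)
    (φ : S ≃ₗ[k] C) (hS : IsParaHurwitzOf NS N φ) :
    (¬ (ringChar k = 3 ∧ Module.finrank k S = 2) →
      IsSimpleLieSuperalgebra (hermitianGrading N) (derHermitian hS.hurwitz) ∧
      derHermitian hS.hurwitz = inderHermitian hS.hurwitz) ∧
    (ringChar k = 3 ∧ Module.finrank k S = 2 →
      IsLieSubsuperalgebra (hermitianGrading N) (derHermitian hS.hurwitz) ∧
      inderHermitian hS.hurwitz = superCommutator (hermitianGrading N)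
        (derHermitian hS.hurwitz) (derHermitian hS.hurwitz) ∧
      IsLieSuperideal (hermitianGrading N)
        (inderHermitian hS.hurwitz) (derHermitian hS.hurwitz) ∧
      IsSimpleLieSuperalgebra (hermitianGrading N) (inderHermitian hS.hurwitz) ∧
      codimensionIn (inderHermitian hS.hurwitz) (derHermitian hS.hurwitz) = 1) := by
  have h := hS.hurwitz
  have h2 : (2 : k) ≠ 0 := Ring.two_ne_zero hk
  rw [φ.finrank_eq]
  refine ⟨fun H => ?_, fun ⟨hchar, hdim⟩ => ?_⟩
  -- A binary `C` in which `3 = 0` is precisely the excluded case.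
  · have e := h.derHermitian_eq_inderHermitian h2 fun c hc h3 => H ⟨?_, h.finrank_of_isBinary h2 hc⟩
    · exact ⟨e ▸ h.isSimpleLieSuperalgebra_inder h2, e⟩
    · have hdvd : ringChar k ∣ 3 := (ringChar.spec k 3).1 (by exact_mod_cast h3)
      exact ((Nat.dvd_prime Nat.prime_three).1 hdvd).resolve_left CharP.ringChar_ne_one
  · have h3 : (3 : k) = 0 := by exact_mod_cast (ringChar.spec k 3).2 hchar.dvd
    obtain ⟨c, hc⟩ := h.exists_isBinary h2 hdim
    exact ⟨h.isLieSubsuperalgebra_der h2, h.inderHermitian_eq_superCommutator hc h2,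
      h.isLieSuperideal_inder_der h2, h.isSimpleLieSuperalgebra_inder h2,
      h.codimensionIn_inder_der hc h2 h3⟩
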